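/- For each $i\in\mathbb Z$ let $\omega_i=(\omega_i(l))_{l\in\{-2,-1,1,2\}}$ be a probability vector, and let $\{X_n\}_{n\ge0}$ be the Markov chain on $\mathbb Z$ with $P_\omega(X_{n+1}=i+l\mid X_n=i)=\omega_i(l)$ (the (2-2) random walk); $P_\omega^k$ is its law when $X_0=k$. Let $T_1=\inf\{n\ge0:X_n>0\}$. Add an imaginary first step by setting $X_{-1}=1$. **Excursions.** An excursion at $i$ is a stretch of path $X_k,X_{k+1},\dots,X_{m}$ with $m\geq k+2$, $X_{k+1},\dots,X_{m-1}\le i-1$ and $X_m\ge i$, whose first step is $i\to i-1$ (type $\mathcal A_i$), $i\to i-2$ (type $\mathcal B_i$) or $i+1\to i-1$ (type $\mathcal C_i$); it has subtype $1,2,3$ according as its last step is $i-1\to i$, $i-2\to i$, $i-1\to i+1$. For $i\le 1$ let $A_{i,j},B_{i,j},C_{i,j}$ be the numbers of excursions of type $\mathcal A_{i,j},\mathcal B_{i,j},\mathcal C_{i,j}$ that end no later than $T_1$ (the imaginary step being part of the path), and $$U_i=(A_{i,1},A_{i,2},A_{i,3},B_{i,1},B_{i,2},B_{i,3},C_{i,1},C_{i,2},C_{i,3})\in\mathbb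 N^9 .$$ **Notation.** For $k\le i<j$ let $f_k(i,j)$ be the $P_\omega^k$-probability that the first visit of the walk to $(i,\infty)$ is at $j$. Put $$S_i=\sum_{n,m\ge0}\frac{(n+m)!}{n!\,m!}\,[\omega_{i-1}(-1)f_{i-2}(i-2,i-1)]^n\,[\omega_{i-1}(-2)f_{i-3}(i-2,i-1)]^m,$$ $$\alpha_{i,1}=\omega_i(-1)S_i\,\omega_{i-1}(1),\quad \alpha_{i,3}=\omega_i(-1)S_i\,\omega_{i-1}(2),\quad \alpha_{i,2}=\omega_i(-1)-\alpha_{i,1}-\alpha_{i,3},$$ $$\beta_{i,1}=\omega_i(-2)f_{i-2}(i-2,i-1)S_i\,\omega_{i-1}(1),\quad \beta_{i,3}=\omega_i(-2)f_{i-2}(i-2,i-1)S_i\,\omega_{i-1}(2),\quad \beta_{i,2}=\omega_i(-2)-\beta_{i,1}-\beta_{i,3},$$ $$\gamma_{i,1}=\omega_{i+1}(-2)S_i\,\omega_{i-1}(1),\quad \gamma_{i,3}=\omega_{i+1}(-2)S_i\,\omega_{i-1}(2),\quad \gamma_{i,2}=\omega_{i+1}(-2)-\gamma_{i,1}-\gamma_{i,3},$$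 $$N_i(a,b,c,d)=\frac{(a+b+c+d)!}{a!\,b!\,c!\,d!}\,\alpha_{i,1}^a\alpha_{i,2}^b\beta_{i,1}^c\beta_{i,2}^d\,(1-\alpha_{i,1}-\alpha_{i,2}-\beta_{i,1}-\beta_{i,2}).$$ **Theorem 1.2.** Suppose that $\limsup_{n\to\infty}X_n=\infty$ $P_\omega^0$-a.s. Then under $P_\omega^0$ the process $U_1,U_0,U_{-1},\dots$ is a non-homogeneous 9-type branching process: for each $i\le0$, given $U_1,\dots,U_{i+1}$, the vector $U_i$ is distributed as a sum of independent offspring vectors, one for each of the particles counted by $U_{i+1}$, the law of an offspring vector depending only on $i$ and on the type of the particle. Its initial (immigration) law is, with $D=1-\omega_0(-1)f_{-1}(-1,0)-\omega_0(-2)f_{-2}(-1,0)$, $$P_\omega^0(U_1=\mathbf e_1)=\frac{\omega_0(1)}{D},\qquad P_\omega^0(U_1=\mathbf e_2)=\frac{D-\omega_0(1)-\omega_0(2)}{D},\qquad P_\omega^0(U_1=\mathbf e_3)=\frac{\omega_0(2)}{D}.$$ For $i\le0$ the offspring law of a particle of $U_{i+1}$, of any type that occurs in $U_{i+1}$ with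 positive probability, is as follows ($a,b,c,d\ge0$; all other vectors have probability $0$). It is also the conditional law of $U_i$ given $U_{i+1}=\mathbf e_t$, where $t$ is the type's place in $U_{i+1}$, whenever that event has positive probability. (a) Types $\mathcal A_{i+1,1},\mathcal A_{i+1,3},\mathcal C_{i+1,1},\mathcal C_{i+1,3}$: $(a,b,0,c,d,0,0,0,0)$ with probability $N_i(a,b,c,d)$. (b) Types $\mathcal A_{i+1,2},\mathcal C_{i+1,2}$: $(a,b,1,c,d,0,0,0,0)$ with probability $N_i(a,b,c,d)\frac{\alpha_{i,3}}{\alpha_{i,3}+\beta_{i,3}}$, and $(a,b,0,c,d,1,0,0,0)$ with probability $N_i(a,b,c,d)\frac{\beta_{i,3}}{\alpha_{i,3}+\beta_{i,3}}$. (c) Types $\mathcal B_{i+1,1},\mathcal B_{i+1,3}$: $(a,b,0,c,d,0,1,0,0)$ with probability $N_i(a,b,c,d)\frac{\gamma_{i,1}}{\gamma_{i,1}+\gamma_{i,2}}$, and $(a,b,0,c,d,0,0,1,0)$ with probability $N_i(a,b,c,d)\frac{\gamma_{i,2}}{\gamma_{i,1}+\gamma_{i,2}}$. (d) Type $\mathcal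 B_{i+1,2}$: $(0,0,0,0,0,0,0,0,1)$ with probability $\frac{\gamma_{i,3}}{\beta_{i+1,2}}$; and, with $K_i=\frac{\beta_{i+1,2}-\gamma_{i,3}}{\beta_{i+1,2}(\gamma_{i,1}+\gamma_{i,2})(\alpha_{i,3}+\beta_{i,3})}$, the vectors $(a,b,1,c,d,0,1,0,0)$, $(a,b,1,c,d,0,0,1,0)$, $(a,b,0,c,d,1,1,0,0)$, $(a,b,0,c,d,1,0,1,0)$ with probabilities $N_i(a,b,c,d)K_i$ times $\gamma_{i,1}\alpha_{i,3}$, $\gamma_{i,2}\alpha_{i,3}$, $\gamma_{i,1}\beta_{i,3}$, $\gamma_{i,2}\beta_{i,3}$ respectively. If $\beta_{i+1,2}=\gamma_{i,3}$ these four families have probability $0$. -/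

import Mathlib

open MeasureTheory ProbabilityTheory Filter

open scoped Nat

namespace TwoTwoWalk

/-! ### The walk

The transition probabilities are a family `ω : ℤ → PMF ℤ`: from the site `i` the walk jumps to
`i + l` with probability `ω i l`. -/

/-- The one-step transition kernel of the walk. -/
noncomputable def stepKernel (ω : ℤ → PMF ℤ) : Kernel ℤ ℤ :=
  Kernel.ofFunOfCountable fun i => ((ω i).map fun l => i + l).toMeasure

instance (ω : ℤ → PMF ℤ) : IsMarkovKernel (stepKernel ω) :=
  ⟨fun i => inferInstanceAs (IsProbabilityMeasure ((ω i).map fun l => i + l).toMeasure)⟩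

/-- The transition kernel from the past up to time `n` to the position at time `n + 1`;
it only looks at the position at time `n`. -/
noncomputable def pastKernel (ω : ℤ → PMF ℤ) (n : ℕ) :
    Kernel (Π _ : Finset.Iic n, ℤ) ℤ :=
  (stepKernel ω).comap (fun x => x ⟨n, Finset.mem_Iic.2 le_rfl⟩) (measurable_pi_apply _)

instance (ω : ℤ → PMF ℤ) (n : ℕ) : IsMarkovKernel (pastKernel ω n) := by
  unfold pastKernel; infer_instance

/-- The law `P_ω^k` on path space of the walk started at `k` (Ionescu-Tulcea). -/
noncomputable def walkLaw (ω : ℤ → PMF ℤ) (k : ℤ) : Measure (ℕ → ℤ) :=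
  Kernel.trajMeasure (X := fun _ => ℤ) (Measure.dirac k) (pastKernel ω)

/-- The first time the path is strictly positive (`⊤` if there is none). -/
noncomputable def ladderTime (x : ℕ → ℤ) : ℕ∞ :=
  sInf {t : ℕ∞ | ∃ n : ℕ, t = n ∧ 0 < x n}

/-! ### Excursions and their numbers -/

/-- The path with the imaginary step from `1` to the starting point put in front: the time `n` of
`x` is the time `n + 1` of `withAncestor x`. -/
def withAncestor (x : ℕ → ℤ) : ℕ → ℤ
  | 0 => 1
  | n + 1 => x n

/-- `y` makes, between the times `k` and `m + 1`, an excursion below `i` whose first step is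
`first = (y k, y (k + 1))`, whose last step is `last = (y m, y (m + 1))`, and which stays in
`(-∞, i - 1]` at all times strictly between `k` and `m + 1`. -/
def IsExcursion (y : ℕ → ℤ) (i : ℤ) (first last : ℤ × ℤ) (k m : ℕ) : Prop :=
  k < m ∧ (y k, y (k + 1)) = first ∧ (∀ n, k < n → n ≤ m → y n ≤ i - 1) ∧
    (y m, y (m + 1)) = last

/-- The number of excursions below `i` with the given first and last steps before the time `T₁`
(the time `m + 1` of `withAncestor x` is the time `m` of `x`, so the excursion ends by `T₁`). -/
noncomputable def excursionCount (x : ℕ → ℤ) (i : ℤ) (first last : ℤ × ℤ) : ℕ :=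
  Set.ncard {km : ℕ × ℕ | IsExcursion (withAncestor x) i first last km.1 km.2 ∧
    (km.2 : ℕ∞) ≤ ladderTime x}

/-- The vector `U_i = (A_{i,1}, A_{i,2}, A_{i,3}, B_{i,1}, …, C_{i,3})`, `i ≤ 1`. The first step is
`i → i - 1` for `A`, `i → i - 2` for `B`, `i + 1 → i - 1` for `C`; the last step is
`i - 1 → i` for the subtype 1, `i - 2 → i` for the subtype 2, `i - 1 → i + 1` for the subtype 3.
For `i ≤ 0` the imaginary step does not start an excursion at `i` and has no influence. -/
noncomputable def U (x : ℕ → ℤ) (i : ℤ) : Fin 9 → ℕ :=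
  ![excursionCount x i (i, i - 1) (i - 1, i),
    excursionCount x i (i, i - 1) (i - 2, i),
    excursionCount x i (i, i - 1) (i - 1, i + 1),
    excursionCount x i (i, i - 2) (i - 1, i),
    excursionCount x i (i, i - 2) (i - 2, i),
    excursionCount x i (i, i - 2) (i - 1, i + 1),
    excursionCount x i (i + 1, i - 1) (i - 1, i),
    excursionCount x i (i + 1, i - 1) (i - 2, i),
    excursionCount x i (i + 1, i - 1) (i - 1, i + 1)]

/-! ### The explicit laws -/

section Laws

variable (ω : ℤ → PMF ℤ)

/-- The jump probability `ω_i(l)` as a real number. -/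
noncomputable def jump (i l : ℤ) : ℝ := (ω i l).toReal

/-- `f_k(i, j)` for `k ≤ i < j`: the probability that the walk from `k` enters `(i, ∞)` at `j`. -/
noncomputable def exitProb (k i j : ℤ) : ℝ :=
  (walkLaw ω k).real {x | ∃ n, x n = j ∧ ∀ m < n, x m ≤ i}

/-- The sum over the numbers `n`, `m` of steps `i - 1 → i - 2` and `i - 1 → i - 3` that are
followed by a return to `i - 1` from below. -/
noncomputable def loopSum (i : ℤ) : ℝ :=
  ∑' nm : ℕ × ℕ, ((nm.1 + nm.2)! : ℝ) / ((nm.1)! * (nm.2)!) *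
    (jump ω (i - 1) (-1) * exitProb ω (i - 2) (i - 2) (i - 1)) ^ nm.1 *
    (jump ω (i - 1) (-2) * exitProb ω (i - 3) (i - 2) (i - 1)) ^ nm.2

noncomputable def α₁ (i : ℤ) : ℝ := jump ω i (-1) * loopSum ω i * jump ω (i - 1) 1

noncomputable def α₃ (i : ℤ) : ℝ := jump ω i (-1) * loopSum ω i * jump ω (i - 1) 2

noncomputable def α₂ (i : ℤ) : ℝ := jump ω i (-1) - α₁ ω i - α₃ ω i

noncomputable def β₁ (i : ℤ) : ℝ :=
  jump ω i (-2) * exitProb ω (i - 2) (i - 2) (i - 1) * loopSum ω i * jump ω (i - 1) 1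

noncomputable def β₃ (i : ℤ) : ℝ :=
  jump ω i (-2) * exitProb ω (i - 2) (i - 2) (i - 1) * loopSum ω i * jump ω (i - 1) 2

noncomputable def β₂ (i : ℤ) : ℝ := jump ω i (-2) - β₁ ω i - β₃ ω i

noncomputable def γ₁ (i : ℤ) : ℝ := jump ω (i + 1) (-2) * loopSum ω i * jump ω (i - 1) 1

noncomputable def γ₃ (i : ℤ) : ℝ := jump ω (i + 1) (-2) * loopSum ω i * jump ω (i - 1) 2

noncomputable def γ₂ (i : ℤ) : ℝ := jump ω (i + 1) (-2) - γ₁ ω i - γ₃ ω i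

/-- `1 - ω_0(-1) f_{-1}(-1,0) - ω_0(-2) f_{-2}(-1,0)`. -/
noncomputable def immigrationDenom : ℝ :=
  1 - jump ω 0 (-1) * exitProb ω (-1) (-1) 0 - jump ω 0 (-2) * exitProb ω (-2) (-1) 0

/-- The immigration probabilities. -/
noncomputable def immigrationProb (v : Fin 9 → ℕ) : ℝ :=
  if v = ![1, 0, 0, 0, 0, 0, 0, 0, 0] then jump ω 0 1 / immigrationDenom ω
  else if v = ![0, 1, 0, 0, 0, 0, 0, 0, 0] then
    (1 - jump ω 0 1 - jump ω 0 2 - jump ω 0 (-1) * exitProb ω (-1) (-1) 0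
      - jump ω 0 (-2) * exitProb ω (-2) (-1) 0) / immigrationDenom ω
  else if v = ![0, 0, 1, 0, 0, 0, 0, 0, 0] then jump ω 0 2 / immigrationDenom ω
  else 0

/-- The negative multinomial weights. -/
noncomputable def negMultinomial (i : ℤ) (a b c d : ℕ) : ℝ :=
  ((a + b + c + d)! : ℝ) / (a ! * b ! * c ! * d !) *
    α₁ ω i ^ a * α₂ ω i ^ b * β₁ ω i ^ c * β₂ ω i ^ d *
    (1 - α₁ ω i - α₂ ω i - β₁ ω i - β₂ ω i)

/-- The probability that a particle of type `j` at `i + 1` has the offspring vector `v` at `i`.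
The types `0, 1, …, 8` are `A₁, A₂, A₃, B₁, B₂, B₃, C₁, C₂, C₃`. -/
noncomputable def offspringProb (i : ℤ) (j : Fin 9) (v : Fin 9 → ℕ) : ℝ :=
  let a := v 0
  let b := v 1
  let c := v 3
  let d := v 4
  let N := negMultinomial ω i a b c d
  match j with
  | 0 | 2 | 6 | 8 =>
    if v = ![a, b, 0, c, d, 0, 0, 0, 0] then N else 0
  | 1 | 7 =>
    if v = ![a, b, 1, c, d, 0, 0, 0, 0] then N * (α₃ ω i / (α₃ ω i + β₃ ω i))
    else if v = ![a, b, 0, c, d, 1, 0, 0, 0] then N * (β₃ ω i / (α₃ ω i + β₃ ω i))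
    else 0
  | 3 | 5 =>
    if v = ![a, b, 0, c, d, 0, 1, 0, 0] then N * (γ₁ ω i / (γ₁ ω i + γ₂ ω i))
    else if v = ![a, b, 0, c, d, 0, 0, 1, 0] then N * (γ₂ ω i / (γ₁ ω i + γ₂ ω i))
    else 0
  | 4 =>
    if v = ![0, 0, 0, 0, 0, 0, 0, 0, 1] then γ₃ ω i / β₂ ω (i + 1)
    else if v = ![a, b, 1, c, d, 0, 1, 0, 0] then
      N * ((β₂ ω (i + 1) - γ₃ ω i) * γ₁ ω i * α₃ ω i /
        (β₂ ω (i + 1) * (γ₁ ω i + γ₂ ω i) * (α₃ ω i + β₃ ω i)))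
    else if v = ![a, b, 1, c, d, 0, 0, 1, 0] then
      N * ((β₂ ω (i + 1) - γ₃ ω i) * γ₂ ω i * α₃ ω i /
        (β₂ ω (i + 1) * (γ₁ ω i + γ₂ ω i) * (α₃ ω i + β₃ ω i)))
    else if v = ![a, b, 0, c, d, 1, 1, 0, 0] then
      N * ((β₂ ω (i + 1) - γ₃ ω i) * γ₁ ω i * β₃ ω i /
        (β₂ ω (i + 1) * (γ₁ ω i + γ₂ ω i) * (α₃ ω i + β₃ ω i)))
    else if v = ![a, b, 0, c, d, 1, 0, 1, 0] then
      N * ((β₂ ω (i + 1) - γ₃ ω i) * γ₂ ω i * β₃ ω i /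
        (β₂ ω (i + 1) * (γ₁ ω i + γ₂ ω i) * (α₃ ω i + β₃ ω i)))
    else 0

end Laws

/-! ### Multitype branching processes -/

/-- The law of the sum of independent offspring vectors of a population with `u j` particles of
type `j` for each `j`, a particle of type `j` having the offspring law `p j`. -/
noncomputable def totalOffspring {τ : Type*} [Fintype τ] (p : τ → PMF (τ → ℕ)) (u : τ → ℕ) :
    Measure (τ → ℕ) :=
  Measure.map (fun ξ : (Σ j, Fin (u j)) → τ → ℕ => ∑ s, ξ s)
    (Measure.pi fun s : (Σ j, Fin (u j)) => (p s.1).toMeasure)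

/-- `Z` is a (time-)non-homogeneous multitype branching process under `P` with initial law `init`,
in which a particle of type `j` of the generation `n` has the offspring law `p n j`: given the
generations `0, …, n`, the generation `n + 1` is the sum of independent offspring vectors of the
particles of the generation `n`. -/
structure IsBranchingProcess {Ω τ : Type*} [MeasurableSpace Ω] [Fintype τ] (P : Measure Ω)
    (Z : ℕ → Ω → τ → ℕ) (init : PMF (τ → ℕ)) (p : ℕ → τ → PMF (τ → ℕ)) : Prop where
  measurable : ∀ n, Measurable (Z n)
  initial : ∀ v, P {w | Z 0 w = v} = init v
  branching : ∀ (n : ℕ) (z : ℕ → τ → ℕ),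
    P {w | ∀ m ≤ n + 1, Z m w = z m} =
      P {w | ∀ m ≤ n, Z m w = z m} * totalOffspring (p n) (z n) {z (n + 1)}

end TwoTwoWalk

open TwoTwoWalk

namespace TwoTwoWalk

open scoped ENNReal

/-! ### Words -/

/-! Up to `T₁` the walk follows a word that enters `[1, ∞)` at its last letter and not before. The
maximum of the walk is almost surely infinite, so such words carry full mass, from `0` and from
every site reached from `0` (`Reach.exitSum_one`). All the counts `U x i` are functions of the word
(`U_eq_listCount`), and the joint generating function of consecutive generations is therefore a
weighted sum over words (`tsum_gens`).

Excursions nest. An excursion below `L + 1` whose first step leads to `L` returns to `L` from below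
a number of times, each time by an excursion below `L` of subtype 1 or 2; then it leaves by a jump
up from `L`, or by an excursion below `L` of subtype 3. Summing over the number of returns gives a
geometric series (`genA_succ`). An excursion that begins with `L + 1 → L - 1` first enters `[L, ∞)`
by an excursion of type C below `L`, which either lands at `L`, where the previous description takes
over, or jumps over `L` and ends everything (`genB_succ`). In both recursions the weight of a type
enters only through its product with the generating function of that type (`typeGen_succ_congr`). So
the lowest generation can be absorbed: multiply the weights of the next one by the conditional
generating function of the offspring. This is the branching property (`tsum_gens_branching`);
uniqueness of generating functions (`pgf_ext`) turns it into an identity of laws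
(`walkLaw_gens_succ`).

The offspring laws are read off from one step of the recursion (`typeGen_formula`). The geometric
factor expands into negative multinomial weights, and the remaining factors mark the last excursion
below `i` of subtype 3, or the initial one of type C. The constants `α`, `β`, `γ` are jump
probabilities times the probabilities `hit` of the three ways to come back up (`α_eq`, `β_eq`,
`γ_eq`). This uses that the three ways exhaust all the mass, which is known only at sites that the
walk reaches; `occurs` provides such sites for each type of positive probability. -/

/-- The probability that the walk started at the given site first makes the jumps to the
letters of the given word. -/
noncomputable def wt (ω : ℤ → PMF ℤ) : ℤ → List ℤ → ℝ≥0∞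
  | _, [] => 1
  | a, b :: w => ω a (b - a) * wt ω b w

/-- The word enters `[L, ∞)` at its last letter, and not earlier. -/
def IsExit (L : ℤ) : List ℤ → Prop
  | [] => False
  | b :: w => if b < L then IsExit L w else w = []

/-- The last step of the path that starts at the given site and follows the given word. -/
def lastStep : ℤ → List ℤ → ℤ × ℤ
  | a, [] => (a, a)
  | a, [b] => (a, b)
  | _, b :: c :: w => lastStep b (c :: w)

open Classical in
/-- The expectation of a functional of the path of the walk from `a` up to its entrance
into `[L, ∞)` at a positive time. -/
noncomputable def exitSum (ω : ℤ → PMF ℤ) (L a : ℤ) (F : List ℤ → ℝ≥0∞) : ℝ≥0∞ :=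
  ∑' w, if IsExit L w then wt ω a w * F w else 0

variable {ω : ℤ → PMF ℤ}

@[simp] lemma not_isExit_nil (L : ℤ) : ¬ IsExit L [] := fun h => h

lemma isExit_cons_of_lt {L b : ℤ} (h : b < L) (w : List ℤ) :
    IsExit L (b :: w) ↔ IsExit L w := by simp [IsExit, h]

lemma isExit_cons_of_le {L b : ℤ} (h : L ≤ b) (w : List ℤ) :
    IsExit L (b :: w) ↔ w = [] := by simp [IsExit, not_lt.2 h]

lemma IsExit.ne_nil {L : ℤ} {w : List ℤ} (h : IsExit L w) : w ≠ [] := by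
  rintro rfl; exact h

lemma IsExit.le_getLastD {L : ℤ} {w : List ℤ} (h : IsExit L w) (a : ℤ) : L ≤ w.getLastD a := by
  induction w generalizing a with
  | nil => exact h.elim
  | cons b w ih =>
    rw [List.getLastD_cons]
    by_cases hb : b < L
    · exact ih ((isExit_cons_of_lt hb w).1 h) b
    · rw [(isExit_cons_of_le (not_lt.1 hb) w).1 h]
      simpa using hb

lemma wt_append (a : ℤ) (u v : List ℤ) :
    wt ω a (u ++ v) = wt ω a u * wt ω (u.getLastD a) v := by
  induction u generalizing a with
  | nil => simp [wt]
  | cons b u ih => rw [List.cons_append, wt, wt, ih, List.getLastD_cons, mul_assoc]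

lemma wt_le_one (a : ℤ) (w : List ℤ) : wt ω a w ≤ 1 := by
  induction w generalizing a with
  | nil => simp [wt]
  | cons b w ih => exact mul_le_one' ((ω a).coe_le_one _) (ih b)

lemma wt_ne_top (a : ℤ) (w : List ℤ) : wt ω a w ≠ ∞ :=
  ((wt_le_one a w).trans_lt ENNReal.one_lt_top).ne

lemma lastStep_snd (a : ℤ) (w : List ℤ) : (lastStep a w).2 = w.getLastD a := by
  induction w generalizing a with
  | nil => rfl
  | cons b w ih =>
    cases w with
    | nil => rfl
    | cons c w => rw [lastStep, ih]; simp only [List.getLastD_cons]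

lemma lastStep_cons (a b : ℤ) {w : List ℤ} (h : w ≠ []) :
    lastStep a (b :: w) = lastStep b w := by
  cases w with
  | nil => exact (h rfl).elim
  | cons c w => rfl

lemma lastStep_append (a : ℤ) (u : List ℤ) {v : List ℤ} (h : v ≠ []) :
    lastStep a (u ++ v) = lastStep (u.getLastD a) v := by
  induction u generalizing a with
  | nil => rfl
  | cons b u ih => rw [List.cons_append, lastStep_cons _ _ (by simp [h]), ih, List.getLastD_cons]

lemma exitSum_congr {L a : ℤ} {F G : List ℤ → ℝ≥0∞}
    (h : ∀ w, IsExit L w → wt ω a w ≠ 0 → F w = G w) : exitSum ω L a F = exitSum ω L a G := by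
  refine tsum_congr fun w => ?_
  by_cases hw : IsExit L w
  · by_cases h0 : wt ω a w = 0
    · simp [h0]
    · simp [hw, h w hw h0]
  · simp [hw]

lemma exitSum_mono {L a : ℤ} {F G : List ℤ → ℝ≥0∞}
    (h : ∀ w, IsExit L w → F w ≤ G w) : exitSum ω L a F ≤ exitSum ω L a G := by
  refine ENNReal.tsum_le_tsum fun w => ?_
  by_cases hw : IsExit L w
  · simp only [hw, if_true]; gcongr; exact h w hw
  · simp [hw]

lemma exitSum_add (L a : ℤ) (F G : List ℤ → ℝ≥0∞) :
    exitSum ω L a (fun w => F w + G w) = exitSum ω L a F + exitSum ω L a G := by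
  unfold exitSum
  rw [← ENNReal.tsum_add]
  refine tsum_congr fun w => ?_
  split_ifs <;> simp [mul_add]

lemma exitSum_mul_right (L a : ℤ) (F : List ℤ → ℝ≥0∞) (c : ℝ≥0∞) :
    exitSum ω L a (fun w => F w * c) = exitSum ω L a F * c := by
  unfold exitSum
  rw [← ENNReal.tsum_mul_right]
  refine tsum_congr fun w => ?_
  split_ifs <;> simp [mul_assoc]

lemma exitSum_mul_left (L a : ℤ) (F : List ℤ → ℝ≥0∞) (c : ℝ≥0∞) :
    exitSum ω L a (fun w => c * F w) = c * exitSum ω L a F := by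
  simp_rw [mul_comm c, exitSum_mul_right]

@[simp] lemma exitSum_zero (L a : ℤ) : exitSum ω L a (fun _ => 0) = 0 := by
  simp [exitSum]

lemma exitSum_tsum {ι : Type*} (L a : ℤ) (F : ι → List ℤ → ℝ≥0∞) :
    exitSum ω L a (fun w => ∑' i, F i w) = ∑' i, exitSum ω L a (F i) := by
  unfold exitSum
  rw [ENNReal.tsum_comm]
  refine tsum_congr fun w => ?_
  split_ifs <;> simp [ENNReal.tsum_mul_left]

lemma exitSum_finset_sum {ι : Type*} (s : Finset ι) (L a : ℤ) (F : ι → List ℤ → ℝ≥0∞) :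
    exitSum ω L a (fun w => ∑ i ∈ s, F i w) = ∑ i ∈ s, exitSum ω L a (F i) := by
  classical
  induction s using Finset.induction_on with
  | empty => simp
  | insert i s hi ih => simp_rw [Finset.sum_insert hi, exitSum_add, ih]

lemma le_exitSum {L a : ℤ} (F : List ℤ → ℝ≥0∞) {w : List ℤ} (hw : IsExit L w) :
    wt ω a w * F w ≤ exitSum ω L a F := by
  classical
  unfold exitSum
  refine le_trans (by simp [hw]) (ENNReal.le_tsum w)

lemma tsum_list {F : List ℤ → ℝ≥0∞} (h : F [] = 0) : ∑' w, F w = ∑' b, ∑' w, F (b :: w) := by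
  rw [← ENNReal.tsum_prod (f := fun b w => F (b :: w))]
  have hinj : Function.Injective (fun p : ℤ × List ℤ => p.1 :: p.2) := by
    rintro ⟨a, u⟩ ⟨b, v⟩ h
    simpa using h
  refine (hinj.tsum_eq (f := F) ?_).symm
  intro w hw
  cases w with
  | nil => exact (hw h).elim
  | cons b w => exact ⟨(b, w), rfl⟩

/-- The decomposition of the exit words according to their first step. -/
lemma exitSum_eq_first_step (L a : ℤ) (F : List ℤ → ℝ≥0∞) :
    exitSum ω L a F = ∑' b, ω a (b - a) *
      (if b < L then exitSum ω L b (fun w => F (b :: w)) else F [b]) := by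
  classical
  unfold exitSum
  rw [tsum_list (by simp)]
  refine tsum_congr fun b => ?_
  by_cases hb : b < L
  · simp only [hb, if_true, isExit_cons_of_lt]
    rw [← ENNReal.tsum_mul_left]
    refine tsum_congr fun w => ?_
    split_ifs <;> simp [wt, mul_assoc]
  · simp only [hb, if_false, isExit_cons_of_le (not_lt.1 hb)]
    rw [tsum_eq_single []]
    · simp [wt]
    · intro w hw; simp [hw]

/-- The entrance into `[L', ∞)` decomposes at the entrance into `[L, ∞)`. -/
lemma exitSum_eq_of_le {L L' : ℤ} (hL : L ≤ L') (a : ℤ) (F : List ℤ → ℝ≥0∞) :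
    exitSum ω L' a F = exitSum ω L a (fun u =>
      if u.getLastD a < L' then exitSum ω L' (u.getLastD a) (fun w => F (u ++ w)) else F u) := by
  classical
  -- Induction on the length of the words that `F` charges: removing the first letter lowers it by
  -- one. A general `F` is the sum of its restrictions to the words of each length.
  have key : ∀ (n : ℕ) (a : ℤ) (F : List ℤ → ℝ≥0∞), (∀ w, w.length ≠ n → F w = 0) →
      exitSum ω L' a F = exitSum ω L a (fun u => if u.getLastD a < L' then
        exitSum ω L' (u.getLastD a) (fun w => F (u ++ w)) else F u) := by
    intro n
    induction n with
    | zero =>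
      intro a F hF
      have h0 : ∀ u, u ≠ [] → F u = 0 := fun u hu => hF u (by simpa using hu)
      rw [exitSum_congr (G := fun _ => 0) (fun w hw _ => h0 w hw.ne_nil),
        exitSum_congr (L := L) (G := fun _ => 0) (fun u hu _ => ?_)]
      · simp
      · rw [h0 u hu.ne_nil, exitSum_congr (G := fun _ => 0)
          (fun w hw _ => h0 _ (by simp [hw.ne_nil]))]
        simp
    | succ n ih =>
      intro a F hF
      rw [exitSum_eq_first_step, exitSum_eq_first_step]
      refine tsum_congr fun b => ?_
      congr 1
      by_cases hb : b < L
      · simp only [hb, hb.trans_le hL, if_true, List.getLastD_cons]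
        rw [ih b (fun w => F (b :: w)) (fun w hw => hF _ (by simpa using hw))]
        rfl
      · simp only [hb, if_false]
        rfl
  have hsum : ∀ w, F w = ∑' n : ℕ, if w.length = n then F w else 0 := fun w => by
    rw [tsum_eq_single w.length] <;> simp +contextual [eq_comm]
  calc exitSum ω L' a F
      = exitSum ω L' a (fun w => ∑' n : ℕ, if w.length = n then F w else 0) :=
        congrArg _ (funext hsum)
    _ = _ := by
      rw [exitSum_tsum]
      simp_rw [fun n : ℕ => key n a (fun w => if w.length = n then F w else 0)
        (fun w hw => by simp [hw])]
      rw [← exitSum_tsum]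
      congr 1
      funext u
      split_ifs
      · rw [← exitSum_tsum]
        exact congrArg _ (funext fun w => (hsum _).symm)
      · exact (hsum u).symm

end TwoTwoWalk

namespace TwoTwoWalk

/-! ### Counting excursions in finite paths -/

/-- The excursions of a path that end by the time `N`. -/
def excursions (y : ℕ → ℤ) (N : ℕ) (i : ℤ) (f l : ℤ × ℤ) : Set (ℕ × ℕ) :=
  {km | IsExcursion y i f l km.1 km.2 ∧ km.2 < N}

lemma finite_excursions (y : ℕ → ℤ) (N : ℕ) (i : ℤ) (f l : ℤ × ℤ) :
    (excursions y N i f l).Finite := by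
  refine (Set.finite_Iio (N, N)|>.subset fun km h => ?_)
  have h1 := h.1.1
  have h2 := h.2
  exact Prod.lt_iff.2 (Or.inl ⟨by simp; omega, by simp; omega⟩)

lemma excursions_congr {y z : ℕ → ℤ} {N : ℕ} (h : ∀ n ≤ N, y n = z n) (i : ℤ) (f l : ℤ × ℤ) :
    excursions y N i f l = excursions z N i f l := by
  ext ⟨k, m⟩
  simp only [excursions, IsExcursion, Set.mem_ofPred_eq]
  constructor
  · rintro ⟨⟨h1, h2, h3, h4⟩, h5⟩
    refine ⟨⟨h1, ?_, fun n hn hm => ?_, ?_⟩, h5⟩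
    · rw [← h2, h k (by omega), h (k + 1) (by omega)]
    · rw [← h n (by omega)]; exact h3 n hn hm
    · rw [← h4, h m (by omega), h (m + 1) (by omega)]
  · rintro ⟨⟨h1, h2, h3, h4⟩, h5⟩
    refine ⟨⟨h1, ?_, fun n hn hm => ?_, ?_⟩, h5⟩
    · rw [← h2, h k (by omega), h (k + 1) (by omega)]
    · rw [h n (by omega)]; exact h3 n hn hm
    · rw [← h4, h m (by omega), h (m + 1) (by omega)]

/-- An excursion is below `i` strictly between its end points, so it cannot straddle a time at which
the path is at or above `i`. -/
lemma ncard_excursions_split {y : ℕ → ℤ} {i : ℤ} {τ : ℕ} (hτ : i ≤ y τ) (N : ℕ)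
    (f l : ℤ × ℤ) :
    (excursions y (τ + N) i f l).ncard =
      (excursions y τ i f l).ncard + (excursions (fun n => y (τ + n)) N i f l).ncard := by
  have hinj : Function.Injective (fun p : ℕ × ℕ => (τ + p.1, τ + p.2)) := by
    rintro ⟨a, b⟩ ⟨c, d⟩ h
    simpa using h
  rw [← Set.ncard_image_of_injective (excursions (fun n => y (τ + n)) N i f l) hinj,
    ← Set.ncard_union_eq _ (finite_excursions _ _ _ _ _)
    ((finite_excursions _ _ _ _ _).image _)]
  · congr 1
    ext ⟨k, m⟩
    simp only [Set.mem_union, Set.mem_image, excursions, Set.mem_ofPred_eq, Prod.exists,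
      Prod.mk.injEq]
    constructor
    · rintro ⟨⟨h1, h2, h3, h4⟩, h5⟩
      by_cases hm : m < τ
      · exact Or.inl ⟨⟨h1, h2, h3, h4⟩, hm⟩
      · have hk : τ ≤ k := by
          by_contra hk
          have := h3 τ (by omega) (by omega)
          omega
        obtain ⟨k', rfl⟩ := Nat.exists_eq_add_of_le hk
        obtain ⟨m', rfl⟩ := Nat.exists_eq_add_of_le (not_lt.1 hm)
        refine Or.inr ⟨k', m', ⟨⟨by omega, h2, fun n hn hm => h3 _ (by omega) (by omega), h4⟩,
          by omega⟩, rfl, rfl⟩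
    · rintro (⟨h, hm⟩ | ⟨k', m', ⟨⟨h1, h2, h3, h4⟩, h5⟩, rfl, rfl⟩)
      · exact ⟨h, by omega⟩
      · refine ⟨⟨by omega, h2, fun n hn hm => ?_, h4⟩, by omega⟩
        obtain ⟨n', rfl⟩ := Nat.exists_eq_add_of_le (show τ ≤ n by omega)
        exact h3 n' (by omega) (by omega)
  · rw [Set.disjoint_left]
    rintro ⟨k, m⟩ h ⟨⟨k', m'⟩, h', h''⟩
    simp only [Prod.mk.injEq] at h''
    have := h.2
    simp only at this
    omega

/-- The end points of such an excursion are at or above `i`, while all times strictly between `0`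
and `N` are below; so the only candidate is the whole path, with `k = 0` and `m = N - 1`. -/
lemma excursions_of_mem {y : ℕ → ℤ} {i : ℤ} {N : ℕ} {f l : ℤ × ℤ} (hf : i ≤ f.1) (hl : i ≤ l.2)
    (hN : 2 ≤ N) (hy : ∀ n, 0 < n → n < N → y n < i) :
    (excursions y N i f l).ncard = if f = (y 0, y 1) ∧ l = (y (N - 1), y N) then 1 else 0 := by
  have hkm : ∀ k m, IsExcursion y i f l k m → m < N → k = 0 ∧ m = N - 1 := by
    rintro k m ⟨h1, h2, h3, h4⟩ h5
    constructor
    · by_contra hk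
      have := hy k (by omega) (by omega)
      rw [← h2] at hf
      simp only at hf
      omega
    · by_contra hk
      have := hy (m + 1) (by omega) (by omega)
      rw [← h4] at hl
      simp only at hl
      omega
  have hN1 : N - 1 + 1 = N := by omega
  split_ifs with h
  · rw [Set.ncard_eq_one]
    refine ⟨(0, N - 1), ?_⟩
    ext ⟨k, m⟩
    simp only [excursions, Set.mem_ofPred_eq, Set.mem_singleton_iff, Prod.mk.injEq]
    refine ⟨fun h => hkm k m h.1 h.2, ?_⟩
    rintro ⟨rfl, rfl⟩
    refine ⟨⟨by omega, h.1.symm, fun n h1 h2 => ?_, by rw [hN1]; exact h.2.symm⟩, by omega⟩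
    have := hy n h1 (by omega)
    omega
  · rw [Set.ncard_eq_zero (finite_excursions _ _ _ _ _), Set.eq_empty_iff_forall_notMem]
    rintro ⟨k, m⟩ ⟨h1, h2⟩
    obtain ⟨h3, h4⟩ := hkm k m h1 h2
    subst h3 h4
    obtain ⟨h1, h2, h3, h4⟩ := h1
    rw [hN1] at h4
    exact h ⟨h2.symm, h4.symm⟩

lemma excursions_of_le_one {y : ℕ → ℤ} {i : ℤ} {N : ℕ} {f l : ℤ × ℤ} (hN : N ≤ 1) :
    (excursions y N i f l).ncard = 0 := by
  rw [Set.ncard_eq_zero (finite_excursions _ _ _ _ _), Set.eq_empty_iff_forall_notMem]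
  rintro ⟨k, m⟩ ⟨⟨h1, -⟩, h2⟩
  simp only at h1 h2
  omega

/-- The path with the given list of positions. -/
def listPath (ℓ : List ℤ) (n : ℕ) : ℤ := ℓ.getD n 0

lemma listPath_append_left {ℓ₁ ℓ₂ : List ℤ} {n : ℕ} (h : n < ℓ₁.length) :
    listPath (ℓ₁ ++ ℓ₂) n = listPath ℓ₁ n := List.getD_append _ _ _ _ h

lemma listPath_append_right (ℓ₁ ℓ₂ : List ℤ) (n : ℕ) :
    listPath (ℓ₁ ++ ℓ₂) (ℓ₁.length + n) = listPath ℓ₂ n := by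
  unfold listPath
  rw [List.getD_append_right _ _ _ _ (by omega)]
  congr 1
  omega

@[simp] lemma listPath_zero (b : ℤ) (w : List ℤ) : listPath (b :: w) 0 = b := rfl

@[simp] lemma listPath_succ (b : ℤ) (w : List ℤ) (n : ℕ) :
    listPath (b :: w) (n + 1) = listPath w n := rfl

/-- The first step of an excursion below `i` of the type `j`. -/
def firstStep (i : ℤ) (j : Fin 9) : ℤ × ℤ :=
  ![(i, i - 1), (i, i - 1), (i, i - 1), (i, i - 2), (i, i - 2), (i, i - 2),
    (i + 1, i - 1), (i + 1, i - 1), (i + 1, i - 1)] j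

/-- The last step of an excursion below `i` of the subtype `r`. -/
def exitStep (i : ℤ) (r : Fin 3) : ℤ × ℤ := ![(i - 1, i), (i - 2, i), (i - 1, i + 1)] r

/-- The subtype of a type. -/
def subtypeOf (j : Fin 9) : Fin 3 := ![0, 1, 2, 0, 1, 2, 0, 1, 2] j

lemma le_firstStep (i : ℤ) (j : Fin 9) : i ≤ (firstStep i j).1 := by
  fin_cases j <;> simp [firstStep]

lemma le_exitStep (i : ℤ) (r : Fin 3) : i ≤ (exitStep i r).2 := by
  fin_cases r <;> simp [exitStep]

lemma exitStep_injective (i : ℤ) : Function.Injective (exitStep i) := by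
  intro r r' h
  fin_cases r <;> fin_cases r' <;> simp [exitStep] at h ⊢

/-- The number of excursions below `i` of the type `j` in a finite path. -/
noncomputable def listCount (ℓ : List ℤ) (i : ℤ) (j : Fin 9) : ℕ :=
  (excursions (listPath ℓ) (ℓ.length - 1) i (firstStep i j) (exitStep i (subtypeOf j))).ncard

/-- The letter `e` is the end of the first piece and the start of the second, which makes the
numbers of steps (length minus one) add up. -/
lemma listCount_split {i e : ℤ} (h : i ≤ e) (ℓ₁ ℓ₂ : List ℤ) (j : Fin 9) :
    listCount (ℓ₁ ++ e :: ℓ₂) i j = listCount (ℓ₁ ++ [e]) i j + listCount (e :: ℓ₂) i j := by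
  unfold listCount
  have h1 : (ℓ₁ ++ e :: ℓ₂).length - 1 = ℓ₁.length + ℓ₂.length := by simp
  have he : ∀ v, listPath (ℓ₁ ++ e :: v) ℓ₁.length = e := fun v => by
    simpa using listPath_append_right ℓ₁ (e :: v) 0
  rw [h1, ncard_excursions_split (by rw [he]; exact h)]
  congr 2
  · rw [show (ℓ₁ ++ [e]).length - 1 = ℓ₁.length by simp]
    refine excursions_congr (fun n hn => ?_) _ _ _
    rcases hn.lt_or_eq with hn | rfl
    · rw [listPath_append_left hn, listPath_append_left hn]
    · rw [he, he]
  · rw [show (e :: ℓ₂).length - 1 = ℓ₂.length by simp]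
    exact excursions_congr (fun n hn => listPath_append_right _ _ _) _ _ _

lemma listCount_of_length_le {ℓ : List ℤ} (h : ℓ.length ≤ 2) (i : ℤ) (j : Fin 9) :
    listCount ℓ i j = 0 := excursions_of_le_one (by omega)

lemma IsExit.listPath_lt {L : ℤ} {u : List ℤ} (hu : IsExit L u) :
    ∀ n, n + 1 < u.length → listPath u n < L := by
  induction u with
  | nil => simp
  | cons b u ih =>
    intro n hn
    by_cases hb : b < L
    · cases n with
      | zero => simpa using hb
      | succ n => exact ih ((isExit_cons_of_lt hb _).1 hu) n (by simpa using hn)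
    · rw [(isExit_cons_of_le (not_lt.1 hb) _).1 hu] at hn
      simp at hn

lemma lastStep_eq_listPath (a : ℤ) {u : List ℤ} (hu : u ≠ []) :
    lastStep a u = (listPath (a :: u) (u.length - 1), listPath (a :: u) u.length) := by
  induction u generalizing a with
  | nil => exact (hu rfl).elim
  | cons b u ih =>
    cases u with
    | nil => rfl
    | cons c w =>
      rw [lastStep, ih b (by simp)]
      simp

/-- A path that is a single excursion. -/
lemma listCount_of_isExit {i p a : ℤ} (ha : a < i) {u : List ℤ} (hu : IsExit i u)
    (j : Fin 9) : listCount (p :: a :: u) i j =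
      if firstStep i j = (p, a) ∧ lastStep a u = exitStep i (subtypeOf j) then 1 else 0 := by
  have hu0 : 0 < u.length := List.length_pos_of_ne_nil hu.ne_nil
  unfold listCount
  rw [excursions_of_mem (le_firstStep i j) (le_exitStep i _) (by simp; omega)]
  · rw [lastStep_eq_listPath a hu.ne_nil]
    have e1 : (p :: a :: u).length - 1 - 1 = (u.length - 1) + 1 := by simp; omega
    have e2 : (p :: a :: u).length - 1 = u.length + 1 := by simp
    rw [e1, e2, listPath_succ, listPath_succ]
    simp [listPath_succ, eq_comm]
  · intro n h0 hn
    obtain ⟨n, rfl⟩ := Nat.exists_eq_succ_of_ne_zero h0.ne'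
    cases n with
    | zero => simpa using ha
    | succ n => exact hu.listPath_lt n (by simp at hn; omega)

end TwoTwoWalk

namespace TwoTwoWalk
open scoped ENNReal

/-! ### Generating functions of excursions -/

/-- The weight of a finite path that gives to each excursion of type `j` below `lo + k`, `k < n`,
the weight `s k j`. -/
noncomputable def excWeight (lo : ℤ) (s : ℕ → Fin 9 → ℝ≥0∞) (n : ℕ) (ℓ : List ℤ) : ℝ≥0∞ :=
  ∏ k ∈ Finset.range n, ∏ j, s k j ^ listCount ℓ (lo + k) j

open Classical in
/-- The generating function of the excursions below `lo + n` that start with a jump from `p`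
to `a` and have the subtype `r`. -/
noncomputable def excGen (ω : ℤ → PMF ℤ) (lo : ℤ) (s : ℕ → Fin 9 → ℝ≥0∞) (n : ℕ) (p a : ℤ)
    (r : Fin 3) : ℝ≥0∞ :=
  exitSum ω (lo + n) a fun u =>
    excWeight lo s n (p :: a :: u) * if lastStep a u = exitStep (lo + n) r then 1 else 0

variable {ω : ℤ → PMF ℤ} {lo : ℤ} {s : ℕ → Fin 9 → ℝ≥0∞}

/-- The levels that are weighted are at most `lo + n - 1`, hence a cut at a letter `e ≥ lo + n - 1`
destroys no excursion. -/
lemma excWeight_split {n : ℕ} {e : ℤ} (h : lo + n ≤ e + 1) (ℓ₁ ℓ₂ : List ℤ) :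
    excWeight lo s n (ℓ₁ ++ e :: ℓ₂) =
      excWeight lo s n (ℓ₁ ++ [e]) * excWeight lo s n (e :: ℓ₂) := by
  unfold excWeight
  simp_rw [← Finset.prod_mul_distrib]
  refine Finset.prod_congr rfl fun k hk => Finset.prod_congr rfl fun j _ => ?_
  have := Finset.mem_range.1 hk
  rw [listCount_split (by omega), pow_add]

lemma excWeight_of_length_le {ℓ : List ℤ} (h : ℓ.length ≤ 2) (n : ℕ) :
    excWeight lo s n ℓ = 1 := by
  simp [excWeight, listCount_of_length_le h]

lemma excWeight_cons {n : ℕ} {a : ℤ} (h : lo + n ≤ a + 1) (p : ℤ) (w : List ℤ) :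
    excWeight lo s n (p :: a :: w) = excWeight lo s n (a :: w) := by
  have := excWeight_split (s := s) h [p] w
  rw [List.cons_append, List.nil_append, excWeight_of_length_le (ℓ := [p] ++ [a]) (by simp)] at this
  simpa using this

lemma type_ext {i : ℤ} {j j' : Fin 9} (h : firstStep i j = firstStep i j')
    (h' : subtypeOf j = subtypeOf j') : j = j' := by
  fin_cases j <;> fin_cases j' <;> simp [firstStep, subtypeOf] at h h' ⊢

/-- Seen from the level `lo + n`, the path is exactly one excursion, so this level contributes the
single factor `s n j`. -/
lemma excWeight_succ {n : ℕ} {p a : ℤ} (ha : a < lo + n) {u : List ℤ} (hu : IsExit (lo + n) u)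
    {j : Fin 9} (hj : firstStep (lo + n) j = (p, a))
    (hr : lastStep a u = exitStep (lo + n) (subtypeOf j)) :
    excWeight lo s (n + 1) (p :: a :: u) = s n j * excWeight lo s n (p :: a :: u) := by
  unfold excWeight
  rw [Finset.prod_range_succ, mul_comm]
  congr 1
  rw [Finset.prod_eq_single j]
  · rw [listCount_of_isExit ha hu, if_pos ⟨hj, hr⟩, pow_one]
  · intro j' _ hne
    rw [listCount_of_isExit ha hu, if_neg, pow_zero]
    rintro ⟨h1, h2⟩
    rw [hr] at h2
    exact hne (type_ext (h1.trans hj.symm) (exitStep_injective _ h2.symm))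
  · simp

lemma excWeight_le_one (hs : ∀ k j, s k j ≤ 1) (n : ℕ) (ℓ : List ℤ) :
    excWeight lo s n ℓ ≤ 1 :=
  Finset.prod_le_one' fun _ _ => Finset.prod_le_one' fun _ _ => pow_le_one' (hs _ _) _

lemma jump_mem (hω : ∀ i, (ω i).support ⊆ {-2, -1, 1, 2}) {i l : ℤ} (h : ω i l ≠ 0) :
    l = -2 ∨ l = -1 ∨ l = 1 ∨ l = 2 := by
  simpa using hω i ((PMF.mem_support_iff _ _).2 h)

lemma tsum_jump (hω : ∀ i, (ω i).support ⊆ {-2, -1, 1, 2}) (a : ℤ) (f : ℤ → ℝ≥0∞) :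
    ∑' b, ω a (b - a) * f b = ω a (-2) * f (a - 2) + ω a (-1) * f (a - 1) +
      ω a 1 * f (a + 1) + ω a 2 * f (a + 2) := by
  rw [tsum_eq_sum (s := {a - 2, a - 1, a + 1, a + 2})]
  · rw [Finset.sum_insert, Finset.sum_insert, Finset.sum_insert, Finset.sum_singleton]
    · rw [show a - 2 - a = -2 by ring, show a - 1 - a = -1 by ring, show a + 1 - a = 1 by ring,
        show a + 2 - a = 2 by ring]
      ring
    all_goals simp only [Finset.mem_insert, Finset.mem_singleton]; omega
  · intro b hb
    by_cases h : ω a (b - a) = 0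
    · simp [h]
    · exfalso
      have := jump_mem hω h
      simp only [Finset.mem_insert, Finset.mem_singleton] at hb
      omega

/-- Jumps have size at most two, which leaves three ways to cross from below `L` to `[L, ∞)`. -/
lemma exists_lastStep_eq (hω : ∀ i, (ω i).support ⊆ {-2, -1, 1, 2}) {L a : ℤ} (ha : a < L)
    {u : List ℤ} (hu : IsExit L u) (h0 : wt ω a u ≠ 0) : ∃ r, lastStep a u = exitStep L r := by
  induction u generalizing a with
  | nil => exact hu.elim
  | cons b u ih =>
    rw [wt] at h0
    by_cases hb : b < L
    · have hu' := (isExit_cons_of_lt hb _).1 hu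
      rw [lastStep_cons _ _ hu'.ne_nil]
      exact ih hb hu' (right_ne_zero_of_mul h0)
    · have hu' := (isExit_cons_of_le (not_lt.1 hb) _).1 hu
      subst hu'
      have hj := jump_mem hω (left_ne_zero_of_mul h0)
      have : (b = L ∧ a = L - 1) ∨ (b = L ∧ a = L - 2) ∨ (b = L + 1 ∧ a = L - 1) := by omega
      rcases this with ⟨rfl, rfl⟩ | ⟨rfl, rfl⟩ | ⟨rfl, rfl⟩
      · exact ⟨0, rfl⟩
      · exact ⟨1, rfl⟩
      · exact ⟨2, rfl⟩

/-- Summation of a functional of an excursion over its subtypes. -/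
lemma exitSum_excWeight_succ (hω : ∀ i, (ω i).support ⊆ {-2, -1, 1, 2}) {n : ℕ} {p a L : ℤ}
    (hL : L = lo + n) (ha : a < L) {ty : Fin 3 → Fin 9} (hty : ∀ r, firstStep L (ty r) = (p, a))
    (hsub : ∀ r, subtypeOf (ty r) = r) (X : ℤ × ℤ → ℝ≥0∞) :
    exitSum ω L a (fun u => excWeight lo s (n + 1) (p :: a :: u) * X (lastStep a u)) =
      ∑ r, s n (ty r) * excGen ω lo s n p a r * X (exitStep L r) := by
  subst hL
  classical
  simp_rw [excGen, ← exitSum_mul_left, ← exitSum_mul_right, ← exitSum_finset_sum]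
  refine exitSum_congr fun u hu h0 => ?_
  obtain ⟨r, hr⟩ := exists_lastStep_eq hω ha hu h0
  rw [Finset.sum_eq_single r]
  · rw [excWeight_succ ha hu (hty r) (by rw [hr, hsub]), if_pos hr, hr, mul_one]
  · intro r' _ hne
    rw [hr, if_neg (fun h => hne (exitStep_injective _ h).symm)]
    simp
  · simp

/-- A first step that ends at `lo + n - 1` is invisible at the levels below `lo + n`. This is why
the types A and C share one generating function. -/
lemma excGen_sub_one (n : ℕ) (p p' : ℤ) (r : Fin 3) :
    excGen ω lo s n p (lo + n - 1) r = excGen ω lo s n p' (lo + n - 1) r := by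
  unfold excGen
  refine exitSum_congr fun u _ _ => ?_
  rw [excWeight_cons (by omega), excWeight_cons (by omega)]

/-- The generating function of the excursions below `lo + n` of the types `A` and `C`. -/
noncomputable def genA (ω : ℤ → PMF ℤ) (lo : ℤ) (s : ℕ → Fin 9 → ℝ≥0∞) (n : ℕ) (r : Fin 3) :
    ℝ≥0∞ := excGen ω lo s n (lo + n) (lo + n - 1) r

/-- The generating function of the excursions below `lo + n` of the type `B`. -/
noncomputable def genB (ω : ℤ → PMF ℤ) (lo : ℤ) (s : ℕ → Fin 9 → ℝ≥0∞) (n : ℕ) (r : Fin 3) :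
    ℝ≥0∞ := excGen ω lo s n (lo + n) (lo + n - 2) r

/-- The generating function of one return to the site `lo + n` from below. -/
noncomputable def genLoop (ω : ℤ → PMF ℤ) (lo : ℤ) (s : ℕ → Fin 9 → ℝ≥0∞) (n : ℕ) : ℝ≥0∞ :=
  ω (lo + n) (-1) * (s n 0 * genA ω lo s n 0 + s n 1 * genA ω lo s n 1) +
    ω (lo + n) (-2) * (s n 3 * genB ω lo s n 0 + s n 4 * genB ω lo s n 1)

/-- The generating function of the last part of the walk, from the last visit to `lo + n`. -/
noncomputable def genLast (ω : ℤ → PMF ℤ) (lo : ℤ) (s : ℕ → Fin 9 → ℝ≥0∞) (n : ℕ) (r : Fin 3) :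
    ℝ≥0∞ :=
  ![ω (lo + n) 1, ω (lo + n) (-1) * (s n 2 * genA ω lo s n 2) +
    ω (lo + n) (-2) * (s n 5 * genB ω lo s n 2), ω (lo + n) 2] r

lemma excWeight_append {n : ℕ} {a e : ℤ} (h : lo + n ≤ e) (p : ℤ) {u : List ℤ}
    (hu : u ≠ []) (he : u.getLastD a = e) (w : List ℤ) :
    excWeight lo s (n + 1) (p :: a :: (u ++ w)) =
      excWeight lo s (n + 1) (p :: a :: u) * excWeight lo s (n + 1) (e :: w) := by
  obtain ⟨u', rfl⟩ : ∃ u', u = u' ++ [e] := by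
    refine ⟨u.dropLast, ?_⟩
    rw [← he, List.getLastD_eq_getLast?, List.getLast?_eq_some_getLast hu]
    exact (List.dropLast_append_getLast hu).symm
  have := excWeight_split (lo := lo) (s := s) (n := n + 1) (e := e) (by push_cast; omega)
    (p :: a :: u') w
  simpa using this

open Classical in
-- Renewal at `lo + n`: after a step down the path comes back to `[lo + n, ∞)`, and if it lands at
-- `lo + n` it starts afresh. The free factor `T` allows the same decomposition for the full sum and
-- for its truncations to short words.
lemma exitSum_from_top (hω : ∀ i, (ω i).support ⊆ {-2, -1, 1, 2}) (n : ℕ) (r : Fin 3)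
    (T : List ℤ → ℝ≥0∞) :
    exitSum ω (lo + n + 1) (lo + n) (fun w => T w * (excWeight lo s (n + 1) ((lo + n) :: w) *
        if lastStep (lo + n) w = exitStep (lo + n + 1) r then 1 else 0)) =
      ∑' b, ω (lo + n) (b - (lo + n)) * if b < lo + n then
        exitSum ω (lo + n) b (fun u => excWeight lo s (n + 1) ((lo + n) :: b :: u) *
          if (lastStep b u).2 = lo + n then
            exitSum ω (lo + n + 1) (lo + n) (fun w => T (b :: (u ++ w)) *
              (excWeight lo s (n + 1) ((lo + n) :: w) *
                if lastStep (lo + n) w = exitStep (lo + n + 1) r then 1 else 0))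
          else T (b :: u) * if lastStep b u = exitStep (lo + n + 1) r then 1 else 0)
        else if b = lo + n then 0 else
          T [b] * if (lo + n, b) = exitStep (lo + n + 1) r then 1 else 0 := by
  rw [exitSum_eq_first_step]
  refine tsum_congr fun b => ?_
  by_cases hb0 : b - (lo + n) = 0
  · have : ω (lo + n) (b - (lo + n)) = 0 := by
      by_contra h
      have := jump_mem hω h
      omega
    simp [this]
  congr 1
  by_cases hb : b < lo + n
  · rw [if_pos (by omega), if_pos hb, exitSum_eq_of_le (L := lo + n) (by omega)]
    refine exitSum_congr fun u hu h0 => ?_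
    have hge := hu.le_getLastD b
    rw [lastStep_snd]
    by_cases hl : u.getLastD b = lo + n
    · rw [if_pos (by omega), if_pos hl, hl, ← exitSum_mul_left]
      refine exitSum_congr fun w hw _ => ?_
      have hsplit := excWeight_append (lo := lo) (s := s) (n := n) le_rfl (lo + n) hu.ne_nil hl w
      rw [hsplit, lastStep_cons _ _ (by simp [hw.ne_nil]), lastStep_append _ _ hw.ne_nil, hl]
      ring
    · rw [if_neg (by omega), if_neg hl, lastStep_cons _ _ hu.ne_nil]
      ring
  · have hne : ¬ b = lo + n := by omega
    rw [if_neg (by omega), if_neg hb, if_neg hne, excWeight_of_length_le (by simp), one_mul]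
    rfl

lemma isExit_length {L : ℤ} {w : List ℤ} (h : IsExit L w) : w.length ≠ 0 := by
  simpa using h.ne_nil

/-- Identification of the least solution of a linear equation. -/
lemma eq_geometric_of_trunc {c κ : ℝ≥0∞} {h : ℕ → ℝ≥0∞} {x : ℝ≥0∞} (h0 : h 0 = 0)
    (hsucc : ∀ m, h (m + 1) ≤ c + κ * h m) (hx : x = c + κ * x) (hsup : x ≤ ⨆ m, h m) :
    x = (1 - κ)⁻¹ * c := by
  rw [← ENNReal.tsum_geometric, ENNReal.tsum_eq_iSup_nat, ENNReal.iSup_mul]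
  -- The fixed point equation yields only the lower bound, since `∞` solves it too as soon as `κ ≠
  -- 0`. The upper bound comes from the truncations `h m`, which are dominated by the partial
  -- geometric sums.
  apply le_antisymm
  · refine hsup.trans (iSup_mono fun m => ?_)
    induction m with
    | zero => simp [h0]
    | succ m ih =>
      refine (hsucc m).trans ?_
      rw [Finset.sum_range_succ', add_mul, pow_zero, one_mul, add_comm c]
      refine add_le_add ((mul_le_mul_right ih κ).trans_eq ?_) le_rfl
      rw [← mul_assoc, Finset.mul_sum]
      simp_rw [pow_succ']
  · refine iSup_le fun m => ?_
    induction m with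
    | zero => simp
    | succ m ih =>
      rw [Finset.sum_range_succ', add_mul, pow_zero, one_mul, add_comm]
      refine le_of_le_of_eq (add_le_add le_rfl (Eq.trans_le ?_ (mul_le_mul_right ih κ))) hx.symm
      rw [← mul_assoc, Finset.mul_sum]
      simp_rw [pow_succ']

/-- A sum of nonnegative terms is the supremum of its finite partial sums, and finitely many words
have bounded length. -/
lemma exitSum_le_iSup_trunc (L a : ℤ) (F : List ℤ → ℝ≥0∞) :
    exitSum ω L a F ≤ ⨆ m : ℕ, exitSum ω L a (fun w => (if w.length ≤ m then 1 else 0) * F w) := by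
  classical
  conv_lhs => rw [exitSum, ENNReal.tsum_eq_iSup_sum]
  refine iSup_le fun S => le_iSup_of_le (S.sup List.length) ?_
  refine le_trans (Finset.sum_le_sum fun w hw => ?_) (ENNReal.sum_le_tsum S)
  beta_reduce
  rw [if_pos (Finset.le_sup (f := List.length) hw), one_mul]

lemma excGen_succ_eq (n : ℕ) (r : Fin 3) (p : ℤ) : excGen ω lo s (n + 1) p (lo + n) r =
    genA ω lo s (n + 1) r := by
  have h : lo + ((n + 1 : ℕ) : ℤ) - 1 = lo + n := by push_cast; ring
  rw [genA, h, ← h, excGen_sub_one]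

/-- The renewal equation at `lo + n` reads `x = genLast + genLoop * x`. Truncation by word length
shows that `x` is its least solution, so no bound on `genLoop` is needed. -/
lemma genA_succ (hω : ∀ i, (ω i).support ⊆ {-2, -1, 1, 2}) (n : ℕ) (r : Fin 3) :
    genA ω lo s (n + 1) r = (1 - genLoop ω lo s n)⁻¹ * genLast ω lo s n r := by
  classical
  set L : ℤ := lo + n with hL
  set F : List ℤ → ℝ≥0∞ := fun w => excWeight lo s (n + 1) (L :: w) *
        if lastStep L w = exitStep (L + 1) r then 1 else 0 with hF
  have hx : genA ω lo s (n + 1) r = exitSum ω (L + 1) L F := by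
    rw [← excGen_succ_eq n r L, excGen]
    have h : lo + ((n + 1 : ℕ) : ℤ) = L + 1 := by push_cast; ring
    rw [h]
    refine exitSum_congr fun u _ _ => ?_
    rw [excWeight_cons (by omega)]
  -- `X Y q` is the value of what follows an excursion below `L` with last step `q`: `Y` if it lands
  -- at `L` and the path restarts, and otherwise the test that `q` is the prescribed final step.
  obtain ⟨X, hX⟩ : ∃ X : ℝ≥0∞ → ℤ × ℤ → ℝ≥0∞, ∀ Y q, X Y q =
      if q.2 = L then Y else if q = exitStep (L + 1) r then 1 else 0 := ⟨_, fun _ _ => rfl⟩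
  have hsum : ∀ Y : ℝ≥0∞, (∑' b, ω L (b - L) * if b < L then
        exitSum ω L b (fun u => excWeight lo s (n + 1) (L :: b :: u) *
          X Y (lastStep b u))
        else if b = L then 0 else if (L, b) = exitStep (L + 1) r then 1 else 0) =
      genLast ω lo s n r + genLoop ω lo s n * Y := by
    intro Y
    have e1 : ¬ L + 1 < L := by omega
    have e2 : ¬ L + 2 < L := by omega
    have e3 : ¬ L + 1 = L := by omega
    have e4 : ¬ L + 2 = L := by omega
    rw [tsum_jump hω, if_pos (by omega), if_pos (by omega), if_neg e1, if_neg e2, if_neg e3,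
      if_neg e4,
      exitSum_excWeight_succ (lo := lo) (n := n) hω hL (by omega)
          (ty := ![3, 4, 5]) (p := L) (a := L - 2)
        (by intro r; fin_cases r <;> simp [firstStep])
        (by intro r; fin_cases r <;> rfl),
      exitSum_excWeight_succ (lo := lo) (n := n) hω hL (by omega)
          (ty := ![0, 1, 2]) (p := L) (a := L - 1)
        (by intro r; fin_cases r <;> simp [firstStep])
        (by intro r; fin_cases r <;> rfl)]
    simp only [Fin.sum_univ_three, genLast, genLoop, ← hL]
    rw [← show genA ω lo s n = excGen ω lo s n L (L - 1) from rfl,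
      ← show genB ω lo s n = excGen ω lo s n L (L - 2) from rfl]
    have f1 : L + 1 - 2 = L - 1 := by ring
    have f2 : L + 1 + 1 = L + 2 := by ring
    have f3 : ¬ L = L - 1 := by omega
    fin_cases r <;> simp [exitStep, hX, f1, f2, f3] <;> ring
  have hfix : exitSum ω (L + 1) L F =
      genLast ω lo s n r + genLoop ω lo s n * exitSum ω (L + 1) L F := by
    rw [← hsum]
    simp only [hX]
    have := exitSum_from_top (lo := lo) (s := s) hω n r (fun _ => 1)
    simp only [one_mul, ← hL] at this
    exact this
  rw [hx]
  refine eq_geometric_of_trunc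
    (h := fun m => exitSum ω (L + 1) L (fun w => (if w.length ≤ m then 1 else 0) * F w))
    ?_ ?_ hfix ?_
  · rw [exitSum_congr (G := fun _ => 0), exitSum_zero]
    intro w hw _
    rw [if_neg, zero_mul]
    have := isExit_length hw
    omega
  -- A word of length at most `m + 1` that returns to `L` has used at least its first letter, so at
  -- most `m` letters remain after the return.
  · intro m
    rw [← hsum]
    simp only [hX]
    refine (exitSum_from_top (lo := lo) (s := s) hω n r
      (fun w => if w.length ≤ m + 1 then 1 else 0)).trans_le ?_
    simp only [← hL]
    refine ENNReal.tsum_le_tsum fun b => mul_le_mul_right ?_ _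
    split_ifs with h1 h2 h3
    · refine exitSum_mono fun u hu => mul_le_mul_right ?_ _
      split_ifs
      · refine exitSum_mono fun w hw => mul_le_mul_left ?_ _
        split_ifs with h5 h6
        · rfl
        · simp at h5; omega
        · simp
        · simp
      all_goals simp
    all_goals simp
  · exact exitSum_le_iSup_trunc _ _ _

/-- With `L = lo + n`, the path enters `[L, ∞)` from `L - 1` by an excursion of type C below `L`.
Subtypes 1 and 2 land at `L`, where an excursion below `L + 1` of the kind A takes over. Subtype 3
is the jump `L - 1 → L + 1`, which is the last step of subtype 2 (`r = 1`) for the level `L + 1`. -/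
lemma genB_succ (hω : ∀ i, (ω i).support ⊆ {-2, -1, 1, 2}) (n : ℕ) (r : Fin 3) :
    genB ω lo s (n + 1) r =
      (s n 6 * genA ω lo s n 0 + s n 7 * genA ω lo s n 1) * genA ω lo s (n + 1) r +
        if r = 1 then s n 8 * genA ω lo s n 2 else 0 := by
  classical
  set L : ℤ := lo + n with hL
  have h1 : lo + ((n + 1 : ℕ) : ℤ) = L + 1 := by push_cast; ring
  have h2 : L + 1 - 2 = L - 1 := by ring
  rw [genB, excGen, h1, h2, exitSum_eq_of_le (L := L) (by omega)]
  obtain ⟨X, hX⟩ : ∃ X : ℤ × ℤ → ℝ≥0∞, ∀ q, X q =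
      if q.2 = L then genA ω lo s (n + 1) r else if q = exitStep (L + 1) r then 1 else 0 :=
    ⟨_, fun _ => rfl⟩
  have key : ∀ u, IsExit L u → (if u.getLastD (L - 1) < L + 1 then
      exitSum ω (L + 1) (u.getLastD (L - 1)) (fun w =>
        excWeight lo s (n + 1) ((L + 1) :: (L - 1) :: (u ++ w)) *
          if lastStep (L - 1) (u ++ w) = exitStep (L + 1) r then 1 else 0)
      else excWeight lo s (n + 1) ((L + 1) :: (L - 1) :: u) *
          if lastStep (L - 1) u = exitStep (L + 1) r then 1 else 0) =
      excWeight lo s (n + 1) ((L + 1) :: (L - 1) :: u) *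
        X (lastStep (L - 1) u) := by
    intro u hu
    have hge := hu.le_getLastD (L - 1)
    rw [hX, lastStep_snd]
    by_cases hl : u.getLastD (L - 1) = L
    · rw [if_pos (by omega), if_pos hl, hl, ← excGen_succ_eq n r L, excGen, h1, ← exitSum_mul_left]
      refine exitSum_congr fun w hw _ => ?_
      rw [excWeight_cons (p := L) (a := L) (by push_cast; omega),
        excWeight_append (by omega) (L + 1) hu.ne_nil hl w, lastStep_append _ _ hw.ne_nil, hl]
      ring
    · rw [if_neg (by omega), if_neg hl]
  rw [exitSum_congr (fun u hu _ => key u hu),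
    exitSum_excWeight_succ (lo := lo) (n := n) hω hL (by omega) (ty := ![6, 7, 8])
        (by intro r; fin_cases r <;> simp [firstStep])
        (by intro r; fin_cases r <;> rfl)]
  have hA : ∀ r, excGen ω lo s n (L + 1) (L - 1) r = genA ω lo s n r := fun r =>
    excGen_sub_one n _ _ r
  simp only [Fin.sum_univ_three, hA]
  fin_cases r <;> simp [exitStep, hX, h2] <;> ring

end TwoTwoWalk

namespace TwoTwoWalk
open scoped ENNReal

/-! ### The law of the walk on cylinders -/

/-- The word read by the path `y` at the `d` times after the time `c`. -/
def seg (y : ℕ → ℤ) : ℕ → ℕ → List ℤ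
  | _, 0 => []
  | c, d + 1 => y (c + 1) :: seg y (c + 1) d

@[simp] lemma length_seg (y : ℕ → ℤ) (c d : ℕ) : (seg y c d).length = d := by
  induction d generalizing c with
  | zero => rfl
  | succ d ih => simp [seg, ih]

lemma seg_add (y : ℕ → ℤ) (c d e : ℕ) : seg y c (d + e) = seg y c d ++ seg y (c + d) e := by
  induction d generalizing c with
  | zero => simp [seg]
  | succ d ih =>
    rw [show d + 1 + e = (d + e) + 1 by ring, seg, seg, ih, List.cons_append]
    congr 3
    ring

lemma isExit_seg {y : ℕ → ℤ} {L : ℤ} {c d : ℕ} (h : ∀ n < d, y (c + 1 + n) < L)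
    (h' : L ≤ y (c + 1 + d)) : IsExit L (seg y c (d + 1)) := by
  induction d generalizing c with
  | zero => exact (isExit_cons_of_le h' _).2 rfl
  | succ d ih =>
    rw [seg]
    refine (isExit_cons_of_lt (h 0 (by omega)) _).2 (ih (fun n hn => ?_) ?_)
    · have := h (n + 1) (by omega)
      rwa [show c + 1 + (n + 1) = c + 1 + 1 + n by ring] at this
    · rwa [show c + 1 + (d + 1) = c + 1 + 1 + d by ring] at h'

lemma lastStep_seg (y : ℕ → ℤ) (c d : ℕ) :
    lastStep (y c) (seg y c (d + 1)) = (y (c + d), y (c + d + 1)) := by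
  induction d generalizing c with
  | zero => rfl
  | succ d ih =>
    rw [seg, lastStep_cons _ _ (by simp [seg]), ih]
    congr 2 <;> ring

lemma listPath_seg (y : ℕ → ℤ) (c d : ℕ) {n : ℕ} (hn : n ≤ d) :
    listPath (y c :: seg y c d) n = y (c + n) := by
  induction n generalizing c d with
  | zero => rfl
  | succ n ih =>
    obtain ⟨d, rfl⟩ := Nat.exists_eq_succ_of_ne_zero (show d ≠ 0 by omega)
    rw [listPath_succ, Nat.succ_eq_add_one, seg, ih _ _ (by omega)]
    congr 1
    ring

/-- The paths from `a` that first follow the word `w`. -/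
def cyl (a : ℤ) (w : List ℤ) : Set (ℕ → ℤ) := {x | x 0 = a ∧ seg x 0 w.length = w}

lemma measurableSet_seg (c d : ℕ) (w : List ℤ) :
    MeasurableSet {x : ℕ → ℤ | seg x c d = w} := by
  induction d generalizing c w with
  | zero => exact MeasurableSet.const ([] = w)
  | succ d ih =>
    cases w with
    | nil => simp [seg]
    | cons b w =>
      have : {x : ℕ → ℤ | seg x c (d + 1) = b :: w} =
          (fun x => x (c + 1)) ⁻¹' {b} ∩ {x | seg x (c + 1) d = w} := by
        ext x; simp [seg]
      rw [this]
      exact (measurable_pi_apply (c + 1) (measurableSet_singleton b)).inter (ih _ _)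

lemma measurableSet_cyl (a : ℤ) (w : List ℤ) : MeasurableSet (cyl a w) :=
  MeasurableSet.inter (s₁ := (fun x : ℕ → ℤ => x 0) ⁻¹' {a})
    (measurable_pi_apply 0 (measurableSet_singleton a)) (measurableSet_seg 0 w.length w)

lemma mem_cyl_append {a : ℤ} {u v : List ℤ} {x : ℕ → ℤ} :
    x ∈ cyl a (u ++ v) ↔ x ∈ cyl a u ∧ seg x u.length v.length = v := by
  simp only [cyl, Set.mem_ofPred_eq, List.length_append, seg_add, zero_add, and_assoc]
  refine and_congr_right fun _ => ⟨fun h => List.append_inj h (by simp), ?_⟩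
  rintro ⟨h1, h2⟩
  rw [h1, h2]

lemma mem_cyl_iff {a : ℤ} {w : List ℤ} {x : ℕ → ℤ} :
    x ∈ cyl a w ↔ ∀ m ≤ w.length, x m = listPath (a :: w) m := by
  constructor
  · rintro ⟨h0, h1⟩ m hm
    rw [← zero_add m, ← listPath_seg x 0 w.length hm, h0, h1]
    simp
  · intro h
    have key : ∀ (c : ℕ) (a : ℤ) (w : List ℤ),
        (∀ m ≤ w.length, x (c + m) = listPath (a :: w) m) → seg x c w.length = w := by
      intro c a w
      induction w generalizing a c with
      | nil => intro _; rfl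
      | cons b w ih =>
        intro h
        rw [List.length_cons, seg, ih (c + 1) b]
        · congr 1
          exact h 1 (by simp)
        · intro m hm
          rw [show c + 1 + m = c + (m + 1) by ring]
          exact h (m + 1) (by simpa using hm)
    exact ⟨h 0 (by simp), key 0 a w (by simpa using h)⟩

lemma listPath_length (a : ℤ) (w : List ℤ) : listPath (a :: w) w.length = w.getLastD a := by
  induction w generalizing a with
  | nil => rfl
  | cons b w ih => rw [List.length_cons, listPath_succ, ih, List.getLastD_cons]

variable {ω : ℤ → PMF ℤ}

instance (a : ℤ) : IsProbabilityMeasure (walkLaw ω a) := by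
  unfold walkLaw; infer_instance

lemma stepKernel_apply (i b : ℤ) : stepKernel ω i {b} = ω i (b - i) := by
  change ((ω i).map fun l => i + l).toMeasure {b} = _
  rw [PMF.toMeasure_apply_singleton _ _ (measurableSet_singleton _), PMF.map_apply,
    tsum_eq_single (b - i)]
  · simp
  · intro l hl
    rw [if_neg]
    rintro rfl
    simp at hl

lemma walkLaw_start (a : ℤ) : walkLaw ω a {x | x 0 = a} = 1 := by
  have h : (walkLaw ω a).map (Preorder.frestrictLe 0) =
      (Measure.dirac a).map (MeasurableEquiv.piUnique (fun _ : Finset.Iic 0 => ℤ)).symm := by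
    rw [walkLaw, Kernel.trajMeasure, Measure.map_comp _ _ (by fun_prop),
      Kernel.traj_map_frestrictLe, Kernel.partialTraj_self, Measure.id_comp]
  have hm : MeasurableSet {z : Π _ : Finset.Iic 0, ℤ | z ⟨0, by simp⟩ = a} :=
    (Set.to_countable _).measurableSet
  have h2 := congrArg (fun μ => μ {z : Π _ : Finset.Iic 0, ℤ | z ⟨0, by simp⟩ = a}) h
  beta_reduce at h2
  rw [Measure.map_apply (by fun_prop) hm, Measure.map_apply (by fun_prop) hm] at h2
  refine h2.trans ?_
  rw [Measure.dirac_apply' _ ((MeasurableEquiv.measurable _) hm), Set.indicator_of_mem]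
  · rfl
  · rfl

/-- Letters are appended at the end, because the Ionescu-Tulcea law extends a finite history by one
step of the kernel. From here on the path measure is handled through weights of words. -/
lemma walkLaw_cyl (a : ℤ) (w : List ℤ) : walkLaw ω a (cyl a w) = wt ω a w := by
  induction w using List.reverseRecOn with
  | nil =>
    rw [wt, ← walkLaw_start (ω := ω) a]
    congr 1
    ext x
    simp [cyl, seg]
  | append_singleton u b ih =>
    set n := u.length with hn
    set z : Π _ : Finset.Iic n, ℤ := fun m => listPath (a :: u) m with hz
    have key := congrArg (fun μ => μ (({z} : Set (Π _ : Finset.Iic n, ℤ)) ×ˢ ({b} : Set ℤ)))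
      (Kernel.map_frestrictLe_trajMeasure_compProd_eq_map_trajMeasure
        (X := fun _ => ℤ) (μ₀ := Measure.dirac a) (κ := pastKernel ω) (a := n))
    beta_reduce at key
    rw [Measure.compProd_apply_prod (measurableSet_singleton _) (measurableSet_singleton _),
      lintegral_singleton, Measure.map_apply (by fun_prop) (measurableSet_singleton _),
      Measure.map_apply (by fun_prop)
        ((measurableSet_singleton _).prod (measurableSet_singleton _))] at key
    have h1 : Preorder.frestrictLe n ⁻¹' ({z} : Set (Π _ : Finset.Iic n, ℤ)) = cyl a u := by
      ext x
      rw [mem_cyl_iff, Set.mem_preimage, Set.mem_singleton_iff, funext_iff]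
      exact ⟨fun h m hm => h ⟨m, Finset.mem_Iic.2 hm⟩, fun h m => h m (Finset.mem_Iic.1 m.2)⟩
    have h2 : (fun x : ℕ → ℤ => (Preorder.frestrictLe n x, x (n + 1))) ⁻¹'
          (({z} : Set (Π _ : Finset.Iic n, ℤ)) ×ˢ ({b} : Set ℤ)) =
        cyl a (u ++ [b]) := by
      ext x
      have hx : x ∈ Preorder.frestrictLe n ⁻¹' ({z} : Set (Π _ : Finset.Iic n, ℤ)) ↔
          x ∈ cyl a u := by rw [h1]
      rw [mem_cyl_append, ← hx]
      simp [seg, hn]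
    rw [h1, h2] at key
    rw [wt_append, ← ih]
    refine key.symm.trans ?_
    rw [mul_comm]
    congr 1
    change stepKernel ω (listPath (a :: u) n) {b} = _
    rw [stepKernel_apply, hn, listPath_length, wt, wt, mul_one]

end TwoTwoWalk

namespace TwoTwoWalk
open scoped ENNReal

/-! ### Decomposition of events along exit words -/

variable {ω : ℤ → PMF ℤ}

lemma IsExit.append_iff {L : ℤ} {u : List ℤ} (hu : IsExit L u) (t : List ℤ) :
    IsExit L (u ++ t) ↔ t = [] := by
  induction u with
  | nil => exact hu.elim
  | cons b u ih =>
    by_cases hb : b < L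
    · rw [List.cons_append, isExit_cons_of_lt hb]
      exact ih ((isExit_cons_of_lt hb _).1 hu)
    · have h := (isExit_cons_of_le (not_lt.1 hb) _).1 hu
      subst h
      rw [List.cons_append, isExit_cons_of_le (not_lt.1 hb)]
      simp

/-- Exit words form a prefix-free family (`IsExit.append_iff`), so from a given time a path reads at
most one of them. -/
lemma IsExit.eq_of_seg {L : ℤ} {u u' : List ℤ} (hu : IsExit L u) (hu' : IsExit L u')
    {x : ℕ → ℤ} {c : ℕ} (h : seg x c u.length = u) (h' : seg x c u'.length = u') : u = u' := by
  rcases le_total u.length u'.length with hle | hle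
  · obtain ⟨d, hd⟩ := Nat.exists_eq_add_of_le hle
    rw [hd, seg_add, h] at h'
    rw [← h', hu.append_iff] at hu'
    rw [← h', hu', List.append_nil]
  · obtain ⟨d, hd⟩ := Nat.exists_eq_add_of_le hle
    rw [hd, seg_add, h'] at h
    rw [← h, hu'.append_iff] at hu
    rw [← h, hu, List.append_nil]

lemma exists_isExit_seg {x : ℕ → ℤ} {L : ℤ} {c m : ℕ} (hm : c < m) (hx : L ≤ x m) :
    ∃ d, IsExit L (seg x c (d + 1)) := by
  classical
  have hex : ∃ d, L ≤ x (c + 1 + d) := ⟨m - (c + 1), by rwa [Nat.add_sub_cancel' (by omega)]⟩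
  exact ⟨Nat.find hex, isExit_seg (fun n hn => not_le.1 (Nat.find_min hex hn))
    (Nat.find_spec hex)⟩

open Classical in
-- A path in the event that has read `v` almost surely goes on to read an exit word, and by
-- prefix-freeness only one; the pieces are disjoint.
lemma measure_inter_cyl {P : Measure (ℕ → ℤ)} {a L : ℤ} {v : List ℤ} {A : Set (ℕ → ℤ)}
    (hA : ∀ u, IsExit L u → MeasurableSet (A ∩ cyl a (v ++ u)))
    (h : ∀ᵐ x ∂P, x ∈ A → x ∈ cyl a v → ∃ m > v.length, L ≤ x m) :
    P (A ∩ cyl a v) = ∑' u, if IsExit L u then P (A ∩ cyl a (v ++ u)) else 0 := by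
  have hae : (A ∩ cyl a v : Set (ℕ → ℤ)) =ᵐ[P]
      ⋃ u : {u : List ℤ // IsExit L u}, A ∩ cyl a (v ++ u) := by
    filter_upwards [h] with x hx
    refine propext ⟨?_, ?_⟩
    · rintro ⟨h1, h2⟩
      obtain ⟨m, hm, hxm⟩ := hx h1 h2
      obtain ⟨d, hd⟩ := exists_isExit_seg hm hxm
      exact Set.mem_iUnion.2 ⟨⟨_, hd⟩, h1, mem_cyl_append.2 ⟨h2, by simp⟩⟩
    · intro hx
      obtain ⟨u, h1, h2⟩ := Set.mem_iUnion.1 hx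
      exact ⟨h1, (mem_cyl_append.1 h2).1⟩
  rw [measure_congr hae, measure_iUnion]
  · have := tsum_subtype {u : List ℤ | IsExit L u} (fun u => P (A ∩ cyl a (v ++ u)))
    refine this.trans (tsum_congr fun u => ?_)
    simp [Set.indicator]
  · rintro ⟨u, hu⟩ ⟨u', hu'⟩ hne
    refine Set.disjoint_left.2 ?_
    rintro x ⟨_, h1⟩ ⟨_, h2⟩
    exact hne (Subtype.ext (hu.eq_of_seg hu' (mem_cyl_append.1 h1).2 (mem_cyl_append.1 h2).2))
  · exact fun u => hA u u.2

/-- The walk from `0` has unbounded maximum. -/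
def Transient (ω : ℤ → PMF ℤ) : Prop :=
  ∀ᵐ x ∂walkLaw ω 0, ∀ (c : ℕ) (L : ℤ), ∃ m > c, L ≤ x m

lemma transient_of_limsup
    (hlim : ∀ᵐ x ∂walkLaw ω 0, limsup (fun n : ℕ => ((x n : ℝ) : EReal)) atTop = ⊤) :
    Transient ω := by
  filter_upwards [hlim] with x hx c L
  have h : ∃ᶠ n in atTop, ((L : ℝ) : EReal) < ((x n : ℝ) : EReal) := by
    refine frequently_lt_of_lt_limsup ?_ ?_
    · isBoundedDefault
    · rw [hx]; exact EReal.coe_lt_top _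
  obtain ⟨m, hm, hxm⟩ := frequently_atTop.1 h (c + 1)
  refine ⟨m, hm, ?_⟩
  have := EReal.coe_lt_coe_iff.1 hxm
  exact (Int.cast_lt.1 this).le

/-- The walk from `0` reaches the site with positive probability. -/
def Reach (ω : ℤ → PMF ℤ) (a : ℤ) : Prop := ∃ v, wt ω 0 v ≠ 0 ∧ v.getLastD 0 = a

lemma getLastD_append (a : ℤ) (u v : List ℤ) :
    (u ++ v).getLastD a = v.getLastD (u.getLastD a) := by
  induction u generalizing a with
  | nil => rfl
  | cons b u ih => rw [List.cons_append, List.getLastD_cons, List.getLastD_cons, ih]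

lemma Reach.trans {a b : ℤ} (h : Reach ω a) {v : List ℤ} (hv : wt ω a v ≠ 0)
    (hb : v.getLastD a = b) : Reach ω b := by
  obtain ⟨u, hu, rfl⟩ := h
  refine ⟨u ++ v, ?_, ?_⟩
  · rw [wt_append]; exact mul_ne_zero hu hv
  · rw [← hb]
    exact getLastD_append 0 u v

lemma Reach.step {a b : ℤ} (h : Reach ω a) (hb : ω a (b - a) ≠ 0) : Reach ω b :=
  h.trans (v := [b]) (by simpa [wt] using hb) rfl

/-- From a site that is reached from `0` the walk almost surely enters each half-line. -/
lemma Reach.exitSum_one {a : ℤ} (hω : Transient ω) (h : Reach ω a) (L : ℤ) :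
    exitSum ω L a (fun _ => 1) = 1 := by
  obtain ⟨v, hv, rfl⟩ := h
  -- The hypothesis concerns the walk from `0` only. It is transported along a word `v` of positive
  -- weight that leads to the site, and that weight is cancelled at the end.
  have key := measure_inter_cyl (P := walkLaw ω 0) (a := 0) (L := L) (v := v) (A := Set.univ)
    (fun u _ => by simpa using measurableSet_cyl _ _)
    (by filter_upwards [hω] with x hx _ _ using hx _ _)
  simp only [Set.univ_inter, walkLaw_cyl, wt_append] at key
  have h2 : wt ω 0 v * exitSum ω L (v.getLastD 0) (fun _ => 1) = wt ω 0 v * 1 := by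
    rw [mul_one]
    refine Eq.trans ?_ key.symm
    rw [exitSum, ← ENNReal.tsum_mul_left]
    refine tsum_congr fun u => ?_
    split_ifs <;> simp
  exact (ENNReal.mul_right_inj hv (wt_ne_top _ _)).1 h2

lemma ae_walkLaw_start (k : ℤ) : ∀ᵐ x ∂walkLaw ω k, x 0 = k := by
  have hm : MeasurableSet {x : ℕ → ℤ | x 0 = k} :=
    measurableSet_eq_fun (measurable_pi_apply 0) measurable_const
  exact (mem_ae_iff_prob_eq_one hm).2 (walkLaw_start k)

open Classical in
-- Since `k ≤ i`, time `0` is no entrance, and the first time above `i` is the length of the exit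
-- word: its last letter decides the event.
lemma exitProb_eq {k i j : ℤ} (hki : k ≤ i) (hij : i < j) : exitProb ω k i j =
    (exitSum ω (i + 1) k (fun u => if u.getLastD k = j then 1 else 0)).toReal := by
  set A : Set (ℕ → ℤ) := {x | ∃ n, x n = j ∧ ∀ m < n, x m ≤ i} with hA
  have hAm : MeasurableSet A := by
    have : A = ⋃ n, (fun x : ℕ → ℤ => x n) ⁻¹' {j} ∩
        ⋂ m, ⋂ (_ : m < n), (fun x : ℕ → ℤ => x m) ⁻¹' (Set.Iic i) := by
      ext x; simp [hA]
    rw [this]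
    exact MeasurableSet.iUnion fun n => (measurable_pi_apply n (measurableSet_singleton j)).inter
      (MeasurableSet.iInter fun m => MeasurableSet.iInter fun _ =>
        measurable_pi_apply m measurableSet_Iic)
  rw [exitProb, Measure.real]
  congr 1
  have h1 : walkLaw ω k A = walkLaw ω k (A ∩ cyl k []) := by
    refine measure_congr ?_
    have h0 : ∀ᵐ x ∂walkLaw ω k, x 0 = k := ae_walkLaw_start k
    filter_upwards [h0] with x hx
    exact propext ⟨fun h => ⟨h, hx, rfl⟩, fun h => h.1⟩
  rw [h1, measure_inter_cyl (L := i + 1) (fun u _ => hAm.inter (measurableSet_cyl _ _))]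
  · refine tsum_congr fun u => ?_
    by_cases hu : IsExit (i + 1) u
    · rw [if_pos hu, if_pos hu, List.nil_append]
      have hx : ∀ x ∈ cyl k u, x ∈ A ↔ u.getLastD k = j := by
        intro x hx
        have hx' := mem_cyl_iff.1 hx
        have hlast : x u.length = u.getLastD k := by
          rw [hx' _ le_rfl, listPath_length]
        have hlt : ∀ m < u.length, x m ≤ i := by
          intro m hm
          rw [hx' m hm.le]
          cases m with
          | zero => exact hki
          | succ m => have := hu.listPath_lt m hm; rw [listPath_succ]; omega
        constructor
        · rintro ⟨n, hn, hlt'⟩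
          have : n = u.length := by
            rcases lt_trichotomy n u.length with h | h | h
            · have := hlt n h; omega
            · exact h
            · have := hlt' _ h
              have := hu.le_getLastD k
              omega
          rw [← hlast, ← this, hn]
        · intro h
          exact ⟨u.length, by rw [hlast, h], hlt⟩
      by_cases hj : u.getLastD k = j
      · beta_reduce
        rw [if_pos hj, mul_one, ← walkLaw_cyl]
        congr 1
        ext x
        exact ⟨fun h => h.2, fun h => ⟨(hx x h).2 hj, h⟩⟩
      · beta_reduce
        rw [if_neg hj, mul_zero]
        convert measure_empty (μ := walkLaw ω k)
        ext x
        simp only [Set.mem_inter_iff, Set.mem_empty_iff_false, iff_false, not_and]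
        exact fun h1 h2 => hj ((hx x h2).1 h1)
    · rw [if_neg hu, if_neg hu]
  · refine ae_of_all _ fun x hx hx' => ?_
    obtain ⟨n, hn, -⟩ := hx
    refine ⟨n, ?_, by omega⟩
    rw [List.length_nil]
    rcases Nat.eq_zero_or_pos n with rfl | h
    · have := hx'.1; omega
    · exact h

/-! ### The generations as functions of the exit word -/

lemma natCast_le_ladderTime {x : ℕ → ℤ} {m : ℕ} :
    (m : ℕ∞) ≤ ladderTime x ↔ ∀ n < m, x n ≤ 0 := by
  rw [ladderTime, le_sInf_iff]
  constructor
  · intro h n hn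
    by_contra h0
    have := h n ⟨n, rfl, not_le.1 h0⟩
    exact absurd (Nat.cast_le.1 this) (by omega)
  · rintro h t ⟨n, rfl, hn⟩
    refine Nat.cast_le.2 ?_
    by_contra h0
    have := h n (by omega)
    omega

/-- The cardinality is a countable sum of indicators. For an infinite set the sum is `∞`, whose
`toReal` is `0`, in agreement with `Set.ncard`. -/
lemma measurable_ncard {Ω ι : Type*} [MeasurableSpace Ω] [Countable ι] {S : Ω → Set ι}
    (h : ∀ i, MeasurableSet {x | i ∈ S x}) : Measurable fun x => (S x).ncard := by
  classical
  have h1 : Measurable fun x => ∑' i, (if i ∈ S x then (1 : ℝ≥0∞) else 0) :=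
    Measurable.tsum fun i => Measurable.ite (h i) measurable_const measurable_const
  have h2 : (fun x => (S x).ncard) = fun x =>
      ⌊(∑' i, (if i ∈ S x then (1 : ℝ≥0∞) else 0)).toReal⌋₊ := by
    funext x
    have h3 : ∑' i, (if i ∈ S x then (1 : ℝ≥0∞) else 0) = ((S x).encard : ℝ≥0∞) := by
      rw [← ENNReal.tsum_set_one, tsum_subtype (S x) (fun _ => (1 : ℝ≥0∞))]
      exact tsum_congr fun i => by simp [Set.indicator]
    rw [h3]
    by_cases hf : (S x).Finite
    · rw [← hf.cast_ncard_eq]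
      simp
    · replace hf : (S x).Infinite := hf
      simp [Set.Infinite.ncard hf, Set.Infinite.encard_eq hf]
  rw [h2]
  exact Nat.measurable_floor.comp h1.ennreal_toReal

lemma U_apply (x : ℕ → ℤ) (i : ℤ) (j : Fin 9) :
    U x i j = excursionCount x i (firstStep i j) (exitStep i (subtypeOf j)) := by
  fin_cases j <;> rfl

lemma measurable_withAncestor (n : ℕ) : Measurable fun x : ℕ → ℤ => withAncestor x n := by
  cases n with
  | zero => exact measurable_const
  | succ n => exact measurable_pi_apply n

lemma measurable_U (i : ℤ) : Measurable fun x : ℕ → ℤ => U x i := by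
  refine measurable_pi_lambda _ fun j => ?_
  simp_rw [U_apply, excursionCount]
  refine measurable_ncard fun ⟨k, m⟩ => ?_
  simp only [Set.mem_ofPred_eq, natCast_le_ladderTime, IsExcursion]
  have hp : ∀ n n' : ℕ, Measurable fun x : ℕ → ℤ => (withAncestor x n, withAncestor x n') :=
    fun n n' => (measurable_withAncestor n).prodMk (measurable_withAncestor n')
  refine MeasurableSet.inter (MeasurableSet.inter (MeasurableSet.const _) (MeasurableSet.inter ?_
    (MeasurableSet.inter ?_ ?_))) ?_
  · exact hp _ _ (measurableSet_singleton _)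
  · have : {x : ℕ → ℤ | ∀ n, k < n → n ≤ m → withAncestor x n ≤ i - 1} = ⋂ n, ⋂ (_ : k < n),
        ⋂ (_ : n ≤ m), (fun x => withAncestor x n) ⁻¹' Set.Iic (i - 1) := by ext; simp
    refine (congrArg MeasurableSet this).mpr ?_
    exact MeasurableSet.iInter fun n => MeasurableSet.iInter fun _ =>
      MeasurableSet.iInter fun _ => measurable_withAncestor n measurableSet_Iic
  · exact hp _ _ (measurableSet_singleton _)
  · have : {x : ℕ → ℤ | ∀ n < m, x n ≤ 0} =
        ⋂ n, ⋂ (_ : n < m), (fun x : ℕ → ℤ => x n) ⁻¹' Set.Iic 0 := by ext; simp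
    refine (congrArg MeasurableSet this).mpr ?_
    exact MeasurableSet.iInter fun n => MeasurableSet.iInter fun _ =>
      measurable_pi_apply n measurableSet_Iic

/-- On this cylinder `T₁` is the length of `w`. The imaginary step shifts time by one, so ending by
`T₁` means `m < w.length + 1`. -/
lemma U_eq_listCount {w : List ℤ} (hw : IsExit 1 w) {x : ℕ → ℤ} (hx : x ∈ cyl 0 w) (i : ℤ)
    (j : Fin 9) : U x i j = listCount (1 :: 0 :: w) i j := by
  have hx' := mem_cyl_iff.1 hx
  rw [U_apply, listCount, excursionCount]
  have hlen : (1 :: 0 :: w).length - 1 = w.length + 1 := by simp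
  rw [hlen, ← excursions_congr (y := withAncestor x)]
  · congr 1
    ext ⟨k, m⟩
    simp only [excursions, Set.mem_ofPred_eq, natCast_le_ladderTime]
    refine and_congr_right fun _ => ⟨fun h => ?_, fun h n hn => ?_⟩
    · by_contra hm
      have h1 := h w.length (by omega)
      rw [hx' _ le_rfl, listPath_length] at h1
      have := hw.le_getLastD 0
      omega
    · rw [hx' n (by omega)]
      cases n with
      | zero => simp
      | succ n => have := hw.listPath_lt n (by omega); rw [listPath_succ]; omega
  · intro n hn
    cases n with
    | zero => rfl
    | succ n => exact hx' n (by omega)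

end TwoTwoWalk

namespace TwoTwoWalk
open scoped ENNReal

/-! ### Probability generating functions -/

/-- Let `s` tend to `0`: the terms of positive order on the right are at most `s` times the total
mass of `g`. -/
lemma coeff_zero_le {f g : ℕ → ℝ≥0∞} (hg : ∑' n, g n ≠ ∞)
    (h : ∀ s : ℝ≥0∞, s ≠ 0 → s ≤ 1 → ∑' n, f n * s ^ n = ∑' n, g n * s ^ n) : f 0 ≤ g 0 := by
  refine ENNReal.le_of_forall_pos_le_add fun ε hε _ => ?_
  set C := ∑' n, g n with hC
  set s : ℝ≥0∞ := min 1 (ε / (C + 1)) with hs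
  have hC1 : C + 1 ≠ ∞ := ENNReal.add_ne_top.2 ⟨hg, ENNReal.one_ne_top⟩
  have hs0 : s ≠ 0 := by
    rw [hs, ← pos_iff_ne_zero, lt_min_iff]
    exact ⟨one_pos, ENNReal.div_pos (by simpa using hε.ne') hC1⟩
  have hs1 : s ≤ 1 := min_le_left _ _
  calc f 0 ≤ ∑' n, f n * s ^ n := by simpa using ENNReal.le_tsum (f := fun n => f n * s ^ n) 0
    _ = ∑' n, g n * s ^ n := h s hs0 hs1
    _ = g 0 + ∑' n, g (n + 1) * s ^ (n + 1) := by
      rw [tsum_eq_zero_add' ENNReal.summable, pow_zero, mul_one]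
    _ ≤ g 0 + ∑' n, g (n + 1) * s := by
      gcongr with n
      rw [pow_succ]
      exact mul_le_of_le_one_left' (pow_le_one' hs1 n)
    _ ≤ g 0 + C * s := by
      rw [ENNReal.tsum_mul_right]
      gcongr
      exact ENNReal.tsum_comp_le_tsum_of_injective (add_left_injective 1) g
    _ ≤ g 0 + ε := by
      gcongr
      calc C * s ≤ (C + 1) * (ε / (C + 1)) := by
            gcongr
            · exact le_self_add
            · exact min_le_right _ _
        _ ≤ ε := ENNReal.mul_div_le

/-- Compare the constant terms, cancel them, divide by `s` and repeat with the shifted sequences.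
The division is the reason for assuming the identity only at `s ≠ 0`. -/
lemma coeff_eq {f g : ℕ → ℝ≥0∞} (hf : ∑' n, f n ≠ ∞) (hg : ∑' n, g n ≠ ∞)
    (h : ∀ s : ℝ≥0∞, s ≠ 0 → s ≤ 1 → ∑' n, f n * s ^ n = ∑' n, g n * s ^ n) (n : ℕ) :
    f n = g n := by
  have h0 : f 0 = g 0 := le_antisymm (coeff_zero_le hg h)
    (coeff_zero_le hf fun s h1 h2 => (h s h1 h2).symm)
  induction n generalizing f g with
  | zero => exact h0
  | succ n ih =>
    have hf' : ∑' n, f (n + 1) ≠ ∞ := ne_top_of_le_ne_top hf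
      (ENNReal.tsum_comp_le_tsum_of_injective (add_left_injective 1) f)
    have hg' : ∑' n, g (n + 1) ≠ ∞ := ne_top_of_le_ne_top hg
      (ENNReal.tsum_comp_le_tsum_of_injective (add_left_injective 1) g)
    have h' : ∀ s : ℝ≥0∞, s ≠ 0 → s ≤ 1 →
        ∑' n, f (n + 1) * s ^ n = ∑' n, g (n + 1) * s ^ n := by
      intro s hs0 hs1
      have := h s hs0 hs1
      rw [tsum_eq_zero_add' (f := fun n => f n * s ^ n) ENNReal.summable,
        tsum_eq_zero_add' (f := fun n => g n * s ^ n) ENNReal.summable, h0,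
        ENNReal.add_right_inj] at this
      · simp_rw [pow_succ, ← mul_assoc] at this
        rw [ENNReal.tsum_mul_right, ENNReal.tsum_mul_right] at this
        exact (ENNReal.mul_left_inj hs0 (ne_top_of_le_ne_top ENNReal.one_ne_top hs1)).1 this
      · rw [pow_zero, mul_one]
        exact ne_top_of_le_ne_top hg (ENNReal.le_tsum 0)
    exact ih hf' hg' h' (le_antisymm (coeff_zero_le hg' h')
      (coeff_zero_le hf' fun s h1 h2 => (h' s h1 h2).symm))

lemma tsum_fiber_eq {ι : Type*} {f g : ι → ℝ≥0∞} (c : ι → ℕ) (hf : ∑' v, f v ≠ ∞)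
    (hg : ∑' v, g v ≠ ∞)
    (h : ∀ s : ℝ≥0∞, s ≤ 1 → ∑' v, f v * s ^ c v = ∑' v, g v * s ^ c v) (n : ℕ) :
    ∑' v, (if c v = n then f v else 0) = ∑' v, (if c v = n then g v else 0) := by
  have key : ∀ (f : ι → ℝ≥0∞) (s : ℝ≥0∞),
      ∑' n, (∑' v, (if c v = n then f v else 0)) * s ^ n = ∑' v, f v * s ^ c v := by
    intro f s
    simp_rw [← ENNReal.tsum_mul_right]
    rw [ENNReal.tsum_comm]
    refine tsum_congr fun v => ?_
    rw [tsum_eq_single (c v)]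
    · simp
    · intro n hn
      simp [hn.symm]
  refine coeff_eq (f := fun n => ∑' v, (if c v = n then f v else 0))
    (g := fun n => ∑' v, (if c v = n then g v else 0)) ?_ ?_ (fun s _ hs => ?_) n
  · simpa using (key f 1).trans_ne (by simpa using hf)
  · simpa using (key g 1).trans_ne (by simpa using hg)
  · rw [key, key, h s hs]

/-- A finite measure on vectors of natural numbers is determined by its generating function. -/
lemma pgf_ext {κ : Type*} [Fintype κ] {f g : (κ → ℕ) → ℝ≥0∞} (hf : ∑' v, f v ≠ ∞)
    (hg : ∑' v, g v ≠ ∞)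
    (h : ∀ s : κ → ℝ≥0∞, (∀ k, s k ≤ 1) →
      ∑' v, f v * ∏ k, s k ^ v k = ∑' v, g v * ∏ k, s k ^ v k) : f = g := by
  classical
  -- The coordinates are fixed one at a time: those in `S` are already equal to those of `u`, the
  -- others still carry their variables. Each stage is the one-variable statement `tsum_fiber_eq`.
  have key : ∀ (S : Finset κ) (u : κ → ℕ) (s : κ → ℝ≥0∞), (∀ k, s k ≤ 1) →
      ∑' v, (if ∀ k ∈ S, v k = u k then f v * ∏ k ∈ Sᶜ, s k ^ v k else 0) =
      ∑' v, (if ∀ k ∈ S, v k = u k then g v * ∏ k ∈ Sᶜ, s k ^ v k else 0) := by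
    intro S u
    induction S using Finset.induction_on with
    | empty => intro s hs; simpa using h s hs
    | insert k₀ S hk ih =>
      intro s hs
      have hfin : ∀ f : (κ → ℕ) → ℝ≥0∞, ∑' v, f v ≠ ∞ → ∑' v, (if ∀ k ∈ S, v k = u k then
          f v * ∏ k ∈ (insert k₀ S)ᶜ, s k ^ v k else 0) ≠ ∞ := by
        intro f hf
        refine ne_top_of_le_ne_top hf (ENNReal.tsum_le_tsum fun v => ?_)
        split_ifs
        · exact mul_le_of_le_one_right' (Finset.prod_le_one' fun _ _ => pow_le_one' (hs _) _)
        · exact zero_le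
      have := tsum_fiber_eq (fun v : κ → ℕ => v k₀) (hfin f hf) (hfin g hg) (fun t ht => ?_) (u k₀)
      · simpa only [Finset.forall_mem_insert, ite_and] using this
      · have hih := ih (Function.update s k₀ t) (fun k => by
          by_cases hk' : k = k₀
          · subst hk'; simpa using ht
          · simpa [hk'] using hs k)
        have hcompl : (S : Finset κ)ᶜ = insert k₀ (insert k₀ S)ᶜ := by
          ext k
          by_cases hk' : k = k₀
          · subst hk'; simp [hk]
          · simp [hk']
        have hprod : ∀ v : κ → ℕ, ∏ k ∈ Sᶜ, Function.update s k₀ t k ^ v k =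
            (∏ k ∈ (insert k₀ S)ᶜ, s k ^ v k) * t ^ v k₀ := by
          intro v
          rw [hcompl, Finset.prod_insert (by simp), Function.update_self, mul_comm]
          congr 1
          refine Finset.prod_congr rfl fun k hk' => ?_
          rw [Function.update_of_ne]
          rintro rfl
          simp at hk'
        simp_rw [hprod] at hih
        simpa only [ite_mul, zero_mul, mul_assoc] using hih
  funext u
  have h1 := key Finset.univ u 1 (by simp)
  simpa [← funext_iff] using h1

/-- The monomial of a sum is a product of monomials, and the expectation of a product factors over
the independent particles. -/
lemma tsum_totalOffspring {τ : Type*} [Fintype τ] (p : τ → PMF (τ → ℕ)) (u : τ → ℕ)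
    (s : τ → ℝ≥0∞) :
    ∑' v, totalOffspring p u {v} * ∏ j, s j ^ v j =
      ∏ j, (∑' v, p j v * ∏ k, s k ^ v k) ^ u j := by
  have hm : ∀ f : (τ → ℕ) → ℝ≥0∞, Measurable f := fun f => measurable_of_countable f
  have h1 : ∀ (μ : Measure (τ → ℕ)) (f : (τ → ℕ) → ℝ≥0∞), ∑' v, μ {v} * f v = ∫⁻ v, f v ∂μ := by
    intro μ f
    rw [lintegral_countable']
    exact tsum_congr fun v => mul_comm _ _
  have hsum : Measurable fun ξ : (Σ j, Fin (u j)) → τ → ℕ => ∑ i, ξ i := by fun_prop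
  rw [h1, totalOffspring, lintegral_map (hm _) hsum]
  have h2 : ∀ ξ : (Σ j, Fin (u j)) → τ → ℕ, ∏ j, s j ^ (∑ i, ξ i) j =
      ∏ i, ∏ j, s j ^ ξ i j := by
    intro ξ
    rw [Finset.prod_comm]
    refine Finset.prod_congr rfl fun j _ => ?_
    rw [Finset.sum_apply, Finset.prod_pow_eq_pow_sum]
  simp_rw [h2]
  have hind := iIndepFun_pi (μ := fun i : Σ j, Fin (u j) => (p i.1).toMeasure)
    (X := fun _ v => ∏ j, s j ^ v j) (fun i => (hm _).aemeasurable)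
  rw [lintegral_prod_eq_prod_lintegral_of_indepFun _ _ hind
    (fun i => (hm (fun v => ∏ j, s j ^ v j)).comp (measurable_pi_apply i))]
  rw [Fintype.prod_sigma]
  refine Finset.prod_congr rfl fun j _ => ?_
  have hpow : ∀ c : ℝ≥0∞, c ^ u j = ∏ _i : Fin (u j), c := fun c => by simp
  rw [hpow]
  refine Finset.prod_congr rfl fun i _ => ?_
  rw [← lintegral_map (μ := Measure.pi fun i : Σ j, Fin (u j) => (p i.1).toMeasure)
    (g := fun ξ => ξ ⟨j, i⟩) (f := fun v => ∏ k, s k ^ v k) (hm _) (measurable_pi_apply _),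
    (measurePreserving_eval _ _).map_eq, ← h1]
  refine tsum_congr fun v => ?_
  rw [PMF.toMeasure_apply_singleton _ _ (measurableSet_singleton v)]

end TwoTwoWalk

namespace TwoTwoWalk
open scoped ENNReal

/-! ### The generating function of the generations -/

variable {ω : ℤ → PMF ℤ} {lo : ℤ} {s s' : ℕ → Fin 9 → ℝ≥0∞}

/-- The generating function of the excursions below `lo + n` of the type `j`. -/
noncomputable def typeGen (ω : ℤ → PMF ℤ) (lo : ℤ) (s : ℕ → Fin 9 → ℝ≥0∞) (n : ℕ) (j : Fin 9) :
    ℝ≥0∞ :=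
  ![genA ω lo s n 0, genA ω lo s n 1, genA ω lo s n 2, genB ω lo s n 0, genB ω lo s n 1,
    genB ω lo s n 2, genA ω lo s n 0, genA ω lo s n 1, genA ω lo s n 2] j

/-- The probability that an excursion below `i` that has made the first step of the type `j` makes
also the last step of the type `j`. -/
noncomputable def hit (ω : ℤ → PMF ℤ) (i : ℤ) (j : Fin 9) : ℝ≥0∞ := typeGen ω i 1 0 j

lemma excGen_mono (h : ∀ k j, s k j ≤ s' k j) (n : ℕ) (p a : ℤ) (r : Fin 3) :
    excGen ω lo s n p a r ≤ excGen ω lo s' n p a r := by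
  classical
  refine exitSum_mono fun u _ => mul_le_mul_left ?_ _
  exact Finset.prod_le_prod' fun k _ => Finset.prod_le_prod' fun j _ => pow_le_pow_left' (h k j) _

lemma typeGen_mono (h : ∀ k j, s k j ≤ s' k j) (n : ℕ) (j : Fin 9) :
    typeGen ω lo s n j ≤ typeGen ω lo s' n j := by
  fin_cases j <;> exact excGen_mono h n _ _ _

lemma typeGen_zero (s : ℕ → Fin 9 → ℝ≥0∞) (j : Fin 9) : typeGen ω lo s 0 j = hit ω lo j := by
  have h : ∀ p a r, excGen ω lo s 0 p a r = excGen ω lo 1 0 p a r := fun p a r => rfl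
  fin_cases j <;> exact h _ _ _

lemma excGen_shift (n : ℕ) (p a : ℤ) (r : Fin 3) :
    excGen ω lo 1 n p a r = excGen ω (lo + n) 1 0 p a r := by
  classical
  unfold excGen
  simp [excWeight]

lemma typeGen_one (n : ℕ) (j : Fin 9) : typeGen ω lo 1 n j = hit ω (lo + n) j := by
  unfold hit
  fin_cases j <;> simp [typeGen, genA, genB, excGen_shift]

/-- The recursion depends on the weights only through the products with the generating functions
of the types. -/
lemma typeGen_succ_congr (hω : ∀ i, (ω i).support ⊆ {-2, -1, 1, 2}) {lo' : ℤ} {n n' : ℕ}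
    (hl : lo + n = lo' + n')
    (h : ∀ j, s n j * typeGen ω lo s n j = s' n' j * typeGen ω lo' s' n' j) (j : Fin 9) :
    typeGen ω lo s (n + 1) j = typeGen ω lo' s' (n' + 1) j := by
  have h0 := h 0
  have h1 := h 1
  have h2 := h 2
  have h3 := h 3
  have h4 := h 4
  have h5 := h 5
  have h6 := h 6
  have h7 := h 7
  have h8 := h 8
  simp only [typeGen, Matrix.cons_val] at h0 h1 h2 h3 h4 h5 h6 h7 h8
  have hA : ∀ r, genA ω lo s (n + 1) r = genA ω lo' s' (n' + 1) r := by
    intro r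
    rw [genA_succ hω, genA_succ hω, genLoop, genLoop, genLast, genLast, hl, h0, h1, h2, h3, h4, h5]
  have hB : ∀ r, genB ω lo s (n + 1) r = genB ω lo' s' (n' + 1) r := by
    intro r
    rw [genB_succ hω, genB_succ hω, hA, h6, h7, h8]
  unfold typeGen
  simp only [hA, hB]

/-- The numbers of excursions in `N` consecutive generations. -/
noncomputable def gens (lo : ℤ) (N : ℕ) (x : ℕ → ℤ) : Fin N → Fin 9 → ℕ :=
  fun k => U x (lo + k)

lemma measurable_gens (lo : ℤ) (N : ℕ) : Measurable (gens lo N) :=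
  measurable_pi_lambda _ fun _ => measurable_U _

/-- An event that is decided by the word up to `T₁` has the total weight of the favourable words,
because `T₁` is almost surely finite. -/
lemma walkLaw_eq_exitSum (hT : Transient ω) {A : Set (ℕ → ℤ)} (hA : MeasurableSet A)
    {Q : List ℤ → Prop} [DecidablePred Q] (hQ : ∀ w, IsExit 1 w → ∀ x ∈ cyl 0 w, x ∈ A ↔ Q w) :
    walkLaw ω 0 A = exitSum ω 1 0 (fun w => if Q w then 1 else 0) := by
  have h1 : walkLaw ω 0 A = walkLaw ω 0 (A ∩ cyl 0 []) := by
    refine measure_congr ?_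
    filter_upwards [ae_walkLaw_start (ω := ω) 0] with x hx
    exact propext ⟨fun h => ⟨h, hx, rfl⟩, fun h => h.1⟩
  rw [h1, measure_inter_cyl (L := 1) (fun u _ => hA.inter (measurableSet_cyl _ _))]
  · refine tsum_congr fun w => ?_
    by_cases hw : IsExit 1 w
    · rw [if_pos hw, if_pos hw, List.nil_append]
      beta_reduce
      by_cases hq : Q w
      · rw [if_pos hq, mul_one, ← walkLaw_cyl]
        congr 1
        ext x
        exact ⟨fun h => h.2, fun h => ⟨(hQ w hw x h).2 hq, h⟩⟩
      · rw [if_neg hq, mul_zero]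
        convert measure_empty (μ := walkLaw ω 0)
        ext x
        simp only [Set.mem_inter_iff, Set.mem_empty_iff_false, iff_false, not_and]
        exact fun h1 h2 => hq ((hQ w hw x h2).1 h1)
    · rw [if_neg hw, if_neg hw]
  · filter_upwards [hT] with x hx _ _ using hx _ _

lemma tsum_gens (hT : Transient ω) (lo : ℤ) (N : ℕ) (s : ℕ → Fin 9 → ℝ≥0∞) :
    ∑' v, walkLaw ω 0 {x | gens lo N x = v} * ∏ k : Fin N, ∏ j, s k j ^ v k j =
      exitSum ω 1 0 (fun w => excWeight lo s N (1 :: 0 :: w)) := by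
  classical
  have h1 : ∀ v, walkLaw ω 0 {x | gens lo N x = v} = exitSum ω 1 0 (fun w =>
      if (fun (k : Fin N) j => listCount (1 :: 0 :: w) (lo + k) j) = v then 1 else 0) := by
    intro v
    refine walkLaw_eq_exitSum (A := {x | gens lo N x = v}) hT
      (measurableSet_eq_fun (measurable_gens lo N) measurable_const) ?_
    intro w hw x hx
    rw [Set.mem_ofPred_eq]
    have : gens lo N x = fun (k : Fin N) j => listCount (1 :: 0 :: w) (lo + k) j := by
      funext k j
      exact U_eq_listCount hw hx _ _
    rw [this]
  simp_rw [h1, ← exitSum_mul_right]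
  rw [← exitSum_tsum]
  refine exitSum_congr fun w _ _ => ?_
  rw [tsum_eq_single (fun (k : Fin N) j => listCount (1 :: 0 :: w) (lo + k) j)]
  · rw [if_pos rfl, one_mul, excWeight, Finset.prod_range]
  · intro v hv
    rw [if_neg hv.symm, zero_mul]

/-- With the imaginary step `1 → 0` in front, the path up to `T₁` is a single excursion of type A
below `1`; hence the top generation has one particle, of type 0, 1 or 2. -/
lemma tsum_gens_eq (hω : ∀ i, (ω i).support ⊆ {-2, -1, 1, 2}) (hT : Transient ω) {m : ℕ}
    (hm : lo + m = 1) (s : ℕ → Fin 9 → ℝ≥0∞) :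
    ∑' v, walkLaw ω 0 {x | gens lo (m + 1) x = v} * ∏ k : Fin (m + 1), ∏ j, s k j ^ v k j =
      s m 0 * typeGen ω lo s m 0 + s m 1 * typeGen ω lo s m 1 + s m 2 * typeGen ω lo s m 2 := by
  rw [tsum_gens hT]
  have := exitSum_excWeight_succ (lo := lo) (s := s) (n := m) (p := 1) (a := 0) (L := 1) hω hm.symm
    (by norm_num) (ty := ![0, 1, 2]) (by intro r; fin_cases r <;> simp [firstStep])
    (by intro r; fin_cases r <;> rfl) (fun _ => 1)
  simp only [mul_one, Fin.sum_univ_three] at this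
  rw [this]
  have h : ∀ r, excGen ω lo s m 1 0 r = genA ω lo s m r := by
    intro r
    rw [genA, hm]
    rfl
  simp only [h]
  rfl

/-- The conditional generating function of the offspring of an excursion of the type `j`
below `lo + 1`. -/
noncomputable def offspringGen (ω : ℤ → PMF ℤ) (lo : ℤ) (s : Fin 9 → ℝ≥0∞) (j : Fin 9) : ℝ≥0∞ :=
  typeGen ω lo (fun _ => s) 1 j / hit ω (lo + 1) j

/-- The cylinders of distinct exit words are disjoint. -/
lemma exitSum_le_one (L a : ℤ) : exitSum ω L a (fun _ => 1) ≤ 1 := by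
  classical
  have h : Disjoint (Set.univ : Set (ℕ → ℤ)) ∅ := by simp
  calc exitSum ω L a (fun _ => 1)
      = ∑' u : {u : List ℤ // IsExit L u}, walkLaw ω a (cyl a u) := by
        have := tsum_subtype {u : List ℤ | IsExit L u} (fun u => walkLaw ω a (cyl a u))
        refine Eq.trans (tsum_congr fun u => ?_) this.symm
        simp [Set.indicator, walkLaw_cyl]
    _ = walkLaw ω a (⋃ u : {u : List ℤ // IsExit L u}, cyl a u) := by
        rw [measure_iUnion _ fun u => measurableSet_cyl _ _]
        rintro ⟨u, hu⟩ ⟨u', hu'⟩ hne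
        refine Set.disjoint_left.2 ?_
        rintro x h1 h2
        exact hne (Subtype.ext (hu.eq_of_seg hu' h1.2 h2.2))
    _ ≤ 1 := prob_le_one

lemma excGen_le_one (hs : ∀ k j, s k j ≤ 1) (n : ℕ) (p a : ℤ) (r : Fin 3) :
    excGen ω lo s n p a r ≤ 1 := by
  classical
  refine le_trans (exitSum_mono fun u _ => ?_) (exitSum_le_one _ _)
  refine mul_le_one' (excWeight_le_one hs _ _) ?_
  split_ifs <;> simp

lemma hit_le_one (i : ℤ) (j : Fin 9) : hit ω i j ≤ 1 := by
  fin_cases j <;> exact excGen_le_one (fun _ _ => le_rfl) _ _ _ _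

lemma hit_ne_top (i : ℤ) (j : Fin 9) : hit ω i j ≠ ∞ :=
  ne_top_of_le_ne_top ENNReal.one_ne_top (hit_le_one i j)

/-- The division is harmless where `hit` vanishes: for weights at most one, `typeGen` is bounded by
`hit` and vanishes too. -/
lemma offspringGen_mul_hit (hω : ∀ i, (ω i).support ⊆ {-2, -1, 1, 2}) (hs : ∀ k j, s k j ≤ 1)
    (j : Fin 9) :
    offspringGen ω lo (s 0) j * hit ω (lo + 1) j = typeGen ω lo s 1 j := by
  have h1 : typeGen ω lo (fun _ => s 0) 1 j = typeGen ω lo s 1 j :=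
    typeGen_succ_congr hω rfl (fun j => by rw [typeGen_zero, typeGen_zero]) j
  rw [offspringGen, h1]
  refine ENNReal.div_mul_cancel' (fun h0 => ?_) (fun h => (hit_ne_top _ _ h).elim)
  have h2 := typeGen_mono (ω := ω) (lo := lo) (s := s) (s' := 1) hs 1 j
  rw [typeGen_one, Nat.cast_one, h0] at h2
  exact nonpos_iff_eq_zero.1 h2

/-- The branching property, in terms of generating functions. -/
lemma tsum_gens_branching (hω : ∀ i, (ω i).support ⊆ {-2, -1, 1, 2}) (hT : Transient ω) {m : ℕ}
    (hm : lo + (m + 1 : ℕ) = 1) (hs : ∀ k j, s k j ≤ 1) :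
    ∑' v, walkLaw ω 0 {x | gens lo (m + 2) x = v} * ∏ k : Fin (m + 2), ∏ j, s k j ^ v k j =
      ∑' v, walkLaw ω 0 {x | gens (lo + 1) (m + 1) x = v} *
        ((∏ k : Fin (m + 1), ∏ j, s (k + 1) j ^ v k j) *
        ∏ j, offspringGen ω lo (s 0) j ^ v 0 j) := by
  -- The lowest generation is absorbed into the weights of the next one; all higher weights are only
  -- shifted.
  set s' : ℕ → Fin 9 → ℝ≥0∞ := fun k j =>
    if k = 0 then s 1 j * offspringGen ω lo (s 0) j else s (k + 1) j with hs'
  have hprod : ∀ v : Fin (m + 1) → Fin 9 → ℕ, (∏ k : Fin (m + 1), ∏ j, s (k + 1) j ^ v k j) *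
      ∏ j, offspringGen ω lo (s 0) j ^ v 0 j = ∏ k : Fin (m + 1), ∏ j, s' k j ^ v k j := by
    intro v
    rw [Fin.prod_univ_succ (fun k : Fin (m + 1) => ∏ j, s (k + 1) j ^ v k j),
      Fin.prod_univ_succ (fun k : Fin (m + 1) => ∏ j, s' k j ^ v k j), mul_right_comm,
      ← Finset.prod_mul_distrib]
    congr 1
    refine Finset.prod_congr rfl fun j _ => ?_
    simp [hs', mul_pow]
  -- The two systems agree at the bottom by the choice of `s'`, and the recursion propagates the
  -- agreement upwards.
  have key : ∀ k : ℕ, ∀ j, s (k + 1) j * typeGen ω lo s (k + 1) j =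
      s' k j * typeGen ω (lo + 1) s' k j := by
    intro k
    induction k with
    | zero =>
      intro j
      rw [typeGen_zero, ← offspringGen_mul_hit hω hs, ← mul_assoc]
      simp [hs']
    | succ k ih =>
      intro j
      rw [typeGen_succ_congr hω (lo := lo) (n := k + 1) (lo' := lo + 1) (n' := k)
        (by push_cast; ring) ih]
      simp [hs']
  simp_rw [hprod]
  rw [tsum_gens_eq hω hT hm, tsum_gens_eq hω hT (by push_cast at hm; linarith)]
  simp only [key]

end TwoTwoWalk

namespace TwoTwoWalk
open scoped ENNReal

/-! ### The branching property -/

variable {ω : ℤ → PMF ℤ} {lo : ℤ}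

lemma pgf_ext_curried {N : ℕ} {f g : (Fin N → Fin 9 → ℕ) → ℝ≥0∞} (hf : ∑' v, f v ≠ ∞)
    (h : ∀ s : ℕ → Fin 9 → ℝ≥0∞, (∀ k j, s k j ≤ 1) →
      ∑' v, f v * ∏ k : Fin N, ∏ j, s k j ^ v k j =
        ∑' v, g v * ∏ k : Fin N, ∏ j, s k j ^ v k j) : f = g := by
  have hg : ∑' v, g v ≠ ∞ := by
    have := h 1 (fun _ _ => le_rfl)
    simp only [Pi.one_apply, one_pow, Finset.prod_const_one, mul_one] at this
    rwa [← this]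
  set e := Equiv.curry (Fin N) (Fin 9) ℕ with he
  have key : (fun v => f (e v)) = fun v => g (e v) := by
    refine pgf_ext (κ := Fin N × Fin 9) ?_ ?_ fun s hs => ?_
    · rwa [e.tsum_eq]
    · rwa [e.tsum_eq]
    · have h1 := h (fun k j => if hk : k < N then s (⟨k, hk⟩, j) else 1) (fun k j => by
        split_ifs
        · exact hs _
        · exact le_rfl)
      rw [← e.tsum_eq, ← e.tsum_eq (fun v => g v * _)] at h1
      simpa [Fintype.prod_prod_type, he] using h1
  funext v
  have := congrFun key (e.symm v)
  simpa using this

lemma gens_eq_iff {N : ℕ} {x : ℕ → ℤ} {v : Fin N → Fin 9 → ℕ} :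
    gens lo N x = v ↔ ∀ k : Fin N, U x (lo + k) = v k := funext_iff

lemma tsum_walkLaw_gens_ne_top (hT : Transient ω) (lo : ℤ) (N : ℕ) :
    ∑' v, walkLaw ω 0 {x | gens lo N x = v} ≠ ∞ := by
  have h := tsum_gens hT lo N 1
  simp only [Pi.one_apply, one_pow, Finset.prod_const_one, mul_one] at h
  rw [h]
  refine ne_top_of_le_ne_top ENNReal.one_ne_top ?_
  refine le_trans (exitSum_mono fun w _ => ?_) (exitSum_le_one (ω := ω) 1 0)
  exact excWeight_le_one (fun _ _ => le_rfl) _ _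

/-- The branching property of the generations. -/
lemma walkLaw_gens_succ (hω : ∀ i, (ω i).support ⊆ {-2, -1, 1, 2}) (hT : Transient ω) {m : ℕ}
    (hm : lo + (m + 1 : ℕ) = 1) {p : Fin 9 → PMF (Fin 9 → ℕ)}
    (hp : ∀ j, walkLaw ω 0 {x | U x (lo + 1) j ≠ 0} ≠ 0 → ∀ s : Fin 9 → ℝ≥0∞, (∀ k, s k ≤ 1) →
      ∑' v, p j v * ∏ k, s k ^ v k = offspringGen ω lo s j) (v : Fin (m + 2) → Fin 9 → ℕ) :
    walkLaw ω 0 {x | gens lo (m + 2) x = v} =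
      walkLaw ω 0 {x | gens (lo + 1) (m + 1) x = Fin.tail v} *
        totalOffspring p (v 1) {v 0} := by
  refine congrFun (pgf_ext_curried (f := fun v => walkLaw ω 0 {x | gens lo (m + 2) x = v})
    (g := fun v => walkLaw ω 0 {x | gens (lo + 1) (m + 1) x = Fin.tail v} *
        totalOffspring p (v 1) {v 0}) (tsum_walkLaw_gens_ne_top hT _ _) fun s hs => ?_) v
  -- A family of generations is split into its lowest member and the rest; the sum over the lowest
  -- one is the generating function of the total offspring.
  rw [tsum_gens_branching hω hT hm hs, ← (Fin.consEquiv fun _ : Fin (m + 2) => Fin 9 → ℕ).tsum_eq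
    (fun v => walkLaw ω 0 {x | gens (lo + 1) (m + 1) x = Fin.tail v} *
      totalOffspring p (v 1) {v 0} * ∏ k : Fin (m + 2), ∏ j, s k j ^ v k j),
    ENNReal.tsum_prod', ENNReal.tsum_comm]
  refine tsum_congr fun t => ?_
  have hcons : ∀ u : Fin 9 → ℕ, Fin.consEquiv (fun _ : Fin (m + 2) => Fin 9 → ℕ) (u, t) =
      (Fin.cons u t : Fin (m + 2) → Fin 9 → ℕ) := fun u => rfl
  have h1 : ∀ u : Fin 9 → ℕ, (Fin.cons u t : Fin (m + 2) → Fin 9 → ℕ) 1 = t 0 := fun u => rfl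
  simp only [hcons, h1, Fin.tail_cons, Fin.cons_zero]
  have h2 : ∀ u : Fin 9 → ℕ, ∏ k : Fin (m + 2), ∏ j,
      s k j ^ (Fin.cons u t : Fin (m + 2) → Fin 9 → ℕ) k j =
      (∏ j, s 0 j ^ u j) * ∏ k : Fin (m + 1), ∏ j, s (k + 1) j ^ t k j := by
    intro u
    rw [Fin.prod_univ_succ (fun k : Fin (m + 2) => ∏ j,
      s k j ^ (Fin.cons u t : Fin (m + 2) → Fin 9 → ℕ) k j)]
    rfl
  simp only [h2]
  have h3 : ∀ u : Fin 9 → ℕ, walkLaw ω 0 {x | gens (lo + 1) (m + 1) x = t} *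
      totalOffspring p (t 0) {u} * ((∏ j, s 0 j ^ u j) *
        ∏ k : Fin (m + 1), ∏ j, s (k + 1) j ^ t k j) =
      walkLaw ω 0 {x | gens (lo + 1) (m + 1) x = t} *
        (∏ k : Fin (m + 1), ∏ j, s (k + 1) j ^ t k j) *
        (totalOffspring p (t 0) {u} * ∏ j, s 0 j ^ u j) := fun u => by ring
  simp only [h3]
  rw [ENNReal.tsum_mul_left, tsum_totalOffspring, ← mul_assoc]
  by_cases h0 : walkLaw ω 0 {x | gens (lo + 1) (m + 1) x = t} = 0
  · simp [h0]
  congr 1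
  refine Finset.prod_congr rfl fun j _ => ?_
  -- The hypothesis `hp` is available only for types that occur. A type without particles in `t 0`
  -- contributes the power `0`, and a type with particles occurs because `t` has positive
  -- probability.
  by_cases hj : t 0 j = 0
  · simp [hj]
  · rw [hp j (fun h => h0 (measure_mono_null (fun x hx => ?_) h)) _ (hs 0)]
    have := congrFun (gens_eq_iff.1 hx 0) j
    rw [Fin.val_zero, Nat.cast_zero, add_zero] at this
    simpa [this] using hj

end TwoTwoWalk

namespace TwoTwoWalk
open scoped ENNReal

/-! ### The explicit constants -/

variable {ω : ℤ → PMF ℤ}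

open Classical in
lemma hit_eq (i : ℤ) (j : Fin 9) : hit ω i j = exitSum ω i (firstStep i j).2
    (fun u => if lastStep (firstStep i j).2 u = exitStep i (subtypeOf j) then 1 else 0) := by
  have h : ∀ p a r, excGen ω i 1 0 p a r =
      exitSum ω i a (fun u => if lastStep a u = exitStep i r then 1 else 0) := by
    intro p a r
    simp [excGen, excWeight]
  unfold hit
  fin_cases j <;> simp [typeGen, genA, genB, h, firstStep, subtypeOf] <;> congr!

lemma exitSum_hit (hω : ∀ i, (ω i).support ⊆ {-2, -1, 1, 2}) {i a : ℤ} {ty : Fin 3 → Fin 9}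
    (ha : a < i) (hty : ∀ r, (firstStep i (ty r)).2 = a) (hsub : ∀ r, subtypeOf (ty r) = r)
    (X : ℤ × ℤ → ℝ≥0∞) :
    exitSum ω i a (fun u => X (lastStep a u)) = ∑ r, hit ω i (ty r) * X (exitStep i r) := by
  classical
  simp_rw [hit_eq, hty, hsub, ← exitSum_mul_right, ← exitSum_finset_sum]
  refine exitSum_congr fun u hu h0 => ?_
  obtain ⟨r, hr⟩ := exists_lastStep_eq hω ha hu h0
  rw [Finset.sum_eq_single r]
  · rw [if_pos hr, one_mul, hr]
  · intro r' _ hne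
    rw [hr, if_neg (fun h => hne (exitStep_injective _ h).symm), zero_mul]
  · simp

/-- The probability of a return to the site `i` from below. -/
noncomputable def loopProb (ω : ℤ → PMF ℤ) (i : ℤ) : ℝ≥0∞ :=
  ω i (-1) * (hit ω i 0 + hit ω i 1) + ω i (-2) * (hit ω i 3 + hit ω i 4)

lemma sum_hit_A (hω : ∀ i, (ω i).support ⊆ {-2, -1, 1, 2})
    (hT : Transient ω) {i : ℤ} (h : Reach ω (i - 1)) :
    hit ω i 0 + hit ω i 1 + hit ω i 2 = 1 := by
  rw [← h.exitSum_one hT i, exitSum_hit hω (ty := ![0, 1, 2]) (by omega)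
    (by intro r; fin_cases r <;> rfl) (by intro r; fin_cases r <;> rfl) (fun _ => 1)]
  simp [Fin.sum_univ_three]

lemma sum_hit_B (hω : ∀ i, (ω i).support ⊆ {-2, -1, 1, 2})
    (hT : Transient ω) {i : ℤ} (h : Reach ω (i - 2)) :
    hit ω i 3 + hit ω i 4 + hit ω i 5 = 1 := by
  rw [← h.exitSum_one hT i, exitSum_hit hω (ty := ![3, 4, 5]) (by omega)
    (by intro r; fin_cases r <;> rfl) (by intro r; fin_cases r <;> rfl) (fun _ => 1)]
  simp [Fin.sum_univ_three]

/-- Among the three possible last steps, those of subtypes 1 and 2 are the ones that land at `i`. -/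
lemma exitProb_A (hω : ∀ i, (ω i).support ⊆ {-2, -1, 1, 2})
    (i : ℤ) : exitProb ω (i - 1) (i - 1) i = (hit ω i 0 + hit ω i 1).toReal := by
  classical
  rw [exitProb_eq le_rfl (by omega), show i - 1 + 1 = i by ring]
  simp_rw [← lastStep_snd]
  rw [exitSum_hit hω (ty := ![0, 1, 2]) (by omega)
    (by intro r; fin_cases r <;> rfl) (by intro r; fin_cases r <;> rfl)
    (fun q => if q.2 = i then 1 else 0)]
  simp [Fin.sum_univ_three, exitStep]

lemma exitProb_B (hω : ∀ i, (ω i).support ⊆ {-2, -1, 1, 2})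
    (i : ℤ) : exitProb ω (i - 2) (i - 1) i = (hit ω i 3 + hit ω i 4).toReal := by
  classical
  rw [exitProb_eq (by omega) (by omega), show i - 1 + 1 = i by ring]
  simp_rw [← lastStep_snd]
  rw [exitSum_hit hω (ty := ![3, 4, 5]) (by omega)
    (by intro r; fin_cases r <;> rfl) (by intro r; fin_cases r <;> rfl)
    (fun q => if q.2 = i then 1 else 0)]
  simp [Fin.sum_univ_three, exitStep]

lemma reach_of_hit {i : ℤ} (h : Reach ω (i - 1)) (h0 : hit ω i 0 + hit ω i 1 ≠ 0) :
    Reach ω i := by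
  classical
  have hex : ∃ j : Fin 9, (firstStep i j).2 = i - 1 ∧ (exitStep i (subtypeOf j)).2 = i ∧
      hit ω i j ≠ 0 := by
    by_cases h1 : hit ω i 0 = 0
    · exact ⟨1, rfl, rfl, fun h2 => h0 (by rw [h1, h2, add_zero])⟩
    · exact ⟨0, rfl, rfl, h1⟩
  obtain ⟨j, hj1, hj2, hj⟩ := hex
  rw [hit_eq, hj1, exitSum] at hj
  obtain ⟨u, hu⟩ := not_forall.1 (mt ENNReal.tsum_eq_zero.2 hj)
  by_cases h3 : IsExit i u
  · rw [if_pos h3] at hu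
    by_cases h4 : lastStep (i - 1) u = exitStep i (subtypeOf j)
    · exact h.trans (left_ne_zero_of_mul hu) (by rw [← lastStep_snd, h4, hj2])
    · simp [h4] at hu
  · simp [h3] at hu

/-- The generating functions of the excursions below `i + 1` in terms of those below `i`. -/
lemma typeGen_formula (hω : ∀ i, (ω i).support ⊆ {-2, -1, 1, 2})
    (i : ℤ) (s : Fin 9 → ℝ≥0∞) :
    let κ := ω i (-1) * (s 0 * hit ω i 0 + s 1 * hit ω i 1) +
      ω i (-2) * (s 3 * hit ω i 3 + s 4 * hit ω i 4)
    let T := typeGen ω i (fun _ => s) 1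
    let q := s 6 * hit ω i 0 + s 7 * hit ω i 1
    T 0 = (1 - κ)⁻¹ * ω i 1 ∧
    T 1 = (1 - κ)⁻¹ * (ω i (-1) * (s 2 * hit ω i 2) + ω i (-2) * (s 5 * hit ω i 5)) ∧
    T 2 = (1 - κ)⁻¹ * ω i 2 ∧
    T 3 = q * T 0 ∧ T 4 = q * T 1 + s 8 * hit ω i 2 ∧ T 5 = q * T 2 ∧
    T 6 = T 0 ∧ T 7 = T 1 ∧ T 8 = T 2 := by
  have h := typeGen_zero (ω := ω) (lo := i) (fun _ => s)
  have h0 := h 0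
  have h1 := h 1
  have h2 := h 2
  have h3 := h 3
  have h4 := h 4
  have h5 := h 5
  simp only [typeGen, Matrix.cons_val] at h0 h1 h2 h3 h4 h5
  have hA := fun r => genA_succ (lo := i) (s := fun _ => s) hω 0 r
  have hB := fun r => genB_succ (lo := i) (s := fun _ => s) hω 0 r
  simp only [genLoop, genLast, h0, h1, h2, h3, h4, h5, zero_add, Nat.cast_zero, add_zero] at hA hB
  simp only [typeGen, Matrix.cons_val]
  refine ⟨hA 0, hA 1, hA 2, ?_, ?_, ?_⟩
  · rw [hB 0]; simp
  · rw [hB 1]; simp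
  · rw [hB 2]; simp

/-- The recursion for the probabilities of the types. -/
lemma hit_succ (hω : ∀ i, (ω i).support ⊆ {-2, -1, 1, 2})
    (i : ℤ) :
    hit ω (i + 1) 0 = (1 - loopProb ω i)⁻¹ * ω i 1 ∧
    hit ω (i + 1) 1 = (1 - loopProb ω i)⁻¹ * (ω i (-1) * hit ω i 2 + ω i (-2) * hit ω i 5) ∧
    hit ω (i + 1) 2 = (1 - loopProb ω i)⁻¹ * ω i 2 ∧
    hit ω (i + 1) 3 = (hit ω i 0 + hit ω i 1) * hit ω (i + 1) 0 ∧
    hit ω (i + 1) 4 = (hit ω i 0 + hit ω i 1) * hit ω (i + 1) 1 + hit ω i 2 ∧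
    hit ω (i + 1) 5 = (hit ω i 0 + hit ω i 1) * hit ω (i + 1) 2 := by
  have h := typeGen_formula hω i 1
  have e : typeGen ω i (fun _ => 1) 1 = hit ω (i + 1) := by
    funext j
    have := typeGen_one (ω := ω) (lo := i) 1 j
    rwa [Nat.cast_one] at this
  simp only [e, Pi.one_apply, one_mul] at h
  obtain ⟨h0, h1, h2, h3, h4, h5, -⟩ := h
  exact ⟨h0, h1, h2, h3, h4, h5⟩

/-- If the return probability were at least one, the factor `(1 - loopProb ω i)⁻¹` would be `∞`, and
the three probabilities at level `i + 1` would add up to `0` or `∞` instead of `1`. -/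
lemma loopProb_lt_one (hω : ∀ i, (ω i).support ⊆ {-2, -1, 1, 2})
    (hT : Transient ω) {i : ℤ} (h : Reach ω i) : loopProb ω i < 1 := by
  by_contra hge
  have hsum := sum_hit_A hω hT (i := i + 1) (by simpa using h)
  obtain ⟨h0, h1, h2, -⟩ := hit_succ hω i
  rw [h0, h1, h2, tsub_eq_zero_of_le (not_lt.1 hge), ENNReal.inv_zero, ← mul_add, ← mul_add,
    ENNReal.top_mul'] at hsum
  split_ifs at hsum <;> simp at hsum

/-- The binomial theorem on each antidiagonal. -/
lemma tsum_choose_mul_pow (x y : ℝ≥0∞) (f : ℕ → ℝ≥0∞) :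
    ∑' p : ℕ × ℕ, ((p.1 + p.2).choose p.1 : ℝ≥0∞) * x ^ p.1 * y ^ p.2 * f (p.1 + p.2) =
      ∑' n, (x + y) ^ n * f n := by
  rw [← (Finset.HasAntidiagonal.sigmaAntidiagonalEquivProd (A := ℕ)).tsum_eq
    (fun p : ℕ × ℕ => ((p.1 + p.2).choose p.1 : ℝ≥0∞) * x ^ p.1 * y ^ p.2 * f (p.1 + p.2)),
    ENNReal.tsum_sigma']
  refine tsum_congr fun n => ?_
  rw [tsum_fintype, (Commute.all x y).add_pow', Finset.sum_mul]
  refine Eq.trans ?_ (Finset.sum_coe_sort (Finset.HasAntidiagonal.antidiagonal n)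
    (fun p : ℕ × ℕ => n.choose p.1 • (x ^ p.1 * y ^ p.2) * f n))
  refine Finset.sum_congr rfl fun p _ => ?_
  have hp := Finset.HasAntidiagonal.mem_antidiagonal.1 p.2
  simp only [Finset.HasAntidiagonal.sigmaAntidiagonalEquivProd_apply, hp, nsmul_eq_mul, mul_assoc]

lemma factorial_div_eq_choose (n m : ℕ) :
    ((n + m)! : ℝ) / (n ! * m !) = ((n + m).choose n : ℝ) := by
  rw [div_eq_iff (by positivity), ← Nat.add_choose_mul_factorial_mul_factorial]
  rw [Nat.choose_symm_add]
  push_cast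
  ring

lemma loopSum_eq (hω : ∀ i, (ω i).support ⊆ {-2, -1, 1, 2}) {i : ℤ} (h : loopProb ω (i - 1) < 1) :
    loopSum ω i = ((1 - loopProb ω (i - 1))⁻¹).toReal := by
  set x := ω (i - 1) (-1) * (hit ω (i - 1) 0 + hit ω (i - 1) 1) with hx
  set y := ω (i - 1) (-2) * (hit ω (i - 1) 3 + hit ω (i - 1) 4) with hy
  have hxy : loopProb ω (i - 1) = x + y := rfl
  have e1 := exitProb_A hω (i - 1)
  have e2 := exitProb_B hω (i - 1)
  rw [show i - 1 - 1 = i - 2 by ring] at e1 e2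
  rw [show i - 1 - 2 = i - 3 by ring] at e2
  have key := tsum_choose_mul_pow x y (fun _ => 1)
  simp only [mul_one] at key
  rw [ENNReal.tsum_geometric, ← hxy] at key
  have hfin : (1 - loopProb ω (i - 1))⁻¹ ≠ ∞ := by
    rw [ENNReal.inv_ne_top]
    exact (tsub_pos_of_lt h).ne'
  rw [← key, ENNReal.tsum_toReal_eq]
  · refine tsum_congr fun p => ?_
    rw [factorial_div_eq_choose, e1, e2, jump, jump]
    simp [hx, hy]
  · intro p
    exact ne_top_of_le_ne_top (key ▸ hfin) (ENNReal.le_tsum p)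

lemma toReal_mul_middle {c x y z : ℝ≥0∞} (h : x + y + z = 1) :
    c.toReal - (c * x).toReal - (c * z).toReal = (c * y).toReal := by
  have hx : x ≠ ∞ := by rintro rfl; simp at h
  have hy : y ≠ ∞ := by rintro rfl; simp at h
  have hz : z ≠ ∞ := by rintro rfl; simp at h
  have h' : x.toReal + y.toReal + z.toReal = 1 := by
    rw [← ENNReal.toReal_add hx hy, ← ENNReal.toReal_add (ENNReal.add_ne_top.2 ⟨hx, hy⟩) hz, h,
      ENNReal.toReal_one]
  simp only [ENNReal.toReal_mul]
  linear_combination (-c.toReal) * h'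

/-- The constants `α` and `γ`. -/
lemma loopSum_mul_jump (hω : ∀ i, (ω i).support ⊆ {-2, -1, 1, 2}) (hT : Transient ω) {i : ℤ}
    {c : ℝ≥0∞} (h : c ≠ 0 → Reach ω (i - 1)) :
    c.toReal * loopSum ω i * jump ω (i - 1) 1 = (c * hit ω i 0).toReal ∧
    c.toReal * loopSum ω i * jump ω (i - 1) 2 = (c * hit ω i 2).toReal ∧
    c.toReal - (c * hit ω i 0).toReal - (c * hit ω i 2).toReal = (c * hit ω i 1).toReal := by
  -- `c` is the probability of getting to `i - 1`. If it is zero nothing is known about that site,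
  -- but all terms vanish.
  by_cases h0 : c = 0
  · simp [h0]
  · have hr := h h0
    obtain ⟨e0, -, e2, -⟩ := hit_succ hω (i - 1)
    rw [sub_add_cancel] at e0 e2
    rw [loopSum_eq hω (loopProb_lt_one hω hT hr), jump, jump]
    refine ⟨?_, ?_, toReal_mul_middle (sum_hit_A hω hT hr)⟩
    · rw [e0]; simp only [ENNReal.toReal_mul]; ring
    · rw [e2]; simp only [ENNReal.toReal_mul]; ring

lemma reach_sub_one {i : ℤ} (h : Reach ω i) (h0 : ω i (-1) ≠ 0) : Reach ω (i - 1) :=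
  h.step (by rwa [show i - 1 - i = -1 by ring])

lemma reach_sub_two {i : ℤ} (h : Reach ω i) (h0 : ω i (-2) ≠ 0) : Reach ω (i - 2) :=
  h.step (by rwa [show i - 2 - i = -2 by ring])

lemma α_eq (hω : ∀ i, (ω i).support ⊆ {-2, -1, 1, 2}) (hT : Transient ω) {i : ℤ}
    (h : Reach ω i) : α₁ ω i = (ω i (-1) * hit ω i 0).toReal ∧
      α₂ ω i = (ω i (-1) * hit ω i 1).toReal ∧ α₃ ω i = (ω i (-1) * hit ω i 2).toReal := by
  obtain ⟨h1, h2, h3⟩ := loopSum_mul_jump hω hT (i := i) (reach_sub_one h)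
  have e1 : α₁ ω i = (ω i (-1) * hit ω i 0).toReal := h1
  have e3 : α₃ ω i = (ω i (-1) * hit ω i 2).toReal := h2
  refine ⟨e1, ?_, e3⟩
  rw [α₂, e1, e3]
  exact h3

lemma γ_eq (hω : ∀ i, (ω i).support ⊆ {-2, -1, 1, 2}) (hT : Transient ω) {i : ℤ}
    (h : Reach ω (i + 1)) : γ₁ ω i = (ω (i + 1) (-2) * hit ω i 0).toReal ∧
      γ₂ ω i = (ω (i + 1) (-2) * hit ω i 1).toReal ∧
      γ₃ ω i = (ω (i + 1) (-2) * hit ω i 2).toReal := by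
  obtain ⟨h1, h2, h3⟩ := loopSum_mul_jump hω hT (i := i) (fun h0 => by
      have := reach_sub_two h h0
      rwa [show i + 1 - 2 = i - 1 by ring] at this)
  have e1 : γ₁ ω i = (ω (i + 1) (-2) * hit ω i 0).toReal := h1
  have e3 : γ₃ ω i = (ω (i + 1) (-2) * hit ω i 2).toReal := h2
  refine ⟨e1, ?_, e3⟩
  rw [γ₂, e1, e3]
  exact h3

/-- From `i - 2` the walk must first climb to `i - 1` exactly, or else it jumps straight to `i`.
Climbing is an excursion below `i - 1` that has been started at `i - 2`, and afterwards the
situation is that of `α`, with `c` in place of `ω i (-1)`. -/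
lemma β_eq (hω : ∀ i, (ω i).support ⊆ {-2, -1, 1, 2}) (hT : Transient ω) {i : ℤ}
    (h : Reach ω i) : β₁ ω i = (ω i (-2) * hit ω i 3).toReal ∧
      β₂ ω i = (ω i (-2) * hit ω i 4).toReal ∧ β₃ ω i = (ω i (-2) * hit ω i 5).toReal := by
  by_cases h0 : ω i (-2) = 0
  · simp [β₁, β₂, β₃, jump, h0]
  have hr := reach_sub_two h h0
  have hr' : Reach ω (i - 1 - 1) := by rwa [show i - 1 - 1 = i - 2 by ring]
  have hp := exitProb_A hω (i - 1)
  rw [show i - 1 - 1 = i - 2 by ring] at hp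
  set c := ω i (-2) * (hit ω (i - 1) 0 + hit ω (i - 1) 1) with hc
  have hcr : jump ω i (-2) * exitProb ω (i - 2) (i - 2) (i - 1) = c.toReal := by
    rw [hp, jump, hc, ENNReal.toReal_mul]
  obtain ⟨h1, h2, -⟩ := loopSum_mul_jump hω hT (i := i)
    (fun h => reach_of_hit hr' (right_ne_zero_of_mul h))
  obtain ⟨-, -, -, e3, -, e5⟩ := hit_succ hω (i - 1)
  rw [sub_add_cancel] at e3 e5
  have e1 : β₁ ω i = (ω i (-2) * hit ω i 3).toReal := by
    rw [β₁, hcr, h1, e3, mul_assoc]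
  have e3 : β₃ ω i = (ω i (-2) * hit ω i 5).toReal := by
    rw [β₃, hcr, h2, e5, mul_assoc]
  refine ⟨e1, ?_, e3⟩
  rw [β₂, e1, e3]
  exact toReal_mul_middle (sum_hit_B hω hT hr)

/-! ### Types that occur -/

lemma step_ne_zero {a : ℤ} {w : List ℤ} (h : wt ω a w ≠ 0) {n : ℕ} (hn : n < w.length) :
    ω (listPath (a :: w) n) (listPath (a :: w) (n + 1) - listPath (a :: w) n) ≠ 0 := by
  induction w generalizing a n with
  | nil => simp at hn
  | cons b w ih =>
    rw [wt] at h
    cases n with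
    | zero => exact left_ne_zero_of_mul h
    | succ n => exact ih (right_ne_zero_of_mul h) (by simpa using hn)

lemma wt_seg_ne_zero {y : ℕ → ℤ} {c d : ℕ}
    (h : ∀ n < d, ω (y (c + n)) (y (c + n + 1) - y (c + n)) ≠ 0) :
    wt ω (y c) (seg y c d) ≠ 0 := by
  induction d generalizing c with
  | zero => simp [seg, wt]
  | succ d ih =>
    rw [seg, wt]
    refine mul_ne_zero (h 0 (by omega)) (ih fun n hn => ?_)
    have := h (n + 1) (by omega)
    rwa [show c + (n + 1) = c + 1 + n by ring] at this

lemma reach_zero : Reach ω 0 := ⟨[], by simp [wt], rfl⟩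

/-- A type that occurs is started from a site that the walk reaches. -/
lemma occurs (hT : Transient ω) {i : ℤ} {j : Fin 9}
    (h : walkLaw ω 0 {x | U x i j ≠ 0} ≠ 0) :
    hit ω i j ≠ 0 ∧ Reach ω (firstStep i j).2 ∧ (firstStep i j = (1, 0) ∨
      Reach ω (firstStep i j).1 ∧
        ω (firstStep i j).1 ((firstStep i j).2 - (firstStep i j).1) ≠ 0) := by
  classical
  have hA : MeasurableSet {x : ℕ → ℤ | U x i j ≠ 0} :=
    (((measurable_pi_apply j).comp (measurable_U i)) (measurableSet_singleton 0)).compl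
  rw [walkLaw_eq_exitSum hT (Q := fun w => listCount (1 :: 0 :: w) i j ≠ 0)
    hA
    (fun w hw x hx => by rw [Set.mem_ofPred_eq, U_eq_listCount hw hx]), exitSum] at h
  obtain ⟨w, hw⟩ := not_forall.1 (mt ENNReal.tsum_eq_zero.2 h)
  have hex : IsExit 1 w := by
    by_contra hc
    simp [hc] at hw
  rw [if_pos hex] at hw
  have hwt := left_ne_zero_of_mul hw
  have hcount : listCount (1 :: 0 :: w) i j ≠ 0 := by
    intro hc
    simp [hc] at hw
  obtain ⟨⟨k, m⟩, ⟨hkm, hfirst, hbelow, hlast⟩, hm⟩ := Set.nonempty_of_ncard_ne_zero hcount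
  set y := listPath (0 :: w) with hy
  have hY : ∀ n, listPath (1 :: 0 :: w) (n + 1) = y n := fun n => rfl
  simp only [List.length_cons, Nat.add_sub_cancel] at hm
  simp only at hkm
  have hstep : ∀ n < w.length, ω (y n) (y (n + 1) - y n) ≠ 0 := fun n hn => step_ne_zero hwt hn
  have hreach : ∀ n ≤ w.length, Reach ω (y n) := by
    intro n
    induction n with
    | zero => exact fun _ => reach_zero
    | succ n ih => exact fun hn => (ih (by omega)).step (hstep n (by omega))
  have hk : (firstStep i j).2 = y k := by rw [← hfirst]; exact hY k
  refine ⟨?_, hk ▸ hreach k (by omega), ?_⟩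
  -- The piece of the word read during the excursion is itself an exit word of positive weight with
  -- the required last step.
  · obtain ⟨d, rfl⟩ : ∃ d, m = k + d + 1 := ⟨m - k - 1, by omega⟩
    have hexit : IsExit i (seg y k (d + 1)) := by
      refine isExit_seg (fun n hn => ?_) ?_
      · have := hbelow (k + 1 + n + 1) (by omega) (by omega)
        rw [hY] at this
        omega
      · have := le_exitStep i (subtypeOf j)
        rw [← hlast, hY] at this
        rwa [show k + 1 + d = k + d + 1 by ring]
    rw [hit_eq, hk]
    refine ne_bot_of_le_ne_bot ?_ (le_exitSum _ hexit)
    rw [lastStep_seg, if_pos, mul_one]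
    · exact wt_seg_ne_zero fun n hn => hstep _ (by omega)
    · rw [← hlast]; rfl
  -- An excursion that starts at time `0` uses the imaginary step `1 → 0`; any later one starts with
  -- a genuine jump of the walk.
  · cases k with
    | zero => exact Or.inl hfirst.symm
    | succ k =>
      refine Or.inr ?_
      rw [← hfirst]
      exact ⟨hreach k (by omega), hstep k (by omega)⟩

end TwoTwoWalk

namespace TwoTwoWalk
open scoped ENNReal

/-! ### The generating functions of the offspring laws -/

variable {ω : ℤ → PMF ℤ}

/-- The number of words with the given numbers of letters of four kinds. -/
def multichoose (a b c d : ℕ) : ℕ :=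
  (a + b).choose a * (c + d).choose c * (a + b + (c + d)).choose (a + b)

/-- The binomial theorem is applied within each of the two pairs of variables and then to the two
totals; a geometric series remains. -/
lemma tsum_multichoose (x y z w : ℝ≥0∞) :
    ∑' p : (ℕ × ℕ) × (ℕ × ℕ), (multichoose p.1.1 p.1.2 p.2.1 p.2.2 : ℝ≥0∞) *
      (x ^ p.1.1 * y ^ p.1.2 * z ^ p.2.1 * w ^ p.2.2) = (1 - (x + y + (z + w)))⁻¹ := by
  have h1 : ∀ p : ℕ × ℕ, ∑' q : ℕ × ℕ, (multichoose p.1 p.2 q.1 q.2 : ℝ≥0∞) *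
      (x ^ p.1 * y ^ p.2 * z ^ q.1 * w ^ q.2) = ((p.1 + p.2).choose p.1 : ℝ≥0∞) * x ^ p.1 *
        y ^ p.2 * ∑' m, (z + w) ^ m * ((p.1 + p.2 + m).choose (p.1 + p.2) : ℝ≥0∞) := by
    intro p
    rw [← tsum_choose_mul_pow, ← ENNReal.tsum_mul_left]
    refine tsum_congr fun q => ?_
    rw [multichoose]
    push_cast
    ring
  rw [ENNReal.tsum_prod']
  simp_rw [h1]
  rw [tsum_choose_mul_pow x y
    (fun n => ∑' m, (z + w) ^ m * ((n + m).choose n : ℝ≥0∞)), ← ENNReal.tsum_geometric]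
  simp_rw [← ENNReal.tsum_mul_left]
  have h2 := tsum_choose_mul_pow (x + y) (z + w) (fun _ => 1)
  simp only [mul_one] at h2
  rw [← h2, ENNReal.tsum_prod']
  refine tsum_congr fun n => tsum_congr fun m => ?_
  ring

lemma factorial_div_eq_multichoose (a b c d : ℕ) :
    ((a + b + c + d)! : ℝ) / (a ! * b ! * c ! * d !) = multichoose a b c d := by
  have h1 := factorial_div_eq_choose a b
  have h2 := factorial_div_eq_choose c d
  have h3 := factorial_div_eq_choose (a + b) (c + d)
  rw [multichoose]
  push_cast
  rw [← h1, ← h2, ← h3, add_assoc (a + b)]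
  field_simp

/-- The negative multinomial weights as extended nonnegative numbers. -/
noncomputable def negMult (ω : ℤ → PMF ℤ) (i : ℤ) (a b c d : ℕ) : ℝ≥0∞ :=
  multichoose a b c d * ((ω i (-1) * hit ω i 0) ^ a * (ω i (-1) * hit ω i 1) ^ b *
    (ω i (-2) * hit ω i 3) ^ c * (ω i (-2) * hit ω i 4) ^ d) * (1 - loopProb ω i)

lemma mul_hit_ne_top (i l i' : ℤ) (j : Fin 9) : ω i l * hit ω i' j ≠ ∞ :=
  ENNReal.mul_ne_top ((ω i).apply_ne_top _) (hit_ne_top _ _)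

lemma loopProb_eq (i : ℤ) : loopProb ω i = ω i (-1) * hit ω i 0 + ω i (-1) * hit ω i 1 +
    (ω i (-2) * hit ω i 3 + ω i (-2) * hit ω i 4) := by
  rw [loopProb, mul_add, mul_add]

lemma negMult_ne_top (i : ℤ) (a b c d : ℕ) : negMult ω i a b c d ≠ ∞ := by
  unfold negMult
  refine ENNReal.mul_ne_top (ENNReal.mul_ne_top (ENNReal.natCast_ne_top _) ?_)
    (ENNReal.sub_ne_top ENNReal.one_ne_top)
  refine ENNReal.mul_ne_top (ENNReal.mul_ne_top (ENNReal.mul_ne_top ?_ ?_) ?_) ?_ <;>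
  exact ENNReal.pow_ne_top (mul_hit_ne_top _ _ _ _)

lemma negMultinomial_eq (hω : ∀ i, (ω i).support ⊆ {-2, -1, 1, 2}) (hT : Transient ω) {i : ℤ}
    (h : Reach ω i) (a b c d : ℕ) :
    negMultinomial ω i a b c d = (negMult ω i a b c d).toReal := by
  obtain ⟨h1, h2, -⟩ := α_eq hω hT h
  obtain ⟨h3, h4, -⟩ := β_eq hω hT h
  have hl : (1 - loopProb ω i).toReal = 1 - α₁ ω i - α₂ ω i - β₁ ω i - β₂ ω i := by
    rw [ENNReal.toReal_sub_of_le (loopProb_lt_one hω hT h).le ENNReal.one_ne_top, loopProb_eq,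
      ENNReal.toReal_add, ENNReal.toReal_add, ENNReal.toReal_add, ← h1, ← h2, ← h3, ← h4,
      ENNReal.toReal_one]
    · ring
    all_goals simp only [ne_eq, ENNReal.add_eq_top, mul_hit_ne_top, or_self, not_false_eq_true]
  rw [negMultinomial, factorial_div_eq_multichoose, negMult]
  simp only [ENNReal.toReal_mul, ENNReal.toReal_pow, ENNReal.toReal_natCast, hl]
  simp only [← ENNReal.toReal_mul, ← h1, ← h2, ← h3, ← h4]
  ring

/-- The generating function of one return to `i` with weights for the types. -/
noncomputable def weightedLoop (ω : ℤ → PMF ℤ) (i : ℤ) (s : Fin 9 → ℝ≥0∞) : ℝ≥0∞ :=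
  ω i (-1) * (s 0 * hit ω i 0 + s 1 * hit ω i 1) + ω i (-2) * (s 3 * hit ω i 3 + s 4 * hit ω i 4)

lemma tsum_negMult (i : ℤ) (s : Fin 9 → ℝ≥0∞) :
    ∑' p : (ℕ × ℕ) × (ℕ × ℕ), negMult ω i p.1.1 p.1.2 p.2.1 p.2.2 *
      (s 0 ^ p.1.1 * s 1 ^ p.1.2 * s 3 ^ p.2.1 * s 4 ^ p.2.2) =
      (1 - loopProb ω i) * (1 - weightedLoop ω i s)⁻¹ := by
  have h : weightedLoop ω i s = ω i (-1) * hit ω i 0 * s 0 + ω i (-1) * hit ω i 1 * s 1 +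
      (ω i (-2) * hit ω i 3 * s 3 + ω i (-2) * hit ω i 4 * s 4) := by
    rw [weightedLoop]; ring
  rw [h, ← tsum_multichoose, ← ENNReal.tsum_mul_left]
  refine tsum_congr fun p => ?_
  rw [negMult]
  ring

lemma prod_fin_nine {M : Type*} [CommMonoid M] (f : Fin 9 → M) :
    ∏ k, f k = f 0 * f 1 * f 2 * f 3 * f 4 * f 5 * f 6 * f 7 * f 8 := by
  rw [Fin.prod_univ_castSucc, Fin.prod_univ_eight]
  rfl

/-- The condition on `v` constrains only the coordinates 2, 5, 6, 7, 8, so the sum runs freely over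
the other four. -/
lemma tsum_pattern (f : ℕ → ℕ → ℕ → ℕ → ℝ≥0∞) (e₂ e₅ e₆ e₇ e₈ : ℕ) (s : Fin 9 → ℝ≥0∞) :
    ∑' v : Fin 9 → ℕ, (if v = ![v 0, v 1, e₂, v 3, v 4, e₅, e₆, e₇, e₈] then
      f (v 0) (v 1) (v 3) (v 4) else 0) * ∏ k, s k ^ v k =
      (∑' p : (ℕ × ℕ) × (ℕ × ℕ), f p.1.1 p.1.2 p.2.1 p.2.2 *
        (s 0 ^ p.1.1 * s 1 ^ p.1.2 * s 3 ^ p.2.1 * s 4 ^ p.2.2)) *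
        (s 2 ^ e₂ * s 5 ^ e₅ * s 6 ^ e₆ * s 7 ^ e₇ * s 8 ^ e₈) := by
  set g : (ℕ × ℕ) × (ℕ × ℕ) → Fin 9 → ℕ := fun p =>
    ![p.1.1, p.1.2, e₂, p.2.1, p.2.2, e₅, e₆, e₇, e₈] with hg
  have hinj : Function.Injective g := by
    rintro ⟨⟨a, b⟩, c, d⟩ ⟨⟨a', b'⟩, c', d'⟩ h
    have h0 : a = a' := congrFun h 0
    have h1 : b = b' := congrFun h 1
    have h3 : c = c' := congrFun h 3
    have h4 : d = d' := congrFun h 4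
    rw [h0, h1, h3, h4]
  rw [← hinj.tsum_eq, ← ENNReal.tsum_mul_right]
  · refine tsum_congr fun p => ?_
    rw [if_pos (by simp [hg]), prod_fin_nine]
    simp only [hg, Matrix.cons_val]
    ring
  · intro v hv
    by_cases h : v = ![v 0, v 1, e₂, v 3, v 4, e₅, e₆, e₇, e₈]
    · exact ⟨((v 0, v 1), (v 3, v 4)), h.symm⟩
    · simp [h] at hv

lemma tsum_negMult_pattern (i : ℤ) (c : ℝ≥0∞) (e₂ e₅ e₆ e₇ e₈ : ℕ) (s : Fin 9 → ℝ≥0∞) :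
    ∑' v : Fin 9 → ℕ, (if v = ![v 0, v 1, e₂, v 3, v 4, e₅, e₆, e₇, e₈] then
      negMult ω i (v 0) (v 1) (v 3) (v 4) * c else 0) * ∏ k, s k ^ v k =
      (1 - loopProb ω i) * (1 - weightedLoop ω i s)⁻¹ * c *
        (s 2 ^ e₂ * s 5 ^ e₅ * s 6 ^ e₆ * s 7 ^ e₇ * s 8 ^ e₈) := by
  rw [tsum_pattern (fun a b d e => negMult ω i a b d e * c), ← tsum_negMult,
    ← ENNReal.tsum_mul_right (a := c)]
  congr 1
  refine tsum_congr fun p => ?_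
  ring

/-- For mutually exclusive patterns a chain of alternatives is a sum, which makes the generating
function additive. -/
lemma ofReal_ite_add {A : Prop} [Decidable A] {x y : ℝ} (h : A → y = 0) :
    ENNReal.ofReal (if A then x else y) =
      ENNReal.ofReal (if A then x else 0) + ENNReal.ofReal y := by
  by_cases hA : A
  · simp [hA, h hA]
  · simp [hA]

lemma tsum_add_mul {ι : Type*} (f g h : ι → ℝ≥0∞) :
    ∑' v, (f v + g v) * h v = ∑' v, f v * h v + ∑' v, g v * h v := by
  simp_rw [add_mul, ENNReal.tsum_add]

lemma pattern_coords {v : Fin 9 → ℕ} {a b e₂ c d e₅ e₆ e₇ e₈ : ℕ}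
    (h : v = ![a, b, e₂, c, d, e₅, e₆, e₇, e₈]) :
    v 2 = e₂ ∧ v 5 = e₅ ∧ v 6 = e₆ ∧ v 7 = e₇ ∧ v 8 = e₈ :=
  ⟨congrFun h 2, congrFun h 5, congrFun h 6, congrFun h 7, congrFun h 8⟩

lemma pattern_ne {v : Fin 9 → ℕ} {a b e₂ c d e₅ e₆ e₇ e₈ a' b' e₂' c' d' e₅' e₆' e₇' e₈' : ℕ}
    (h : v = ![a, b, e₂, c, d, e₅, e₆, e₇, e₈])
    (hne : (e₂, e₅, e₆, e₇, e₈) ≠ (e₂', e₅', e₆', e₇', e₈')) :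
    ¬ v = ![a', b', e₂', c', d', e₅', e₆', e₇', e₈'] := by
  intro h'
  obtain ⟨h1, h2, h3, h4, h5⟩ := pattern_coords h
  obtain ⟨h1', h2', h3', h4', h5'⟩ := pattern_coords h'
  exact hne (by rw [← h1, ← h2, ← h3, ← h4, ← h5, h1', h2', h3', h4', h5'])

/-- The convention `0 / 0 = 0` is consistent here: if `x + y = 0`, then `x = 0`. -/
lemma ofReal_div_add_mul {x y : ℝ≥0∞} (hx : x ≠ ∞) (hy : y ≠ ∞) :
    ENNReal.ofReal (x.toReal / (x.toReal + y.toReal)) * (x + y) = x := by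
  by_cases h : x + y = 0
  · rw [h, mul_zero]
    exact (add_eq_zero.1 h).1.symm
  · have hxy := ENNReal.add_ne_top.2 ⟨hx, hy⟩
    have h0 : (x + y).toReal ≠ 0 := (ENNReal.toReal_pos h hxy).ne'
    rw [← ENNReal.toReal_add hx hy]
    conv_lhs => rw [← ENNReal.ofReal_toReal hxy]
    rw [ENNReal.toReal_ofReal ENNReal.toReal_nonneg, ← ENNReal.ofReal_mul (by positivity),
      div_mul_cancel₀ _ h0, ENNReal.ofReal_toReal hx]

lemma ofReal_div_add_mul' {x y : ℝ≥0∞} (hx : x ≠ ∞) (hy : y ≠ ∞) :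
    ENNReal.ofReal (y.toReal / (x.toReal + y.toReal)) * (x + y) = y := by
  rw [add_comm x.toReal, add_comm x]
  exact ofReal_div_add_mul hy hx

lemma negMultinomial_nonneg (hω : ∀ i, (ω i).support ⊆ {-2, -1, 1, 2}) (hT : Transient ω) {i : ℤ}
    (h : Reach ω i) (a b c d : ℕ) : 0 ≤ negMultinomial ω i a b c d := by
  rw [negMultinomial_eq hω hT h]
  exact ENNReal.toReal_nonneg

lemma tsum_ofReal_pattern (hω : ∀ i, (ω i).support ⊆ {-2, -1, 1, 2}) (hT : Transient ω) {i : ℤ}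
    (h : Reach ω i) (c : ℝ) (e₂ e₅ e₆ e₇ e₈ : ℕ) (s : Fin 9 → ℝ≥0∞) :
    ∑' v : Fin 9 → ℕ, ENNReal.ofReal (if v = ![v 0, v 1, e₂, v 3, v 4, e₅, e₆, e₇, e₈] then
      negMultinomial ω i (v 0) (v 1) (v 3) (v 4) * c else 0) * ∏ k, s k ^ v k =
      (1 - loopProb ω i) * (1 - weightedLoop ω i s)⁻¹ * ENNReal.ofReal c *
        (s 2 ^ e₂ * s 5 ^ e₅ * s 6 ^ e₆ * s 7 ^ e₇ * s 8 ^ e₈) := by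
  rw [← tsum_negMult_pattern]
  refine tsum_congr fun v => ?_
  congr 1
  split_ifs
  · rw [negMultinomial_eq hω hT h, ENNReal.ofReal_mul ENNReal.toReal_nonneg,
      ENNReal.ofReal_toReal (negMult_ne_top _ _ _ _ _)]
  · simp

/-- The weights `offspringProb ω i j` are the offspring law of the type `j`. -/
def IsOffspringLaw (ω : ℤ → PMF ℤ) (i : ℤ) (j : Fin 9) : Prop :=
  (∀ v, 0 ≤ offspringProb ω i j v) ∧ ∀ s : Fin 9 → ℝ≥0∞,
    hit ω (i + 1) j * ∑' v, ENNReal.ofReal (offspringProb ω i j v) * ∏ k, s k ^ v k =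
      typeGen ω i (fun _ => s) 1 j

lemma inv_loopProb_mul (hω : ∀ i, (ω i).support ⊆ {-2, -1, 1, 2}) (hT : Transient ω) {i : ℤ}
    (h : Reach ω i) : (1 - loopProb ω i)⁻¹ * (1 - loopProb ω i) = 1 :=
  ENNReal.inv_mul_cancel (tsub_pos_of_lt (loopProb_lt_one hω hT h)).ne'
    (ENNReal.sub_ne_top ENNReal.one_ne_top)

/-- For the subtypes 1 and 3 of A and C the excursion leaves by a jump up from `i`, whose
probability `c` cancels in the quotient. Only the returns to `i` remain, and they give the negative
multinomial law. -/
lemma isOffspringLaw_of_eq (hω : ∀ i, (ω i).support ⊆ {-2, -1, 1, 2}) (hT : Transient ω) {i : ℤ}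
    (h : Reach ω i) {j : Fin 9} {c : ℝ≥0∞}
    (hj : ∀ v : Fin 9 → ℕ, offspringProb ω i j v = if v = ![v 0, v 1, 0, v 3, v 4, 0, 0, 0, 0] then
      negMultinomial ω i (v 0) (v 1) (v 3) (v 4) else 0)
    (hc : hit ω (i + 1) j = (1 - loopProb ω i)⁻¹ * c)
    (hg : ∀ s : Fin 9 → ℝ≥0∞, typeGen ω i (fun _ => s) 1 j = (1 - weightedLoop ω i s)⁻¹ * c) :
    IsOffspringLaw ω i j := by
  refine ⟨fun v => ?_, fun s => ?_⟩
  · rw [hj]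
    split_ifs
    · exact negMultinomial_nonneg hω hT h _ _ _ _
    · exact le_rfl
  · have key := tsum_ofReal_pattern hω hT h 1 0 0 0 0 0 s
    simp only [mul_one, pow_zero, ENNReal.ofReal_one] at key
    simp only [hj]
    rw [key, hc, hg]
    calc _ = ((1 - loopProb ω i)⁻¹ * (1 - loopProb ω i)) * ((1 - weightedLoop ω i s)⁻¹ * c) := by
          ring
      _ = _ := by rw [inv_loopProb_mul hω hT h, one_mul]

/-- Besides the returns to `i` there is one last excursion of subtype 3 below `i`, of type A or B in
the ratio of `α₃` to `β₃`. -/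
lemma isOffspringLaw_A₂ (hω : ∀ i, (ω i).support ⊆ {-2, -1, 1, 2}) (hT : Transient ω) {i : ℤ}
    (h : Reach ω i) {j : Fin 9}
    (hj : ∀ v : Fin 9 → ℕ, offspringProb ω i j v =
      if v = ![v 0, v 1, 1, v 3, v 4, 0, 0, 0, 0] then
        negMultinomial ω i (v 0) (v 1) (v 3) (v 4) * (α₃ ω i / (α₃ ω i + β₃ ω i))
      else if v = ![v 0, v 1, 0, v 3, v 4, 1, 0, 0, 0] then
        negMultinomial ω i (v 0) (v 1) (v 3) (v 4) * (β₃ ω i / (α₃ ω i + β₃ ω i)) else 0)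
    (hc : hit ω (i + 1) j = hit ω (i + 1) 1)
    (hg : ∀ s : Fin 9 → ℝ≥0∞, typeGen ω i (fun _ => s) 1 j = typeGen ω i (fun _ => s) 1 1) :
    IsOffspringLaw ω i j := by
  obtain ⟨-, -, hα⟩ := α_eq hω hT h
  obtain ⟨-, -, hβ⟩ := β_eq hω hT h
  refine ⟨fun v => ?_, fun s => ?_⟩
  · have hN := negMultinomial_nonneg hω hT h (v 0) (v 1) (v 3) (v 4)
    rw [hj, hα, hβ]
    split_ifs <;> positivity
  · simp only [hj]
    rw [tsum_congr (fun v => by rw [ofReal_ite_add (fun hv => if_neg (pattern_ne hv (by simp)))]),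
      tsum_add_mul, tsum_ofReal_pattern hω hT h, tsum_ofReal_pattern hω hT h, hα, hβ]
    have e1 := ofReal_div_add_mul (mul_hit_ne_top (ω := ω) i (-1) i 2)
      (mul_hit_ne_top (ω := ω) i (-2) i 5)
    have e2 := ofReal_div_add_mul' (mul_hit_ne_top (ω := ω) i (-1) i 2)
      (mul_hit_ne_top (ω := ω) i (-2) i 5)
    set f₁ := ENNReal.ofReal ((ω i (-1) * hit ω i 2).toReal /
      ((ω i (-1) * hit ω i 2).toReal + (ω i (-2) * hit ω i 5).toReal))
    set f₂ := ENNReal.ofReal ((ω i (-2) * hit ω i 5).toReal /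
      ((ω i (-1) * hit ω i 2).toReal + (ω i (-2) * hit ω i 5).toReal))
    rw [hc, hg, (hit_succ hω i).2.1, (typeGen_formula hω i s).2.1]
    calc _ = ((1 - loopProb ω i)⁻¹ * (1 - loopProb ω i)) * ((1 - weightedLoop ω i s)⁻¹ *
          ((f₁ * (ω i (-1) * hit ω i 2 + ω i (-2) * hit ω i 5)) * s 2 +
            (f₂ * (ω i (-1) * hit ω i 2 + ω i (-2) * hit ω i 5)) * s 5)) := by ring
      _ = _ := by
        rw [inv_loopProb_mul hω hT h, e1, e2, weightedLoop]
        ring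

lemma toReal_mul_div_add {c x y : ℝ≥0∞} (hc : c ≠ 0) (hc' : c ≠ ∞) :
    (c * x).toReal / ((c * x).toReal + (c * y).toReal) = x.toReal / (x.toReal + y.toReal) := by
  have : c.toReal ≠ 0 := (ENNReal.toReal_pos hc hc').ne'
  simp only [ENNReal.toReal_mul, ← mul_add]
  exact mul_div_mul_left _ _ this

/-- An initial excursion of type C leads to `i` and has subtype 1 or 2, independently of what
follows. The common factor `ω (i + 1) (-2)` of `γ₁` and `γ₂` cancels, which is why it must not
vanish. -/
lemma isOffspringLaw_B₁ (hω : ∀ i, (ω i).support ⊆ {-2, -1, 1, 2}) (hT : Transient ω) {i : ℤ}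
    (h : Reach ω i) (h' : Reach ω (i + 1)) (hne : ω (i + 1) (-2) ≠ 0) {j : Fin 9} {c : ℝ≥0∞}
    (hj : ∀ v : Fin 9 → ℕ, offspringProb ω i j v =
      if v = ![v 0, v 1, 0, v 3, v 4, 0, 1, 0, 0] then
        negMultinomial ω i (v 0) (v 1) (v 3) (v 4) * (γ₁ ω i / (γ₁ ω i + γ₂ ω i))
      else if v = ![v 0, v 1, 0, v 3, v 4, 0, 0, 1, 0] then
        negMultinomial ω i (v 0) (v 1) (v 3) (v 4) * (γ₂ ω i / (γ₁ ω i + γ₂ ω i)) else 0)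
    (hc : hit ω (i + 1) j = (hit ω i 0 + hit ω i 1) * ((1 - loopProb ω i)⁻¹ * c))
    (hg : ∀ s : Fin 9 → ℝ≥0∞, typeGen ω i (fun _ => s) 1 j =
      (s 6 * hit ω i 0 + s 7 * hit ω i 1) * ((1 - weightedLoop ω i s)⁻¹ * c)) :
    IsOffspringLaw ω i j := by
  obtain ⟨hγ₁, hγ₂, -⟩ := γ_eq hω hT h'
  have f1 : γ₁ ω i / (γ₁ ω i + γ₂ ω i) =
      (hit ω i 0).toReal / ((hit ω i 0).toReal + (hit ω i 1).toReal) := by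
    rw [hγ₁, hγ₂, toReal_mul_div_add hne ((ω _).apply_ne_top _)]
  have f2 : γ₂ ω i / (γ₁ ω i + γ₂ ω i) =
      (hit ω i 1).toReal / ((hit ω i 0).toReal + (hit ω i 1).toReal) := by
    rw [hγ₁, hγ₂, add_comm (ω (i + 1) (-2) * hit ω i 0).toReal,
      toReal_mul_div_add hne ((ω _).apply_ne_top _), add_comm (hit ω i 1).toReal]
  refine ⟨fun v => ?_, fun s => ?_⟩
  · have hN := negMultinomial_nonneg hω hT h (v 0) (v 1) (v 3) (v 4)
    rw [hj, f1, f2]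
    split_ifs <;> positivity
  · simp only [hj]
    rw [tsum_congr (fun v => by rw [ofReal_ite_add (fun hv => if_neg (pattern_ne hv (by simp)))]),
      tsum_add_mul, tsum_ofReal_pattern hω hT h, tsum_ofReal_pattern hω hT h, f1, f2]
    have e1 := ofReal_div_add_mul (hit_ne_top (ω := ω) i 0) (hit_ne_top (ω := ω) i 1)
    have e2 := ofReal_div_add_mul' (hit_ne_top (ω := ω) i 0) (hit_ne_top (ω := ω) i 1)
    set f₁ := ENNReal.ofReal ((hit ω i 0).toReal / ((hit ω i 0).toReal + (hit ω i 1).toReal))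
    set f₂ := ENNReal.ofReal ((hit ω i 1).toReal / ((hit ω i 0).toReal + (hit ω i 1).toReal))
    rw [hc, hg]
    calc _ = ((1 - loopProb ω i)⁻¹ * (1 - loopProb ω i)) * ((1 - weightedLoop ω i s)⁻¹ * c *
          ((f₁ * (hit ω i 0 + hit ω i 1)) * s 6 + (f₂ * (hit ω i 0 + hit ω i 1)) * s 7)) := by
          ring
      _ = _ := by
        rw [inv_loopProb_mul hω hT h, e1, e2]
        ring

lemma tsum_ofReal_single (c : ℝ) (s : Fin 9 → ℝ≥0∞) :
    ∑' v : Fin 9 → ℕ, ENNReal.ofReal (if v = ![0, 0, 0, 0, 0, 0, 0, 0, 1] then c else 0) *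
      ∏ k, s k ^ v k = ENNReal.ofReal c * s 8 := by
  rw [tsum_eq_single ![0, 0, 0, 0, 0, 0, 0, 0, 1]]
  · rw [if_pos rfl, prod_fin_nine]
    simp
  · intro v hv
    simp [hv]

lemma typeGen_one_four (hω : ∀ i, (ω i).support ⊆ {-2, -1, 1, 2}) (i : ℤ) (s : Fin 9 → ℝ≥0∞) :
    typeGen ω i (fun _ => s) 1 4 = (s 6 * hit ω i 0 + s 7 * hit ω i 1) *
      ((1 - weightedLoop ω i s)⁻¹ *
        (ω i (-1) * (s 2 * hit ω i 2) + ω i (-2) * (s 5 * hit ω i 5))) + s 8 * hit ω i 2 := by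
  obtain ⟨-, h1, -, -, h4, -⟩ := typeGen_formula hω i s
  rw [h4, h1]
  rfl

/-- The numerator `w * H - w * h₂` is `w` times the probability of not jumping over `i`, which
equals `(h₀ + h₁) * (g * (a + b))`. Here `y` stands for `a` or `b`; when `a + b = 0` both sides are
zero. -/
lemma mul_div_mul_cancel_of_eq {w h₀ h₁ h₂ g a b x y H : ℝ} (hw : w ≠ 0) (hH : H ≠ 0)
    (h : h₀ + h₁ ≠ 0) (hy : a + b = 0 → y = 0) (he : H = (h₀ + h₁) * (g * (a + b)) + h₂) :
    (w * H - w * h₂) * (w * x) * y / (w * H * (w * h₀ + w * h₁) * (a + b)) * H = x * g * y := by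
  by_cases h0 : a + b = 0
  · simp [hy h0]
  · rw [← mul_add w, show w * H - w * h₂ = w * ((h₀ + h₁) * (g * (a + b))) by rw [he]; ring]
    field_simp

lemma ofReal_mul_of_mul_toReal {c : ℝ} {H z : ℝ≥0∞} (hH : H ≠ 0) (hH' : H ≠ ∞) (hz : z ≠ ∞)
    (h : c * H.toReal = z.toReal) : 0 ≤ c ∧ H * ENNReal.ofReal c = z := by
  have h0 : 0 < H.toReal := ENNReal.toReal_pos hH hH'
  have hc : 0 ≤ c := nonneg_of_mul_nonneg_left (h ▸ ENNReal.toReal_nonneg) h0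
  refine ⟨hc, ?_⟩
  conv_lhs => rw [← ENNReal.ofReal_toReal hH', mul_comm]
  rw [← ENNReal.ofReal_mul hc, h, ENNReal.ofReal_toReal hz]

lemma ofReal_five_patterns (v : Fin 9 → ℕ) (c₈ c₁ c₂ c₃ c₄ : ℝ) :
    ENNReal.ofReal (if v = ![0, 0, 0, 0, 0, 0, 0, 0, 1] then c₈
      else if v = ![v 0, v 1, 1, v 3, v 4, 0, 1, 0, 0] then c₁
      else if v = ![v 0, v 1, 1, v 3, v 4, 0, 0, 1, 0] then c₂
      else if v = ![v 0, v 1, 0, v 3, v 4, 1, 1, 0, 0] then c₃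
      else if v = ![v 0, v 1, 0, v 3, v 4, 1, 0, 1, 0] then c₄ else 0) =
    ENNReal.ofReal (if v = ![0, 0, 0, 0, 0, 0, 0, 0, 1] then c₈ else 0) +
    (ENNReal.ofReal (if v = ![v 0, v 1, 1, v 3, v 4, 0, 1, 0, 0] then c₁ else 0) +
    (ENNReal.ofReal (if v = ![v 0, v 1, 1, v 3, v 4, 0, 0, 1, 0] then c₂ else 0) +
    (ENNReal.ofReal (if v = ![v 0, v 1, 0, v 3, v 4, 1, 1, 0, 0] then c₃ else 0) +
    ENNReal.ofReal (if v = ![v 0, v 1, 0, v 3, v 4, 1, 0, 1, 0] then c₄ else 0)))) := by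
  refine (ofReal_ite_add fun hv => ?_).trans (congrArg _ ((ofReal_ite_add fun hv => ?_).trans
    (congrArg _ ((ofReal_ite_add fun hv => ?_).trans (congrArg _
      (ofReal_ite_add fun hv => ?_))))))
  · rw [if_neg (pattern_ne hv (by simp)), if_neg (pattern_ne hv (by simp)),
      if_neg (pattern_ne hv (by simp)), if_neg (pattern_ne hv (by simp))]
  · rw [if_neg (pattern_ne hv (by simp)), if_neg (pattern_ne hv (by simp)),
      if_neg (pattern_ne hv (by simp))]
  · rw [if_neg (pattern_ne hv (by simp)), if_neg (pattern_ne hv (by simp))]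
  · exact if_neg (pattern_ne hv (by simp))

/-- Either the walk jumps over `i` at once, leaving a single offspring of type C of subtype 3, or it
lands at `i` and continues as an excursion of type A of subtype 2. -/
lemma isOffspringLaw_B₂ (hω : ∀ i, (ω i).support ⊆ {-2, -1, 1, 2}) (hT : Transient ω) {i : ℤ}
    (h : Reach ω (i + 1)) (hne : ω (i + 1) (-2) ≠ 0) (hH : hit ω (i + 1) 4 ≠ 0) :
    IsOffspringLaw ω i 4 := by
  have hHt := hit_ne_top (ω := ω) (i + 1) 4
  have hwt : ω (i + 1) (-2) ≠ ∞ := (ω _).apply_ne_top _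
  have hw : (ω (i + 1) (-2)).toReal ≠ 0 := (ENNReal.toReal_pos hne hwt).ne'
  have hH0 : (hit ω (i + 1) 4).toReal ≠ 0 := (ENNReal.toReal_pos hH hHt).ne'
  obtain ⟨hγ₁, hγ₂, hγ₃⟩ := γ_eq hω hT h
  obtain ⟨-, hβ₂, -⟩ := β_eq hω hT h
  obtain ⟨-, e1, -, -, e4, -⟩ := hit_succ hω i
  simp only [ENNReal.toReal_mul] at hγ₁ hγ₂ hγ₃ hβ₂
  have k₈ : 0 ≤ γ₃ ω i / β₂ ω (i + 1) ∧
      hit ω (i + 1) 4 * ENNReal.ofReal (γ₃ ω i / β₂ ω (i + 1)) = hit ω i 2 := by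
    refine ofReal_mul_of_mul_toReal hH hHt (hit_ne_top _ _) ?_
    rw [hγ₃, hβ₂]
    field_simp
  by_cases h0 : hit ω i 0 + hit ω i 1 = 0
  -- If the walk cannot land at `i` from `i - 1`, reachability of `i` is not available to identify
  -- `α` and `β`. It is not needed: `γ₁ = γ₂ = 0` kills the four families.
  · obtain ⟨h00, h01⟩ := add_eq_zero.1 h0
    have hv : ∀ v, offspringProb ω i 4 v =
        if v = ![0, 0, 0, 0, 0, 0, 0, 0, 1] then γ₃ ω i / β₂ ω (i + 1) else 0 := by
      intro v
      rw [h00, ENNReal.toReal_zero, mul_zero] at hγ₁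
      rw [h01, ENNReal.toReal_zero, mul_zero] at hγ₂
      simp [offspringProb, hγ₁, hγ₂]
    refine ⟨fun v => ?_, fun s => ?_⟩
    · rw [hv]
      split_ifs
      exacts [k₈.1, le_rfl]
    · simp only [hv]
      rw [tsum_ofReal_single, ← mul_assoc, k₈.2, typeGen_one_four hω, h00, h01]
      ring
  have hr : Reach ω i := by
    refine reach_of_hit ?_ h0
    have := reach_sub_two h hne
    rwa [show i + 1 - 2 = i - 1 by ring] at this
  obtain ⟨-, -, hα⟩ := α_eq hω hT hr
  obtain ⟨-, -, hβ⟩ := β_eq hω hT hr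
  set g := (1 - loopProb ω i)⁻¹ with hg
  have hgt : g ≠ ∞ := ENNReal.inv_ne_top.2 (tsub_pos_of_lt (loopProb_lt_one hω hT hr)).ne'
  have hat := mul_hit_ne_top (ω := ω) i (-1) i 2
  have hbt := mul_hit_ne_top (ω := ω) i (-2) i 5
  set a := ω i (-1) * hit ω i 2
  set b := ω i (-2) * hit ω i 5
  have h01 : (hit ω i 0).toReal + (hit ω i 1).toReal ≠ 0 := by
    rw [← ENNReal.toReal_add (hit_ne_top _ _) (hit_ne_top _ _)]
    exact (ENNReal.toReal_pos h0 (ENNReal.add_ne_top.2 ⟨hit_ne_top _ _, hit_ne_top _ _⟩)).ne'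
  have hHe : (hit ω (i + 1) 4).toReal = ((hit ω i 0).toReal + (hit ω i 1).toReal) *
      (g.toReal * (a.toReal + b.toReal)) + (hit ω i 2).toReal := by
    rw [e4, e1, ENNReal.toReal_add _ (hit_ne_top _ _), ENNReal.toReal_mul,
      ENNReal.toReal_add (hit_ne_top _ _) (hit_ne_top _ _), ENNReal.toReal_mul,
      ENNReal.toReal_add hat hbt]
    exact ENNReal.mul_ne_top (ENNReal.add_ne_top.2 ⟨hit_ne_top _ _, hit_ne_top _ _⟩)
      (ENNReal.mul_ne_top hgt (ENNReal.add_ne_top.2 ⟨hat, hbt⟩))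
  have key : ∀ r : Fin 9, ∀ y : ℝ≥0∞, y ≠ ∞ → (a.toReal + b.toReal = 0 → y.toReal = 0) →
      0 ≤ (β₂ ω (i + 1) - γ₃ ω i) * ((ω (i + 1) (-2)).toReal * (hit ω i r).toReal) * y.toReal /
        (β₂ ω (i + 1) * (γ₁ ω i + γ₂ ω i) * (α₃ ω i + β₃ ω i)) ∧
      hit ω (i + 1) 4 * ENNReal.ofReal ((β₂ ω (i + 1) - γ₃ ω i) *
        ((ω (i + 1) (-2)).toReal * (hit ω i r).toReal) * y.toReal /
          (β₂ ω (i + 1) * (γ₁ ω i + γ₂ ω i) * (α₃ ω i + β₃ ω i))) = hit ω i r * g * y := by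
    intro r y hyt hy
    refine ofReal_mul_of_mul_toReal hH hHt
      (ENNReal.mul_ne_top (ENNReal.mul_ne_top (hit_ne_top _ _) hgt) hyt) ?_
    rw [hβ₂, hγ₁, hγ₂, hγ₃, hα, hβ, ENNReal.toReal_mul (a := hit ω i r * g),
      ENNReal.toReal_mul (a := hit ω i r)]
    exact mul_div_mul_cancel_of_eq hw hH0 h01 hy hHe
  have ha0 : a.toReal + b.toReal = 0 → a.toReal = 0 := fun hs =>
    ((add_eq_zero_iff_of_nonneg ENNReal.toReal_nonneg ENNReal.toReal_nonneg).1 hs).1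
  have hb0 : a.toReal + b.toReal = 0 → b.toReal = 0 := fun hs =>
    ((add_eq_zero_iff_of_nonneg ENNReal.toReal_nonneg ENNReal.toReal_nonneg).1 hs).2
  have k0a := key 0 a hat ha0
  have k1a := key 1 a hat ha0
  have k0b := key 0 b hbt hb0
  have k1b := key 1 b hbt hb0
  rw [← hγ₁, ← hα] at k0a
  rw [← hγ₂, ← hα] at k1a
  rw [← hγ₁, ← hβ] at k0b
  rw [← hγ₂, ← hβ] at k1b
  refine ⟨fun v => ?_, fun s => ?_⟩
  · have hN := negMultinomial_nonneg hω hT hr (v 0) (v 1) (v 3) (v 4)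
    simp only [offspringProb]
    split_ifs
    exacts [k₈.1, mul_nonneg hN k0a.1, mul_nonneg hN k1a.1, mul_nonneg hN k0b.1,
      mul_nonneg hN k1b.1, le_rfl]
  · simp only [offspringProb]
    rw [tsum_congr (fun v => by rw [ofReal_five_patterns]), tsum_add_mul, tsum_add_mul,
      tsum_add_mul,
      tsum_add_mul, tsum_ofReal_single, tsum_ofReal_pattern hω hT hr,
      tsum_ofReal_pattern hω hT hr, tsum_ofReal_pattern hω hT hr, tsum_ofReal_pattern hω hT hr,
      typeGen_one_four hω]
    replace k0a := k0a.2
    replace k1a := k1a.2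
    replace k0b := k0b.2
    replace k1b := k1b.2
    replace k₈ := k₈.2
    generalize ENNReal.ofReal (γ₃ ω i / β₂ ω (i + 1)) = c₈ at *
    generalize ENNReal.ofReal ((β₂ ω (i + 1) - γ₃ ω i) * γ₁ ω i * α₃ ω i / _) = c₁ at *
    generalize ENNReal.ofReal ((β₂ ω (i + 1) - γ₃ ω i) * γ₂ ω i * α₃ ω i / _) = c₂ at *
    generalize ENNReal.ofReal ((β₂ ω (i + 1) - γ₃ ω i) * γ₁ ω i * β₃ ω i / _) = c₃ at *
    generalize ENNReal.ofReal ((β₂ ω (i + 1) - γ₃ ω i) * γ₂ ω i * β₃ ω i / _) = c₄ at *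
    have hl : g * (1 - loopProb ω i) = 1 := inv_loopProb_mul hω hT hr
    generalize (1 - weightedLoop ω i s)⁻¹ = W
    generalize hit ω (i + 1) 4 = H at *
    calc _ = (H * c₈) * s 8 + (1 - loopProb ω i) * W * ((H * c₁) * (s 2 * s 6) +
          (H * c₂) * (s 2 * s 7) + (H * c₃) * (s 5 * s 6) + (H * c₄) * (s 5 * s 7)) := by ring
      _ = hit ω i 2 * s 8 + (g * (1 - loopProb ω i)) * (W * ((hit ω i 0 * a) * (s 2 * s 6) +
          (hit ω i 1 * a) * (s 2 * s 7) + (hit ω i 0 * b) * (s 5 * s 6) +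
          (hit ω i 1 * b) * (s 5 * s 7))) := by
        rw [k₈, k0a, k1a, k0b, k1b]
        ring
      _ = _ := by
        rw [hl]
        simp only [a, b]
        ring

/-- Each case needs `i` to be reached. For A and C it is the target of the first step; for B of
subtypes 1 and 3 it follows since the type has positive probability. For B of subtype 2 the walk may
pass over `i`. -/
lemma isOffspringLaw_of_occurs (hω : ∀ i, (ω i).support ⊆ {-2, -1, 1, 2}) (hT : Transient ω)
    {i : ℤ} {j : Fin 9} (h : walkLaw ω 0 {x | U x (i + 1) j ≠ 0} ≠ 0) : IsOffspringLaw ω i j := by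
  obtain ⟨hj, h2, h1⟩ := occurs hT h
  have hA : (firstStep (i + 1) j).2 = i + 1 - 1 → Reach ω i := fun he => by
    rwa [he, add_sub_cancel_right] at h2
  have hB : firstStep (i + 1) j = (i + 1, i + 1 - 2) →
      Reach ω (i + 1) ∧ ω (i + 1) (-2) ≠ 0 ∧ Reach ω (i - 1) := fun he => by
    rw [he] at h1 h2
    rcases h1 with h1 | ⟨h1, h3⟩
    -- The imaginary step has length one, so it is never the first step of type B.
    · rw [Prod.mk.injEq] at h1
      omega
    · refine ⟨h1, ?_, ?_⟩
      · rwa [show i + 1 - 2 - (i + 1) = -2 by ring] at h3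
      · rwa [show i + 1 - 2 = i - 1 by ring] at h2
  obtain ⟨e0, e1, e2, e3, e4, e5⟩ := hit_succ hω i
  have hB₁ : ∀ c : ℝ≥0∞, hit ω (i + 1) j = (hit ω i 0 + hit ω i 1) * c → Reach ω (i - 1) →
      Reach ω i := fun c hc hr => reach_of_hit hr (left_ne_zero_of_mul (hc ▸ hj))
  fin_cases j
  · exact isOffspringLaw_of_eq hω hT (hA rfl) (fun _ => rfl) e0
      fun s => (typeGen_formula hω i s).1
  · exact isOffspringLaw_A₂ hω hT (hA rfl) (fun _ => rfl) rfl fun _ => rfl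
  · exact isOffspringLaw_of_eq hω hT (hA rfl) (fun _ => rfl) e2
      fun s => (typeGen_formula hω i s).2.2.1
  · obtain ⟨r1, r2, r3⟩ := hB rfl
    exact isOffspringLaw_B₁ hω hT (hB₁ _ e3 r3) r1 r2 (fun _ => rfl) (e3.trans (by rw [e0]))
      fun s => by
        obtain ⟨t0, -, -, t3, -⟩ := typeGen_formula hω i s
        exact t3.trans (by rw [t0]; rfl)
  · obtain ⟨r1, r2, r3⟩ := hB rfl
    exact isOffspringLaw_B₂ hω hT r1 r2 hj
  · obtain ⟨r1, r2, r3⟩ := hB rfl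
    exact isOffspringLaw_B₁ hω hT (hB₁ _ e5 r3) r1 r2 (fun _ => rfl) (e5.trans (by rw [e2]))
      fun s => by
        obtain ⟨-, -, t2, -, -, t5, -⟩ := typeGen_formula hω i s
        exact t5.trans (by rw [t2]; rfl)
  · exact isOffspringLaw_of_eq hω hT (hA rfl) (fun _ => rfl) e0
      fun s => (typeGen_formula hω i s).1
  · exact isOffspringLaw_A₂ hω hT (hA rfl) (fun _ => rfl) rfl fun _ => rfl
  · exact isOffspringLaw_of_eq hω hT (hA rfl) (fun _ => rfl) e2
      fun s => (typeGen_formula hω i s).2.2.1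

/-! ### The offspring and immigration laws -/

open Classical in
/-- The offspring law of the type `j`; for a type that does not occur the weights
`offspringProb ω i j` need not sum to one, and the law plays no role. -/
noncomputable def offspringLaw (ω : ℤ → PMF ℤ) (i : ℤ) (j : Fin 9) : PMF (Fin 9 → ℕ) :=
  if h : ∑' v, ENNReal.ofReal (offspringProb ω i j v) = 1 then
    ⟨fun v => ENNReal.ofReal (offspringProb ω i j v), h ▸ ENNReal.summable.hasSum⟩
  else PMF.pure 0

lemma offspringLaw_apply (hω : ∀ i, (ω i).support ⊆ {-2, -1, 1, 2}) (hT : Transient ω)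
    {i : ℤ} {j : Fin 9} (h : walkLaw ω 0 {x | U x (i + 1) j ≠ 0} ≠ 0) (v : Fin 9 → ℕ) :
    offspringLaw ω i j v = ENNReal.ofReal (offspringProb ω i j v) := by
  have hs : ∑' v, ENNReal.ofReal (offspringProb ω i j v) = 1 := by
    have h1 := (isOffspringLaw_of_occurs hω hT h).2 1
    simp only [Pi.one_apply, one_pow, Finset.prod_const_one, mul_one] at h1
    have h2 := typeGen_one (ω := ω) (lo := i) 1 j
    rw [Nat.cast_one] at h2
    have h3 : hit ω (i + 1) j * ∑' v, ENNReal.ofReal (offspringProb ω i j v) =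
        hit ω (i + 1) j * 1 := by
      rw [h1, mul_one, ← h2]
      rfl
    exact (ENNReal.mul_right_inj (occurs hT h).1 (hit_ne_top _ _)).1 h3
  have he : offspringLaw ω i j = ⟨fun v => ENNReal.ofReal (offspringProb ω i j v),
      hs ▸ ENNReal.summable.hasSum⟩ := dif_pos hs
  rw [he]
  rfl

lemma offspringLaw_toReal (hω : ∀ i, (ω i).support ⊆ {-2, -1, 1, 2}) (hT : Transient ω)
    {i : ℤ} {j : Fin 9} (h : walkLaw ω 0 {x | U x (i + 1) j ≠ 0} ≠ 0) (v : Fin 9 → ℕ) :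
    (offspringLaw ω i j v).toReal = offspringProb ω i j v := by
  rw [offspringLaw_apply hω hT h,
    ENNReal.toReal_ofReal ((isOffspringLaw_of_occurs hω hT h).1 v)]

lemma tsum_offspringLaw (hω : ∀ i, (ω i).support ⊆ {-2, -1, 1, 2}) (hT : Transient ω)
    {i : ℤ} {j : Fin 9} (h : walkLaw ω 0 {x | U x (i + 1) j ≠ 0} ≠ 0) (s : Fin 9 → ℝ≥0∞) :
    ∑' v, offspringLaw ω i j v * ∏ k, s k ^ v k = offspringGen ω i s j := by
  simp only [offspringLaw_apply hω hT h]
  rw [offspringGen, ENNReal.eq_div_iff (occurs hT h).1 (hit_ne_top _ _)]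
  exact (isOffspringLaw_of_occurs hω hT h).2 s

/-- Given the generations `lo + 1, …, 1`, the generation `lo` is distributed as the offspring of
the generation `lo + 1`. -/
lemma walkLaw_gens_branching (hω : ∀ i, (ω i).support ⊆ {-2, -1, 1, 2}) (hT : Transient ω)
    {lo : ℤ} {m : ℕ} (hm : lo + (m + 1 : ℕ) = 1) (v : Fin (m + 2) → Fin 9 → ℕ) :
    walkLaw ω 0 {x | gens lo (m + 2) x = v} =
      walkLaw ω 0 {x | gens (lo + 1) (m + 1) x = Fin.tail v} *
        totalOffspring (offspringLaw ω lo) (v 1) {v 0} :=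
  walkLaw_gens_succ hω hT hm (fun _ h s _ => tsum_offspringLaw hω hT h s) v

/-- Both laws have the same generating function. -/
lemma totalOffspring_single {τ : Type*} [Fintype τ] [DecidableEq τ] (p : τ → PMF (τ → ℕ)) (j : τ)
    (v : τ → ℕ) : totalOffspring p (Pi.single j 1) {v} = p j v := by
  have key : ∀ s : τ → ℝ≥0∞, ∑' v, totalOffspring p (Pi.single j 1) {v} * ∏ k, s k ^ v k =
      ∑' v, p j v * ∏ k, s k ^ v k := by
    intro s
    rw [tsum_totalOffspring, Finset.prod_eq_single j]
    · simp
    · intro k _ hk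
      simp [hk]
    · simp
  have h1 := key 1
  simp only [Pi.one_apply, one_pow, Finset.prod_const_one, mul_one, PMF.tsum_coe] at h1
  refine congrFun (pgf_ext (f := fun v => totalOffspring p (Pi.single j 1) {v}) (g := p j) ?_ ?_
    fun s _ => key s) v
  · rw [h1]; exact ENNReal.one_ne_top
  · rw [PMF.tsum_coe]; exact ENNReal.one_ne_top

lemma measurableSet_gens_eq (lo : ℤ) (N : ℕ) (v : Fin N → Fin 9 → ℕ) :
    MeasurableSet {x | gens lo N x = v} :=
  measurable_gens lo N (measurableSet_singleton v)

/-- The joint law of two successive generations. -/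
lemma walkLaw_inter_eq (hω : ∀ i, (ω i).support ⊆ {-2, -1, 1, 2}) (hT : Transient ω)
    {i : ℤ} (hi : i ≤ 0) (u v : Fin 9 → ℕ) :
    walkLaw ω 0 ({x | U x (i + 1) = u} ∩ {x | U x i = v}) =
      walkLaw ω 0 {x | U x (i + 1) = u} * totalOffspring (offspringLaw ω i) u {v} := by
  obtain ⟨m, hm⟩ : ∃ m : ℕ, i + (m + 1 : ℕ) = 1 := ⟨(-i).toNat, by push_cast; omega⟩
  -- The variable `w` records the generations above `i + 1`; they are summed out, which is possible
  -- because the offspring factor depends on `u` alone.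
  have hu : {x | U x (i + 1) = u} =
      ⋃ w : Fin m → Fin 9 → ℕ, {x | gens (i + 1) (m + 1) x = Fin.cons u w} := by
    ext x
    simp only [Set.mem_iUnion, Set.mem_ofPred_eq]
    constructor
    · intro hx
      refine ⟨Fin.tail (gens (i + 1) (m + 1) x), ?_⟩
      rw [← hx]
      conv_lhs => rw [← Fin.cons_self_tail (gens (i + 1) (m + 1) x)]
      congr 1
      simp [gens]
    · rintro ⟨w, hw⟩
      have := congrFun hw 0
      simpa [gens] using this
  have huv : {x | U x (i + 1) = u} ∩ {x | U x i = v} =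
      ⋃ w : Fin m → Fin 9 → ℕ, {x | gens i (m + 2) x = Fin.cons v (Fin.cons u w)} := by
    rw [hu, Set.iUnion_inter]
    refine Set.iUnion_congr fun w => ?_
    ext x
    simp only [Set.mem_inter_iff, Set.mem_ofPred_eq, gens_eq_iff]
    rw [Fin.forall_fin_succ (n := m + 1)]
    simp only [Fin.cons_zero, Fin.cons_succ, Fin.val_zero, Fin.val_succ, Nat.cast_zero, add_zero,
      Nat.cast_add, Nat.cast_one]
    rw [and_comm]
    simp only [add_assoc, add_comm (1 : ℤ)]
  have hd : Pairwise (Function.onFun Disjoint fun w : Fin m → Fin 9 → ℕ =>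
      {x | gens (i + 1) (m + 1) x = Fin.cons u w}) := by
    intro w w' hne
    refine Set.disjoint_left.2 fun x h1 h2 => hne ?_
    exact (Fin.cons_injective2 ((h1 : gens _ _ x = _).symm.trans h2)).2
  have hd' : Pairwise (Function.onFun Disjoint fun w : Fin m → Fin 9 → ℕ =>
      {x | gens i (m + 2) x = Fin.cons v (Fin.cons u w)}) := by
    intro w w' hne
    refine Set.disjoint_left.2 fun x h1 h2 => hne ?_
    exact (Fin.cons_injective2 (Fin.cons_injective2 ((h1 : gens _ _ x = _).symm.trans h2)).2).2
  rw [huv, hu, measure_iUnion hd' fun w => measurableSet_gens_eq _ _ _,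
    measure_iUnion hd fun w => measurableSet_gens_eq _ _ _, ← ENNReal.tsum_mul_right]
  refine tsum_congr fun w => ?_
  rw [walkLaw_gens_branching hω hT hm]
  rfl

lemma cond_single_eq (hω : ∀ i, (ω i).support ⊆ {-2, -1, 1, 2}) (hT : Transient ω)
    {i : ℤ} (hi : i ≤ 0) {j : Fin 9}
    (h : walkLaw ω 0 {x | U x (i + 1) = Pi.single j 1} ≠ 0) (v : Fin 9 → ℕ) :
    (ProbabilityTheory.cond (walkLaw ω 0) {x | U x (i + 1) = Pi.single j 1}).real
      {x | U x i = v} = offspringProb ω i j v := by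
  have h' : walkLaw ω 0 {x | U x (i + 1) j ≠ 0} ≠ 0 := by
    refine fun h0 => h (measure_mono_null (fun x hx => ?_) h0)
    have hx' : U x (i + 1) = Pi.single j 1 := hx
    simp [hx']
  have hm : MeasurableSet {x | U x (i + 1) = Pi.single j 1} :=
    measurable_U (i + 1) (measurableSet_singleton _)
  rw [measureReal_def, cond_apply hm,
    walkLaw_inter_eq hω hT hi, ← mul_assoc, ENNReal.inv_mul_cancel h (measure_ne_top _ _), one_mul,
    totalOffspring_single, offspringLaw_toReal hω hT h']

/-- The law of the first generation. -/
noncomputable def immigrationLaw (ω : ℤ → PMF ℤ) : PMF (Fin 9 → ℕ) :=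
  haveI := Measure.isProbabilityMeasure_map (μ := walkLaw ω 0) (measurable_U 1).aemeasurable
  ((walkLaw ω 0).map fun x => U x 1).toPMF

lemma immigrationLaw_apply (v : Fin 9 → ℕ) :
    immigrationLaw ω v = walkLaw ω 0 {x | U x 1 = v} := by
  rw [immigrationLaw, Measure.toPMF_apply,
    Measure.map_apply (measurable_U 1) (measurableSet_singleton _)]
  rfl

lemma isBranchingProcess (hω : ∀ i, (ω i).support ⊆ {-2, -1, 1, 2}) (hT : Transient ω) :
    IsBranchingProcess (walkLaw ω 0) (fun (n : ℕ) x => U x (1 - n)) (immigrationLaw ω)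
      (fun n : ℕ => offspringLaw ω (-n)) where
  measurable n := measurable_U _
  initial v := by simp [immigrationLaw_apply]
  branching n z := by
    -- `gens` lists the levels upwards whereas the process runs downwards from level `1`, hence the
    -- reversed index `N - k`.
    have hg : ∀ N : ℕ, {x : ℕ → ℤ | ∀ m ≤ N, U x (1 - m) = z m} =
        {x | gens (1 - N) (N + 1) x = fun k : Fin (N + 1) => z (N - k)} := by
      intro N
      ext x
      simp only [Set.mem_ofPred_eq, gens_eq_iff]
      constructor
      · intro hx k
        rw [← hx (N - k) (Nat.sub_le _ _)]
        congr 1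
        have := k.is_le
        push_cast [this]
        ring
      · intro hx m hm
        have := hx ⟨N - m, by omega⟩
        simp only [Nat.sub_sub_self hm] at this
        rw [← this]
        congr 1
        push_cast [hm]
        ring
    rw [hg, hg]
    have e : (1 : ℤ) - (n + 1 : ℕ) = -n := by push_cast; ring
    have e' : (1 : ℤ) - n = -n + 1 := by ring
    rw [e, e', walkLaw_gens_branching hω hT (by push_cast; ring)]
    have htail : (Fin.tail fun k : Fin (n + 2) => z (n + 1 - k)) =
        fun k : Fin (n + 1) => z (n - k) := by
      funext k
      simp [Fin.tail]
    rw [htail]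
    simp

/-- At the top level the generating function is linear in the first three variables, so there is
exactly one initial particle. -/
lemma walkLaw_U_one (hω : ∀ i, (ω i).support ⊆ {-2, -1, 1, 2}) (hT : Transient ω)
    (v : Fin 9 → ℕ) : walkLaw ω 0 {x | U x 1 = v} =
      (if v = ![1, 0, 0, 0, 0, 0, 0, 0, 0] then hit ω 1 0 else 0) +
      (if v = ![0, 1, 0, 0, 0, 0, 0, 0, 0] then hit ω 1 1 else 0) +
      (if v = ![0, 0, 1, 0, 0, 0, 0, 0, 0] then hit ω 1 2 else 0) := by
  have hsingle : ∀ (e : Fin 9 → ℕ) (c : ℝ≥0∞) (s : Fin 9 → ℝ≥0∞),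
      ∑' v, (if v = e then c else 0) * ∏ k, s k ^ v k = c * ∏ k, s k ^ e k := by
    intro e c s
    rw [tsum_eq_single e (fun v hv => by simp [hv]), if_pos rfl]
  have key : ∀ s : Fin 9 → ℝ≥0∞, ∑' v, walkLaw ω 0 {x | U x 1 = v} * ∏ k, s k ^ v k =
      ∑' v, ((if v = ![1, 0, 0, 0, 0, 0, 0, 0, 0] then hit ω 1 0 else 0) +
        (if v = ![0, 1, 0, 0, 0, 0, 0, 0, 0] then hit ω 1 1 else 0) +
        (if v = ![0, 0, 1, 0, 0, 0, 0, 0, 0] then hit ω 1 2 else 0)) * ∏ k, s k ^ v k := by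
    intro s
    have h := tsum_gens_eq hω hT (lo := 1) (m := 0) (by simp) (fun _ => s)
    simp only [typeGen_zero] at h
    rw [tsum_add_mul, tsum_add_mul, hsingle, hsingle, hsingle]
    have hleft : ∑' v, walkLaw ω 0 {x | U x 1 = v} * ∏ k, s k ^ v k =
        s 0 * hit ω 1 0 + s 1 * hit ω 1 1 + s 2 * hit ω 1 2 := by
      rw [← h, ← (Equiv.funUnique (Fin 1) (Fin 9 → ℕ)).symm.tsum_eq]
      refine tsum_congr fun v => ?_
      simp [gens_eq_iff]
    rw [hleft]
    simp only [prod_fin_nine (fun k => s k ^ _)]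
    simp [mul_comm]
  have hfin : ∑' v, walkLaw ω 0 {x | U x 1 = v} ≠ ∞ := by
    simp only [← immigrationLaw_apply, PMF.tsum_coe]
    exact ENNReal.one_ne_top
  refine congrFun (pgf_ext (f := fun v => walkLaw ω 0 {x | U x 1 = v}) hfin ?_ fun s _ => key s) v
  have := key 1
  simp only [Pi.one_apply, one_pow, Finset.prod_const_one, mul_one] at this
  rwa [← this]

lemma immigrationDenom_eq (hω : ∀ i, (ω i).support ⊆ {-2, -1, 1, 2}) (hT : Transient ω) :
    immigrationDenom ω = (1 - loopProb ω 0).toReal := by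
  have e1 := exitProb_A hω 0
  have e2 := exitProb_B hω 0
  rw [zero_sub] at e1
  rw [zero_sub, zero_sub] at e2
  have hfin : ∀ l j k, ω 0 l * (hit ω 0 j + hit ω 0 k) ≠ ∞ := fun l j k =>
    ENNReal.mul_ne_top ((ω 0).apply_ne_top _)
      (ENNReal.add_ne_top.2 ⟨hit_ne_top _ _, hit_ne_top _ _⟩)
  rw [ENNReal.toReal_sub_of_le (loopProb_lt_one hω hT reach_zero).le ENNReal.one_ne_top,
    immigrationDenom, e1, e2, loopProb, ENNReal.toReal_add (hfin _ _ _) (hfin _ _ _),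
    ENNReal.toReal_mul, ENNReal.toReal_mul, ENNReal.toReal_one, jump, jump, sub_sub]

lemma immigrationLaw_toReal (hω : ∀ i, (ω i).support ⊆ {-2, -1, 1, 2}) (hT : Transient ω)
    (v : Fin 9 → ℕ) : (immigrationLaw ω v).toReal = immigrationProb ω v := by
  obtain ⟨e0, -, e2, -⟩ := hit_succ hω 0
  rw [zero_add] at e0 e2
  have hD := immigrationDenom_eq hω hT
  have hsum := sum_hit_A hω hT (i := 1) reach_zero
  have hD0 : immigrationDenom ω ≠ 0 := by
    rw [hD]
    exact (ENNReal.toReal_pos (tsub_pos_of_lt (loopProb_lt_one hω hT reach_zero)).ne'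
      (ENNReal.sub_ne_top ENNReal.one_ne_top)).ne'
  have h0 : (hit ω 1 0).toReal = jump ω 0 1 / immigrationDenom ω := by
    rw [e0, hD, ENNReal.toReal_mul, ENNReal.toReal_inv, jump, div_eq_inv_mul]
  have h2 : (hit ω 1 2).toReal = jump ω 0 2 / immigrationDenom ω := by
    rw [e2, hD, ENNReal.toReal_mul, ENNReal.toReal_inv, jump, div_eq_inv_mul]
  have h1 : (hit ω 1 1).toReal = (1 - jump ω 0 1 - jump ω 0 2 -
      jump ω 0 (-1) * exitProb ω (-1) (-1) 0 - jump ω 0 (-2) * exitProb ω (-2) (-1) 0) /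
        immigrationDenom ω := by
    -- The probability of the middle subtype is obtained as the complement of the other two.
    have hsum' := congrArg ENNReal.toReal hsum
    rw [ENNReal.toReal_add (ENNReal.add_ne_top.2 ⟨hit_ne_top _ _, hit_ne_top _ _⟩)
      (hit_ne_top _ _), ENNReal.toReal_add (hit_ne_top _ _) (hit_ne_top _ _), h0, h2,
      ENNReal.toReal_one] at hsum'
    rw [show 1 - jump ω 0 1 - jump ω 0 2 - jump ω 0 (-1) * exitProb ω (-1) (-1) 0 -
      jump ω 0 (-2) * exitProb ω (-2) (-1) 0 = immigrationDenom ω - jump ω 0 1 - jump ω 0 2 by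
        rw [immigrationDenom]; ring, sub_div, sub_div, div_self hD0]
    linarith
  rw [immigrationLaw_apply, walkLaw_U_one hω hT, immigrationProb, ← h0, ← h1, ← h2]
  by_cases hv1 : v = ![1, 0, 0, 0, 0, 0, 0, 0, 0]
  · subst hv1
    simp
  by_cases hv2 : v = ![0, 1, 0, 0, 0, 0, 0, 0, 0]
  · subst hv2
    simp
  by_cases hv3 : v = ![0, 0, 1, 0, 0, 0, 0, 0, 0]
  · subst hv3
    simp
  simp [hv1, hv2, hv3]

end TwoTwoWalk

theorem theorem1p2 (ω : ℤ → PMF ℤ)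
    (hω : ∀ i, (ω i).support ⊆ {-2, -1, 1, 2})
    (hlim : ∀ᵐ x ∂walkLaw ω 0, limsup (fun n : ℕ => ((x n : ℝ) : EReal)) atTop = ⊤) :
    ∃ (init : PMF (Fin 9 → ℕ)) (p : ℤ → Fin 9 → PMF (Fin 9 → ℕ)),
      IsBranchingProcess (walkLaw ω 0) (fun (n : ℕ) x => U x (1 - n)) init
        (fun n : ℕ => p (-n)) ∧
      (∀ v, (init v).toReal = immigrationProb ω v) ∧
      (∀ i ≤ 0, ∀ j : Fin 9, walkLaw ω 0 {x | U x (i + 1) j ≠ 0} ≠ 0 →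
        ∀ v, (p i j v).toReal = offspringProb ω i j v) ∧
      (∀ i ≤ 0, ∀ j : Fin 9, walkLaw ω 0 {x | U x (i + 1) = Pi.single j 1} ≠ 0 →
        ∀ v, (ProbabilityTheory.cond (walkLaw ω 0) {x | U x (i + 1) = Pi.single j 1}).real
          {x | U x i = v} = offspringProb ω i j v) := by
  have hT := transient_of_limsup hlim
  exact ⟨immigrationLaw ω, offspringLaw ω, isBranchingProcess hω hT, immigrationLaw_toReal hω hT,
    fun i _ j h v => offspringLaw_toReal hω hT h v, fun i hi j h v => cond_single_eq hω hT hi h v⟩
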